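/- **Setting.** Let $X, Y_1,\dots,Y_n$ ($n\ge 1$) be (real or complex) Hilbert spaces, let $Y=Y_1\times\cdots\times Y_n$ carry the norm $\|y\|^2=\sum_i\|y_i\|^2$, and let $A_\dagger:X\to Y$ be bounded and linear. For a bounded operator $A=(A_1,\dots,A_n)^T:X\to Y$ put $L=\max_{1\le i\le n}\|A_i\|^2$. Let $y_\dagger=A_\dagger x_\dagger$, where $x_\dagger$ is the minimum-norm solution relative to $x_0\in X$ (i.e. $\|x_\dagger-x_0\|\le\|x-x_0\|$ whenever $A_\dagger x=y_\dagger$), and let $y^\delta\in Y$ with $\delta=\|y^\delta-y_\dagger\|<1$. For $c_0>0$, an integer $M\ge1$ and indices $i_0,i_1,\dots$ drawn independently and uniformly from $\{1,\dots,n\}$, define the (r)SVRG iterates by $x^\delta_0=x_0$ and, with $z_k=x^\delta_{[k/M]M}$, $$x_{k+1}^\delta=x_k^\delta-c_0\Big(A_{i_k}^*A_{i_k}(x_k^\delta-z_k)+\tfrac1nA^*(Az_k-y^\delta)\Big),\qquad e_k^\delta=x_k^\delta-x_\dagger .$$ Assume: (i) $c_0L\le 1$; (ii) $x_\dagger-x_0=B_\dagger^{\nu}w$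 with $\nu>0$, $w\in\mathcal N(A_\dagger)^\perp$ and $B_\dagger=n^{-1}A_\dagger^*A_\dagger$; (iii) $a\ge0$, and: if $a=0$ then $A=A_\dagger$ (SVRG); if $a>0$ then $\delta>0$, $A_\dagger$ is compact and $A$ is its truncated SVD, keeping exactly the terms with singular values $\sigma_j\ge a\delta^{b}$, where $b=(1+2\nu)^{-1}$ (rSVRG). Let $$\overline{C_0}=\max\Big(\|A\|^{-1}(5Ln^{-1}M)^{-1/2},\,L^{-1}(10+\ln M)^{-1}\Big),\qquad C_0=\Big(100\sqrt L\,M\|A\|\ln\big(2e^2n\sqrt L\,\|A\|^{-1}\big)\Big)^{-1},$$ both read as $+\infty$ if $A=0$, and let $$N_k=\delta^{\frac{2\nu}{1+2\nu}}\ \text{ if } a>0,\qquad N_k=n^{-1/2}\sqrt k\,\delta\ \text{ if } a=0 .$$ **Theorem 2.1.** There is a constant $c^*$, depending only on $\nu$, $a$, $c_0$, $M$ and upper bounds for $\|A_\dagger\|$ and $\|w\|$ (in particular independent of $k$, $n$ and $\delta$), such that: 1. if $c_0<\overline{C_0}$, then for all $k\ge1$, $\ \mathbb E[\|e_k^\delta\|^2]^{1/2}\le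 c^*k^{-\min(\nu,\frac12)}+c^*N_k$; 2. if $c_0<C_0$, then for every realization of the indices, $\ \|e_k^\delta\|\le\sqrt n\,c^*k^{-\nu}+c^*N_k$ for all $k\ge1$ when $\nu<\frac12$, and $\ \|e_k^\delta\|\le\sqrt n\,c^*k^{-\frac12}\ln k+c^*N_k$ for all $k\ge2$ when $\nu\ge\frac12$. (Both cases are $\sqrt n\,c^*k^{-\frac12+\max(\frac12-\nu,0)}+c^*N_k$ with the convention $k^0:=\ln k$.) -/

import Mathlib

open MeasureTheory ProbabilityTheory Filter Topology
open scoped ENNReal InnerProductSpace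

universe u v w

noncomputable section

namespace SVRG

/-- The filter of real polynomials `p` tending to `t ↦ t ^ ν` uniformly on `[0, β]`. -/
def polyToPow (β ν : ℝ) : Filter (Polynomial ℝ) :=
  ⨅ ε ∈ Set.Ioi (0 : ℝ), 𝓟 {p | ∀ t ∈ Set.Icc 0 β, |p.eval t - t ^ ν| ≤ ε}

section Operators

variable {𝕜 : Type*} [RCLike 𝕜]
variable {X : Type*} [NormedAddCommGroup X] [InnerProductSpace 𝕜 X]

/-- The fractional power `B ^ ν` (`ν > 0`) of a positive bounded operator `B` on a real or complex
Hilbert space, by the continuous functional calculus: the operator norm limit of `p(B)` as the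
polynomial `p` tends to `t ^ ν` uniformly on `[0, ‖B‖]`, an interval that contains the spectrum. -/
def opPow (B : X →L[𝕜] X) (ν : ℝ) : X →L[𝕜] X :=
  limUnder (polyToPow ‖B‖ ν)
    fun p : Polynomial ℝ => Polynomial.aeval B (p.map (algebraMap ℝ 𝕜))

/-- A singular system of `T`: `T x = ∑ⱼ σⱼ ⟪φⱼ, x⟫ ψⱼ` with `σ` nonnegative and non-increasing and
with `φ`, `ψ` orthonormal. Where `σⱼ = 0` the vectors play no role and are unconstrained, so that
operators of finite rank (and finite-dimensional spaces) are covered. -/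
structure IsSingularSystem {Y : Type*} [NormedAddCommGroup Y] [InnerProductSpace 𝕜 Y]
    (T : X →L[𝕜] Y) (σ : ℕ → ℝ) (φ : ℕ → X) (ψ : ℕ → Y) : Prop where
  nonneg : ∀ j, 0 ≤ σ j
  antitone : Antitone σ
  orthonormal_left : Orthonormal 𝕜 fun j : {j : ℕ // σ j ≠ 0} => φ j
  orthonormal_right : Orthonormal 𝕜 fun j : {j : ℕ // σ j ≠ 0} => ψ j
  hasSum : ∀ x, HasSum (fun j => ((σ j : 𝕜) * ⟪φ j, x⟫_𝕜) • ψ j) (T x)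

/-- `A` is the truncated singular value decomposition of the compact operator `T` at level `τ`:
exactly the terms with singular value at least `τ > 0` are kept. -/
def IsTruncatedSVD {Y : Type*} [NormedAddCommGroup Y] [InnerProductSpace 𝕜 Y]
    (T A : X →L[𝕜] Y) (τ : ℝ) : Prop :=
  0 < τ ∧ IsCompactOperator T ∧
    ∃ (σ : ℕ → ℝ) (φ : ℕ → X) (ψ : ℕ → Y) (J : ℕ), IsSingularSystem T σ φ ψ ∧
      (∀ j < J, τ ≤ σ j) ∧ (∀ j, J ≤ j → σ j < τ) ∧
      ∀ x, A x = ∑ j ∈ Finset.range J, ((σ j : 𝕜) * ⟪φ j, x⟫_𝕜) • ψ j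

variable {n : ℕ} {Y : Fin n → Type*} [∀ i, NormedAddCommGroup (Y i)]
  [∀ i, InnerProductSpace 𝕜 (Y i)]

/-- The `i`-th component `Aᵢ : X → Yᵢ` of `A : X → Y = Y₁ × ⋯ × Yₙ`, where the product carries the
Hilbert norm `‖y‖² = ∑ᵢ ‖yᵢ‖²`. -/
def comp (A : X →L[𝕜] PiLp 2 Y) (i : Fin n) : X →L[𝕜] Y i :=
  (PiLp.proj 2 Y i).comp A

/-- `L = maxᵢ ‖Aᵢ‖²`. -/
def maxNormSq (A : X →L[𝕜] PiLp 2 Y) : ℝ := ⨆ i, ‖comp A i‖ ^ 2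

/-- The threshold `max (‖A‖⁻¹ (5 L n⁻¹ M)^(-1/2), L⁻¹ (10 + ln M)⁻¹)` for the step size in the
mean-square bound. It takes values in `[0, ∞]`, with value `∞` if `A = 0`. -/
def stepBoundMean (A : X →L[𝕜] PiLp 2 Y) (M : ℕ) : ℝ≥0∞ :=
  max (ENNReal.ofReal (‖A‖ * √(5 * maxNormSq A * (n : ℝ)⁻¹ * M)))⁻¹
    (ENNReal.ofReal (maxNormSq A * (10 + Real.log M)))⁻¹

/-- The threshold `(100 √L M ‖A‖ ln (2 e² n √L ‖A‖⁻¹))⁻¹` for the step size in the pathwise bound.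
It takes values in `[0, ∞]`, with value `∞` if `A = 0`. -/
def stepBoundPath (A : X →L[𝕜] PiLp 2 Y) (M : ℕ) : ℝ≥0∞ :=
  (ENNReal.ofReal (100 * √(maxNormSq A) * M * ‖A‖ *
    Real.log (2 * Real.exp 2 * n * √(maxNormSq A) * ‖A‖⁻¹)))⁻¹

variable [CompleteSpace X] [∀ i, CompleteSpace (Y i)]

/-- `B = n⁻¹ A* A`. -/
def normalOp (A : X →L[𝕜] PiLp 2 Y) : X →L[𝕜] X :=
  ((n : 𝕜)⁻¹) • (A.adjoint.comp A)

/-- The (r)SVRG iterates with operator `A`, data `y`, initial guess `x₀`, step sizes `η`, frequency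
`M` of the full gradient and sampled indices `i₀, i₁, …`. With the anchor point `z = x_{[k/M] M}`,
`x_{k+1} = x_k - η_k (A_{i_k}* A_{i_k} (x_k - z) + n⁻¹ A* (A z - y))`. -/
def iterate (A : X →L[𝕜] PiLp 2 Y) (y : PiLp 2 Y) (x₀ : X) (η : ℕ → ℝ) (M : ℕ)
    (idx : ℕ → Fin n) : ℕ → X
  | 0 => x₀
  | k + 1 =>
    iterate A y x₀ η M idx k - (η k : 𝕜) •
      ((comp A (idx k)).adjoint (comp A (idx k)
          (iterate A y x₀ η M idx k - iterate A y x₀ η M idx (k / M * M))) +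
        ((n : 𝕜)⁻¹) • A.adjoint (A (iterate A y x₀ η M idx (k / M * M)) - y))
  termination_by k => k
  decreasing_by all_goals first | exact Nat.lt_succ_self _ | exact Nat.lt_succ_of_le (Nat.div_mul_le_self _ _)

end Operators

/-- The power `k ^ s` with the convention `k ^ 0 = ln k`. -/
def powLog (k : ℕ) (s : ℝ) : ℝ := if s = 0 then Real.log k else (k : ℝ) ^ s

/-- The noise term: `δ^(2ν/(1+2ν))` for rSVRG (`a > 0`) and `n^(-1/2) √k δ` for SVRG (`a = 0`). -/
def noiseTerm (a ν δ : ℝ) (n k : ℕ) : ℝ :=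
  if 0 < a then δ ^ (2 * ν / (1 + 2 * ν)) else (n : ℝ) ^ (-(1 / 2) : ℝ) * √k * δ

/-- `i₀, i₁, …` are independent and uniformly distributed on the `n` indices. -/
def IsUniformSampling {Ω : Type*} [MeasurableSpace Ω] (P : Measure Ω) {n : ℕ}
    (idx : ℕ → Ω → Fin n) : Prop :=
  (∀ k, Measurable (idx k)) ∧ iIndepFun idx P ∧ ∀ k i, P (idx k ⁻¹' {i}) = (n : ℝ≥0∞)⁻¹

section Problem

variable {𝕜 : Type*} [RCLike 𝕜]
variable {X : Type*} [NormedAddCommGroup X] [InnerProductSpace 𝕜 X] [CompleteSpace X]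
variable {n : ℕ} {Y : Fin n → Type*} [∀ i, NormedAddCommGroup (Y i)]
  [∀ i, InnerProductSpace 𝕜 (Y i)] [∀ i, CompleteSpace (Y i)]

/-- `xd` is the minimum-norm solution of `T x = y` relative to `x₀`. -/
def IsMinNormSolution (T : X →L[𝕜] PiLp 2 Y) (y : PiLp 2 Y) (x₀ xd : X) : Prop :=
  T xd = y ∧ ∀ x, T x = y → ‖xd - x₀‖ ≤ ‖x - x₀‖

/-- The source condition `xd - x₀ = B ^ ν w` with `B = n⁻¹ T* T` and `w ∈ N(T)ᗮ`. -/
def SourceCondition (T : X →L[𝕜] PiLp 2 Y) (x₀ xd w : X) (ν : ℝ) : Prop :=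
  w ∈ (LinearMap.ker (T : X →ₗ[𝕜] PiLp 2 Y))ᗮ ∧ xd - x₀ = opPow (normalOp T) ν w

/-- The operator `A` run by the method: `A = T` if `a = 0` (SVRG), and the truncated singular value
decomposition of the compact operator `T` at level `a δ^b` if `a > 0` (rSVRG). -/
def IsMethodOperator (T A : X →L[𝕜] PiLp 2 Y) (a b δ : ℝ) : Prop :=
  (a = 0 → A = T) ∧ (0 < a → IsTruncatedSVD T A (a * δ ^ b))

end Problem

end SVRG

end

/-! With B = n⁻¹A*A and the drift Δ_k = x_k - x_{[k/M]M}, the error satisfies a Landweber recursion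
e_{k+1} = (1 - cB)e_k + cb + c(B - A_i*A_i)Δ_k, i = i_k, where b = n⁻¹A*(y^δ - y†). Unrolling it
(`error_eq`) splits e_k into the deterministic Landweber error and a sum of propagated gradient
noise.

The deterministic part (`norm_landweberError_le`) is classical: the source condition gives k^(-ν),
and the data error gives the noise term. The truncated SVD enters only through an orthogonal
projection P commuting with T*T with A = TP (`IsSpectralCutoff`). The discarded part of x† - x₀ has
size at most τ^(2ν)‖w‖ and the amplified data error at most δ/τ; τ = aδ^b makes both of the order of
the noise term.

The gradient noise is controlled by AΔ_j, so everything hinges on the decay of the drift. The drift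
solves a Volterra equation in its own past (`drift_eq`). Noise from before the anchor reaches it
through a difference of two Landweber propagators, hence with an extra factor 1 - (1 - ct)^m ≤ Mct,
which makes the kernel summable. The step size bounds make the kernel a contraction for suitable
weights, and a Gronwall argument (`le_mul_of_sum_le`) transfers the decay of the deterministic drift
to the actual one.

In mean square the noises are martingale differences and only their squares add up. Averaging over
the index yields a factor 1/n that cancels the n in the operator bounds. The drift kernel decays
like p⁻³, so E‖AΔ_k‖² ≲ k^(-3/2); convolution with 1/(k - j) gives a stochastic mean square error ≲
1/k. On a single path norms add up: ‖A_iΔ_k‖ ≲ 1/k for all i, and convolution with (k - j)^(-1/2)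
gives √n k^(-1/2) ln k.

All operator estimates reduce to scalar maxima on [0, ‖A‖²/n]: ‖p(B)‖ ≤ max|p| (`norm_polyAt_le`),
and ‖A q(B)‖² ≤ n max t q(t)² (`norm_apply_polyAt_le`). -/

noncomputable section

namespace SVRG

/-! ### Polynomials of a positive operator and their norms -/

section PolynomialCalculus

variable {𝕜 : Type*} [RCLike 𝕜]
variable {X : Type*} [NormedAddCommGroup X] [InnerProductSpace 𝕜 X]

/-- The evaluation `p ↦ p(B)` of real polynomials at a bounded operator. -/
def polyAt (B : X →L[𝕜] X) : Polynomial ℝ →+* (X →L[𝕜] X) :=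
  (Polynomial.aeval B).toRingHom.comp (Polynomial.mapRingHom (algebraMap ℝ 𝕜))

theorem polyAt_apply (B : X →L[𝕜] X) (p : Polynomial ℝ) :
    polyAt B p = Polynomial.aeval B (p.map (algebraMap ℝ 𝕜)) := rfl

@[simp]
theorem polyAt_X (B : X →L[𝕜] X) : polyAt B Polynomial.X = B := by
  simp [polyAt_apply]

@[simp]
theorem polyAt_C (B : X →L[𝕜] X) (r : ℝ) : polyAt B (Polynomial.C r) = (r : 𝕜) • 1 := by
  simp [polyAt_apply, Algebra.algebraMap_eq_smul_one]

theorem polyAt_intertwine {Z : Type*} [NormedAddCommGroup Z] [InnerProductSpace 𝕜 Z]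
    {B : X →L[𝕜] X} {S : Z →L[𝕜] Z} {F : X →L[𝕜] Z} (h : ∀ x, F (B x) = S (F x))
    (p : Polynomial ℝ) (x : X) : F (polyAt B p x) = polyAt S p (F x) := by
  induction p using Polynomial.induction_on' generalizing x with
  | add p q hp hq => simp [hp, hq]
  | monomial m r =>
    have hm : ∀ x, F (B^[m] x) = S^[m] (F x) := fun x =>
      (Function.Semiconj.iterate_right (fun x => h x) m) x
    simp [← Polynomial.C_mul_X_pow_eq_monomial, map_mul, map_pow, hm]

theorem isSymmetric_polyAt {B : X →L[𝕜] X} (hB : B.IsPositive) (p : Polynomial ℝ) (x y : X) :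
    ⟪polyAt B p x, y⟫_𝕜 = ⟪x, polyAt B p y⟫_𝕜 := by
  induction p using Polynomial.induction_on' generalizing x y with
  | add p q hp hq => simp [hp, hq, inner_add_left, inner_add_right]
  | monomial m r =>
    have hm : ∀ m : ℕ, ∀ x y, ⟪B^[m] x, y⟫_𝕜 = ⟪x, B^[m] y⟫_𝕜 := by
      intro m
      induction m with
      | zero => simp
      | succ m ih =>
        intro x y
        rw [Function.iterate_succ_apply, ih, hB.inner_left_eq_inner_right,
          ← Function.iterate_succ_apply' (⇑B)]
    simp [← Polynomial.C_mul_X_pow_eq_monomial, map_mul, map_pow, hm, inner_smul_left,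
      inner_smul_right]

theorem polyAt_mul_apply (B : X →L[𝕜] X) (p q : Polynomial ℝ) (x : X) :
    polyAt B (p * q) x = polyAt B p (polyAt B q x) := by
  simp [map_mul]

theorem exists_bound_below_sub {B : X →L[𝕜] X} (hB : B.IsPositive) {β r : ℝ} (hβ : ‖B‖ ≤ β)
    (hr : r ∉ Set.Icc 0 β) : ∃ c > 0, ∀ x, c * ‖x‖ ≤ ‖polyAt B (Polynomial.X - Polynomial.C r) x‖ := by
  have hval : ∀ x, polyAt B (Polynomial.X - Polynomial.C r) x = B x - (r : 𝕜) • x := by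
    intro x; simp
  rw [Set.mem_Icc, not_and_or, not_le, not_le] at hr
  rcases hr with hr | hr
  · refine ⟨-r, by linarith, fun x => ?_⟩
    rw [hval]
    rcases eq_or_ne x 0 with rfl | hx
    · simp
    have h1 : RCLike.re ⟪B x - (r : 𝕜) • x, x⟫_𝕜 ≤ ‖B x - (r : 𝕜) • x‖ * ‖x‖ :=
      re_inner_le_norm _ _
    have h2 : RCLike.re ⟪B x - (r : 𝕜) • x, x⟫_𝕜 = RCLike.re ⟪B x, x⟫_𝕜 - r * ‖x‖ ^ 2 := by
      rw [inner_sub_left, inner_smul_left, map_sub, inner_self_eq_norm_sq_to_K, RCLike.conj_ofReal]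
      norm_cast
    have h3 := hB.re_inner_nonneg_left x
    have hx' : 0 < ‖x‖ := norm_pos_iff.mpr hx
    have : (-r * ‖x‖) * ‖x‖ ≤ ‖B x - (r : 𝕜) • x‖ * ‖x‖ := by nlinarith
    exact le_of_mul_le_mul_right this hx'
  · refine ⟨r - β, by linarith, fun x => ?_⟩
    rw [hval]
    have h1 : ‖(r : 𝕜) • x‖ - ‖B x‖ ≤ ‖B x - (r : 𝕜) • x‖ := by
      rw [norm_sub_rev]; exact norm_sub_norm_le _ _
    have h2 : ‖B x‖ ≤ β * ‖x‖ := (B.le_opNorm x).trans (by gcongr)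
    have h3 : ‖(r : 𝕜) • x‖ = r * ‖x‖ := by
      rw [norm_smul, RCLike.norm_ofReal, abs_of_pos]
      linarith [norm_nonneg B]
    linarith

/-- The operator is S² + b² with S = B - a symmetric, and S² ≥ 0. -/
theorem exists_bound_below_quadratic {B : X →L[𝕜] X} (hB : B.IsPositive) {a b : ℝ} (hb : b ≠ 0) :
    ∃ c > 0, ∀ x, c * ‖x‖ ≤ ‖polyAt B
      ((Polynomial.X - Polynomial.C a) ^ 2 + Polynomial.C (b ^ 2)) x‖ := by
  refine ⟨b ^ 2, by positivity, fun x => ?_⟩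
  rcases eq_or_ne x 0 with rfl | hx
  · simp
  set S := polyAt B (Polynomial.X - Polynomial.C a) with hS
  have hval : polyAt B ((Polynomial.X - Polynomial.C a) ^ 2 + Polynomial.C (b ^ 2)) x
      = S (S x) + ((b ^ 2 : ℝ) : 𝕜) • x := by
    rw [map_add, map_pow, polyAt_C, pow_two]; rfl
  rw [hval]
  have h1 : RCLike.re ⟪S (S x) + ((b ^ 2 : ℝ) : 𝕜) • x, x⟫_𝕜
      ≤ ‖S (S x) + ((b ^ 2 : ℝ) : 𝕜) • x‖ * ‖x‖ := re_inner_le_norm _ _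
  have h2 : RCLike.re ⟪S (S x) + ((b ^ 2 : ℝ) : 𝕜) • x, x⟫_𝕜 = ‖S x‖ ^ 2 + b ^ 2 * ‖x‖ ^ 2 := by
    rw [inner_add_left, inner_smul_left, map_add, isSymmetric_polyAt hB,
      inner_self_eq_norm_sq_to_K, inner_self_eq_norm_sq_to_K, RCLike.conj_ofReal]
    norm_cast
  have hx' : 0 < ‖x‖ := norm_pos_iff.mpr hx
  refine le_of_mul_le_mul_right ?_ hx'
  nlinarith [sq_nonneg ‖S x‖]

/-- A weak form of spectral mapping: over ℝ the polynomial splits into linear factors with roots off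
[0, β] and irreducible quadratic factors. Each is bounded below at B, and such bounds multiply. -/
theorem exists_bound_below {B : X →L[𝕜] X} (hB : B.IsPositive) {β : ℝ} (hβ : ‖B‖ ≤ β)
    (p : Polynomial ℝ) (hp : p ≠ 0) (h : ∀ t ∈ Set.Icc 0 β, p.eval t ≠ 0) :
    ∃ c > 0, ∀ x, c * ‖x‖ ≤ ‖polyAt B p x‖ := by
  induction hd : p.natDegree using Nat.strong_induction_on generalizing p with
  | _ d ih =>
    have step : ∀ q g : Polynomial ℝ, p = q * g → 0 < q.natDegree →
        (∃ c > 0, ∀ x, c * ‖x‖ ≤ ‖polyAt B q x‖) → ∃ c > 0, ∀ x, c * ‖x‖ ≤ ‖polyAt B p x‖ := by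
      rintro q g rfl hq ⟨c, hc, hcx⟩
      have hg : g ≠ 0 := right_ne_zero_of_mul hp
      have hq0 : q ≠ 0 := left_ne_zero_of_mul hp
      obtain ⟨c', hc', hcx'⟩ := ih g.natDegree
        (by rw [← hd, Polynomial.natDegree_mul hq0 hg]; omega) g hg
        (fun t ht h0 => h t ht (by simp [h0])) rfl
      refine ⟨c * c', by positivity, fun x => ?_⟩
      rw [polyAt_mul_apply, mul_assoc]
      exact (mul_le_mul_of_nonneg_left (hcx' x) hc.le).trans (hcx _)
    rcases Nat.eq_zero_or_pos p.natDegree with h0 | hpos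
    · obtain ⟨r, rfl⟩ : ∃ r, p = Polynomial.C r := ⟨_, Polynomial.eq_C_of_natDegree_eq_zero h0⟩
      have hr : r ≠ 0 := by rintro rfl; simp at hp
      refine ⟨|r|, abs_pos.mpr hr, fun x => ?_⟩
      simp [norm_smul]
    · obtain ⟨z, hz⟩ := Complex.exists_root (f := p.map (algebraMap ℝ ℂ))
        (by rw [Polynomial.degree_map]; exact Polynomial.natDegree_pos_iff_degree_pos.mp hpos)
      have hz' : Polynomial.aeval z p = 0 := by
        rwa [Polynomial.IsRoot, Polynomial.eval_map_algebraMap] at hz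
      by_cases him : z.im = 0
      · have hroot : p.eval z.re = 0 := by
          have hzre : z = ((z.re : ℝ) : ℂ) := Complex.ext rfl (by simp [him])
          rw [hzre, ← Complex.coe_algebraMap, Polynomial.aeval_algebraMap_apply] at hz'
          simpa using hz'
        obtain ⟨g, hg⟩ := Polynomial.dvd_iff_isRoot.mpr hroot
        refine step _ g hg (by simp) (exists_bound_below_sub hB hβ fun hmem => h _ hmem hroot)
      · obtain ⟨g, hg⟩ := p.quadratic_dvd_of_aeval_eq_zero_im_ne_zero hz' him
        have hquad : Polynomial.X ^ 2 - Polynomial.C (2 * z.re) * Polynomial.X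
            + Polynomial.C (‖z‖ ^ 2)
            = (Polynomial.X - Polynomial.C z.re) ^ 2 + Polynomial.C (z.im ^ 2) := by
          rw [Complex.sq_norm, Complex.normSq_apply]
          simp only [map_mul, map_add, map_pow, map_ofNat]
          ring
        rw [hquad] at hg
        refine step _ g hg ?_ (exists_bound_below_quadratic hB him)
        have : ((Polynomial.X - Polynomial.C z.re) ^ 2 + Polynomial.C (z.im ^ 2)).natDegree = 2 := by
          rw [Polynomial.natDegree_add_C, Polynomial.natDegree_pow, Polynomial.natDegree_X_sub_C]
        omega

/-- The norm of `p(B)` is at most the maximum of `|p|` on an interval containing the spectrum. -/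
theorem norm_polyAt_le {B : X →L[𝕜] X} (hB : B.IsPositive) {β K : ℝ} (hβ : ‖B‖ ≤ β)
    (p : Polynomial ℝ) (h : ∀ t ∈ Set.Icc 0 β, |p.eval t| ≤ K) : ‖polyAt B p‖ ≤ K := by
  have hβ0 : 0 ≤ β := (norm_nonneg B).trans hβ
  have hK : 0 ≤ K := (abs_nonneg _).trans (h 0 ⟨le_rfl, hβ0⟩)
  by_contra! hlt
  set S := polyAt B p with hS
  -- If K < ‖S‖, then f has no zero on [0, β], so S² - ‖S‖² is bounded below. But ‖S‖² is always an
  -- approximate eigenvalue of S² for symmetric S; `key` is the quantitative form of this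
  -- contradiction.
  set f : Polynomial ℝ := p ^ 2 - Polynomial.C (‖S‖ ^ 2) with hf
  have hfneg : ∀ t ∈ Set.Icc 0 β, f.eval t < 0 := by
    intro t ht
    have h1 := h t ht
    have : p.eval t ^ 2 ≤ K ^ 2 := sq_le_sq' (by linarith [abs_le.mp h1]) (abs_le.mp h1).2
    simp only [hf, Polynomial.eval_sub, Polynomial.eval_pow, Polynomial.eval_C]
    nlinarith
  have hf0 : f ≠ 0 := by
    intro h0
    have := hfneg 0 ⟨le_rfl, hβ0⟩
    simp [h0] at this
  obtain ⟨c, hc, hcx⟩ := exists_bound_below hB hβ f hf0 fun t ht => (hfneg t ht).ne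
  have hfx : ∀ x, polyAt B f x = S (S x) - ((‖S‖ ^ 2 : ℝ) : 𝕜) • x := by
    intro x
    rw [hf, map_sub, map_pow, polyAt_C, pow_two]; rfl
  have hSpos : 0 < ‖S‖ := hK.trans_lt hlt
  have key : ∀ x, ‖S x‖ ^ 2 * (2 * ‖S‖ ^ 2) ≤ (2 * ‖S‖ ^ 4 - c ^ 2) * ‖x‖ ^ 2 := by
    intro x
    have h1 : ‖polyAt B f x‖ ^ 2
        = ‖S (S x)‖ ^ 2 - 2 * (‖S‖ ^ 2 * ‖S x‖ ^ 2) + (‖S‖ ^ 2 * ‖x‖) ^ 2 := by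
      rw [hfx, @norm_sub_sq 𝕜, inner_smul_right, norm_smul, isSymmetric_polyAt hB,
        inner_self_eq_norm_sq_to_K, RCLike.norm_ofReal, abs_of_nonneg (sq_nonneg ‖S‖)]
      norm_cast
    have h2 : ‖S (S x)‖ ≤ ‖S‖ * (‖S‖ * ‖x‖) :=
      (S.le_opNorm _).trans (mul_le_mul_of_nonneg_left (S.le_opNorm _) (norm_nonneg _))
    have h3 : ‖S (S x)‖ ^ 2 ≤ (‖S‖ * (‖S‖ * ‖x‖)) ^ 2 := by gcongr
    have h4 : (c * ‖x‖) ^ 2 ≤ ‖polyAt B f x‖ ^ 2 := by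
      have := hcx x
      gcongr
    nlinarith
  have hbound : ‖S‖ ≤ √(‖S‖ ^ 2 - c ^ 2 / (2 * ‖S‖ ^ 2)) := by
    refine S.opNorm_le_bound (Real.sqrt_nonneg _) fun x => ?_
    rcases eq_or_ne x 0 with rfl | hx
    · simp
    have hx' : 0 < ‖x‖ := norm_pos_iff.mpr hx
    have h5 : ‖S x‖ ^ 2 ≤ (‖S‖ ^ 2 - c ^ 2 / (2 * ‖S‖ ^ 2)) * ‖x‖ ^ 2 := by
      have h6 : (‖S‖ ^ 2 - c ^ 2 / (2 * ‖S‖ ^ 2)) * ‖x‖ ^ 2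
          = (2 * ‖S‖ ^ 4 - c ^ 2) * ‖x‖ ^ 2 / (2 * ‖S‖ ^ 2) := by
        field_simp
      rw [h6, le_div_iff₀ (by positivity)]
      exact key x
    calc ‖S x‖ = √(‖S x‖ ^ 2) := (Real.sqrt_sq (norm_nonneg _)).symm
      _ ≤ √((‖S‖ ^ 2 - c ^ 2 / (2 * ‖S‖ ^ 2)) * ‖x‖ ^ 2) := Real.sqrt_le_sqrt h5
      _ = _ := by rw [Real.sqrt_mul' _ (sq_nonneg _), Real.sqrt_sq hx'.le]
  have hlt' : √(‖S‖ ^ 2 - c ^ 2 / (2 * ‖S‖ ^ 2)) < ‖S‖ := by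
    rw [Real.sqrt_lt' hSpos]
    have : 0 < c ^ 2 / (2 * ‖S‖ ^ 2) := by positivity
    linarith
  linarith

theorem norm_polyAt_apply_le {B : X →L[𝕜] X} (hB : B.IsPositive) {β K : ℝ} (hβ : ‖B‖ ≤ β)
    (p : Polynomial ℝ) (h : ∀ t ∈ Set.Icc 0 β, |p.eval t| ≤ K) (x : X) :
    ‖polyAt B p x‖ ≤ K * ‖x‖ :=
  ((polyAt B p).le_opNorm x).trans
    (mul_le_mul_of_nonneg_right (norm_polyAt_le hB hβ p h) (norm_nonneg x))

end PolynomialCalculus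

/-! ### Fractional powers as norm limits of polynomials -/

section FractionalPower

variable {𝕜 : Type*} [RCLike 𝕜]
variable {X : Type*} [NormedAddCommGroup X] [InnerProductSpace 𝕜 X]

theorem mem_polyToPow {β ν ε : ℝ} (hε : 0 < ε) :
    {p : Polynomial ℝ | ∀ t ∈ Set.Icc 0 β, |p.eval t - t ^ ν| ≤ ε} ∈ polyToPow β ν :=
  mem_iInf_of_mem ε (mem_iInf_of_mem hε (mem_principal_self _))

/-- The basic sets are directed, and nonempty by Weierstrass approximation. -/
theorem polyToPow_neBot {β ν : ℝ} (hν : 0 < ν) : (polyToPow β ν).NeBot := by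
  rw [polyToPow, iInf_subtype']
  have : Nonempty (Set.Ioi (0 : ℝ)) := ⟨⟨1, Set.mem_Ioi.mpr one_pos⟩⟩
  refine iInf_neBot_of_directed' ?_ ?_
  · rintro ⟨a, ha⟩ ⟨b, hb⟩
    refine ⟨⟨min a b, Set.mem_Ioi.mpr (lt_min ha hb)⟩, ?_, ?_⟩
    · exact principal_mono.mpr fun p hp t ht => (hp t ht).trans (min_le_left _ _)
    · exact principal_mono.mpr fun p hp t ht => (hp t ht).trans (min_le_right _ _)
  · rintro ⟨ε, hε⟩
    rw [principal_neBot_iff]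
    obtain ⟨p, hp⟩ := exists_polynomial_near_of_continuousOn 0 β (fun t => t ^ ν)
      (continuousOn_id.rpow_const fun _ _ => Or.inr hν.le) ε hε
    exact ⟨p, fun t ht => (hp t ht).le⟩

variable [CompleteSpace X]

/-- By `norm_polyAt_le`, polynomials uniformly close on [0, ‖B‖] have close values at B, so the
family is Cauchy. This shows that the `limUnder` in `opPow` is a genuine limit. -/
theorem tendsto_opPow {B : X →L[𝕜] X} (hB : B.IsPositive) {ν : ℝ} (hν : 0 < ν) :
    Tendsto (fun p : Polynomial ℝ => polyAt B p) (polyToPow ‖B‖ ν) (𝓝 (opPow B ν)) := by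
  have hne := polyToPow_neBot (β := ‖B‖) hν
  have hcauchy : Cauchy (map (fun p : Polynomial ℝ => polyAt B p) (polyToPow ‖B‖ ν)) := by
    rw [Metric.cauchy_iff]
    refine ⟨inferInstance, fun ε hε => ⟨_, image_mem_map (mem_polyToPow (half_pos (half_pos hε))), ?_⟩⟩
    rintro _ ⟨p, hp, rfl⟩ _ ⟨q, hq, rfl⟩
    have h : ‖polyAt B (p - q)‖ ≤ ε / 2 := by
      refine norm_polyAt_le hB le_rfl _ fun t ht => ?_
      have h1 := abs_le.mp (hp t ht)
      have h2 := abs_le.mp (hq t ht)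
      rw [Polynomial.eval_sub, abs_le]
      constructor <;> linarith
    rw [dist_eq_norm, ← map_sub]
    linarith
  obtain ⟨T, hT⟩ := CompleteSpace.complete hcauchy
  exact tendsto_nhds_limUnder ⟨T, hT⟩

/-- If `P` intertwines `B` with a positive operator `C` of no larger norm, then `q(C) P B^ν` is
controlled by the maximum of `|q(t)| t^ν` on `[0, ‖C‖]`. -/
theorem norm_polyAt_opPow_le {B C P : X →L[𝕜] X} (hB : B.IsPositive) (hC : C.IsPositive)
    (hCB : ‖C‖ ≤ ‖B‖) (hP : ∀ x, P (B x) = C (P x)) (hP1 : ‖P‖ ≤ 1) {ν K : ℝ} (hν : 0 < ν)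
    (q : Polynomial ℝ) (hq : ∀ t ∈ Set.Icc 0 ‖C‖, |q.eval t| * t ^ ν ≤ K) (w : X) :
    ‖polyAt C q (P (opPow B ν w))‖ ≤ K * ‖w‖ := by
  have hne := polyToPow_neBot (β := ‖B‖) hν
  obtain ⟨m, hm⟩ := isCompact_Icc.exists_bound_of_continuousOn
    (f := fun t => q.eval t) (s := Set.Icc 0 ‖C‖) q.continuous.continuousOn
  have hm0 : 0 ≤ m := (norm_nonneg _).trans (hm 0 ⟨le_rfl, norm_nonneg C⟩)
  have hlim : Tendsto (fun p : Polynomial ℝ => ‖polyAt C q (P (polyAt B p w))‖)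
      (polyToPow ‖B‖ ν) (𝓝 ‖polyAt C q (P (opPow B ν w))‖) := by
    have hcont : Continuous fun T : X →L[𝕜] X => ‖polyAt C q (P (T w))‖ := by fun_prop
    exact (hcont.tendsto _).comp (tendsto_opPow hB hν)
  refine le_of_forall_pos_le_add fun ε hε => le_of_tendsto hlim ?_
  -- With |q| ≤ m on [0, ‖C‖], replacing t^ν by a polynomial this close costs at most ε.
  have hη : 0 < ε / ((m + 1) * (‖w‖ + 1)) := by positivity
  filter_upwards [mem_polyToPow hη] with p hp
  rw [polyAt_intertwine hP, ← polyAt_mul_apply]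
  have h1 : ∀ t ∈ Set.Icc 0 ‖C‖, |(q * p).eval t| ≤ K + m * (ε / ((m + 1) * (‖w‖ + 1))) := by
    intro t ht
    have h2 : |p.eval t| ≤ t ^ ν + ε / ((m + 1) * (‖w‖ + 1)) := by
      have h3 := abs_le.mp (hp t ⟨ht.1, ht.2.trans hCB⟩)
      have h4 := Real.rpow_nonneg ht.1 ν
      rw [abs_le]
      constructor <;> linarith
    rw [Polynomial.eval_mul, abs_mul]
    calc |q.eval t| * |p.eval t| ≤ |q.eval t| * (t ^ ν + ε / ((m + 1) * (‖w‖ + 1))) := by gcongr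
      _ = |q.eval t| * t ^ ν + |q.eval t| * (ε / ((m + 1) * (‖w‖ + 1))) := by ring
      _ ≤ _ := add_le_add (hq t ht) (mul_le_mul_of_nonneg_right (hm t ht) hη.le)
  have hPw : ‖P w‖ ≤ ‖w‖ := by simpa using P.le_of_opNorm_le hP1 w
  have hK0 : 0 ≤ K := (mul_nonneg (abs_nonneg _) (Real.rpow_nonneg le_rfl _)).trans
    (hq 0 ⟨le_rfl, norm_nonneg C⟩)
  calc ‖polyAt C (q * p) (P w)‖ ≤ (K + m * (ε / ((m + 1) * (‖w‖ + 1)))) * ‖P w‖ :=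
        norm_polyAt_apply_le hC le_rfl _ h1 _
    _ ≤ (K + m * (ε / ((m + 1) * (‖w‖ + 1)))) * ‖w‖ := by gcongr
    _ = K * ‖w‖ + ε * ((m * ‖w‖) / ((m + 1) * (‖w‖ + 1))) := by field_simp
    _ ≤ K * ‖w‖ + ε * 1 := by
        gcongr
        rw [div_le_one (by positivity)]
        nlinarith [norm_nonneg w]
    _ = _ := by ring

end FractionalPower

/-! ### Maxima of the scalar filter functions -/

section ScalarBounds

theorem one_sub_pow_le_exp {s : ℝ} (h1 : s ≤ 1) (p : ℕ) : (1 - s) ^ p ≤ Real.exp (-(p * s)) := by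
  calc (1 - s) ^ p ≤ Real.exp (-s) ^ p :=
        pow_le_pow_left₀ (by linarith) (by linarith [Real.add_one_le_exp (-s)]) p
    _ = _ := by rw [← Real.exp_nat_mul]; ring_nf

/-- Bernoulli gives (1 - s)^p (1 + ps) ≤ (1 - s²)^p ≤ 1, and s/(1 + ps) is increasing in s. -/
theorem mul_one_sub_pow_le {s s₀ : ℝ} (h0 : 0 ≤ s) (hs : s ≤ s₀) (h1 : s₀ ≤ 1) (p : ℕ) :
    s * (1 - s) ^ p ≤ s₀ / (1 + p * s₀) := by
  have hb : (1 - s) ^ p * (1 + p * s) ≤ 1 := by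
    calc (1 - s) ^ p * (1 + p * s) ≤ (1 - s) ^ p * (1 + s) ^ p := by
          refine mul_le_mul_of_nonneg_left (one_add_mul_le_pow (by linarith) p)
            (pow_nonneg (by linarith) p)
      _ = (1 - s ^ 2) ^ p := by rw [← mul_pow]; ring_nf
      _ ≤ 1 := pow_le_one₀ (by nlinarith) (by nlinarith)
  have h2 : 0 < 1 + p * s := by positivity
  have h3 : 0 ≤ s₀ := h0.trans hs
  calc s * (1 - s) ^ p ≤ s * (1 / (1 + p * s)) := by
        refine mul_le_mul_of_nonneg_left ?_ h0
        rwa [le_div_iff₀ h2]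
    _ = s / (1 + p * s) := by ring
    _ ≤ s₀ / (1 + p * s₀) := by
        rw [div_le_div_iff₀ h2 (by positivity)]
        nlinarith

theorem mul_one_sub_pow_two_mul_le {s : ℝ} (h1 : s ≤ 1) (r : ℕ) :
    s * (1 - s) ^ (2 * r) ≤ 1 / (1 + 4 * r) := by
  rcases Nat.eq_zero_or_pos r with rfl | hr
  · simpa using h1
  have hr1 : (1 : ℝ) ≤ r := by exact_mod_cast hr
  have h2 := one_sub_pow_le_exp h1 (2 * r)
  have h3 : 2 * r * s ≤ Real.exp (2 * r * s - 1) := by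
    linarith [Real.add_one_le_exp (2 * r * s - 1)]
  have h4 : Real.exp (2 * r * s - 1) * Real.exp (-(2 * r * s)) = Real.exp (-1) := by
    rw [← Real.exp_add]; ring_nf
  -- With v = s(1 - s)^(2r), the bound 2rv ≤ 2/5 is just enough: for r ≥ 1 it gives v ≤ 1/5 and 4rv
  -- ≤ 4/5.
  have h5 : Real.exp (-1) ≤ 2 / 5 := by
    rw [Real.exp_neg]
    have := Real.exp_one_gt_d9
    rw [inv_le_comm₀ (by positivity) (by norm_num)]
    linarith
  have h6 : 2 * r * (s * (1 - s) ^ (2 * r)) ≤ 2 / 5 := by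
    calc 2 * r * (s * (1 - s) ^ (2 * r)) = (2 * r * s) * (1 - s) ^ (2 * r) := by ring
      _ ≤ Real.exp (2 * r * s - 1) * Real.exp (-(2 * r * s)) := by
          push_cast at h2
          exact mul_le_mul h3 h2 (pow_nonneg (by linarith) _) (Real.exp_nonneg _)
      _ ≤ _ := h4.trans_le h5
  rw [le_div_iff₀ (by positivity)]
  nlinarith

/-- The cube of 1 + x/3 ≤ e^(x/3) at x = 2ps. The cap s₀ on s survives, as the path kernel needs. -/
theorem pow_three_mul_one_sub_pow_le {s s₀ : ℝ} (h0 : 0 ≤ s) (hs : s ≤ s₀) (h1 : s₀ ≤ 1) (p : ℕ) :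
    s ^ 3 * (1 - s) ^ (2 * p) ≤ 4 * (s₀ / (1 + p * s₀)) ^ 3 := by
  have h2 := one_sub_pow_le_exp (hs.trans h1) (2 * p)
  have h3 : (1 + 2 / 3 * (p * s)) ^ 3 ≤ Real.exp (2 * p * s) := by
    calc (1 + 2 / 3 * (p * s)) ^ 3 ≤ Real.exp (2 / 3 * (p * s)) ^ 3 :=
          pow_le_pow_left₀ (by positivity) (by linarith [Real.add_one_le_exp (2 / 3 * (p * s))]) 3
      _ = _ := by rw [← Real.exp_nat_mul]; ring_nf
  have h4 : (1 - s) ^ (2 * p) ≤ 1 / (1 + 2 / 3 * (p * s)) ^ 3 := by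
    rw [le_div_iff₀ (by positivity)]
    calc (1 - s) ^ (2 * p) * (1 + 2 / 3 * (p * s)) ^ 3
        ≤ Real.exp (-(2 * p * s)) * Real.exp (2 * p * s) := by
          push_cast at h2
          exact mul_le_mul h2 h3 (by positivity) (Real.exp_nonneg _)
      _ = 1 := by rw [← Real.exp_add]; simp
  have hs0 : 0 ≤ s₀ := h0.trans hs
  have h5 : s / (1 + 2 / 3 * (p * s)) ≤ 3 / 2 * (s₀ / (1 + p * s₀)) := by
    rw [← mul_div_assoc, div_le_div_iff₀ (by positivity) (by positivity)]
    have : (0 : ℝ) ≤ p := p.cast_nonneg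
    nlinarith [mul_nonneg this (mul_nonneg h0 hs0)]
  calc s ^ 3 * (1 - s) ^ (2 * p) ≤ s ^ 3 * (1 / (1 + 2 / 3 * (p * s)) ^ 3) := by gcongr
    _ = (s / (1 + 2 / 3 * (p * s))) ^ 3 := by rw [div_pow]; ring
    _ ≤ (3 / 2 * (s₀ / (1 + p * s₀))) ^ 3 := pow_le_pow_left₀ (by positivity) h5 3
    _ = 27 / 8 * (s₀ / (1 + p * s₀)) ^ 3 := by rw [mul_pow]; norm_num
    _ ≤ _ := by
        have : 0 ≤ (s₀ / (1 + p * s₀)) ^ 3 := by positivity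
        linarith

/-- The maximum of s³e^(-2ps) is (3/2)³e⁻³/p³. The sharp constant matters: it decides whether the
mean square kernel has mass below 1. -/
theorem pow_three_mul_one_sub_pow_le_inv {s : ℝ} (h0 : 0 ≤ s) (h1 : s ≤ 1) {p : ℕ} (hp : 0 < p) :
    s ^ 3 * (1 - s) ^ (2 * p) ≤ 0.172 / (p : ℝ) ^ 3 := by
  have hp0 : (0 : ℝ) < p := by exact_mod_cast hp
  have h2 := one_sub_pow_le_exp h1 (2 * p)
  push_cast at h2
  have h3 : (2 / 3 * (p * s)) ^ 3 ≤ Real.exp (2 * p * s - 3) := by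
    calc (2 / 3 * (p * s)) ^ 3 ≤ Real.exp (2 / 3 * (p * s) - 1) ^ 3 :=
          pow_le_pow_left₀ (by positivity)
            (by linarith [Real.add_one_le_exp (2 / 3 * (p * s) - 1)]) 3
      _ = _ := by rw [← Real.exp_nat_mul]; ring_nf
  have h4 : (2 / 3 * (p * s)) ^ 3 * (1 - s) ^ (2 * p) ≤ Real.exp (-3) := by
    calc (2 / 3 * (p * s)) ^ 3 * (1 - s) ^ (2 * p)
        ≤ Real.exp (2 * p * s - 3) * Real.exp (-(2 * p * s)) :=
          mul_le_mul h3 h2 (pow_nonneg (by linarith) _) (Real.exp_nonneg _)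
      _ = _ := by rw [← Real.exp_add]; ring_nf
  have h5 : Real.exp (-3) ≤ 0.0509 := by
    have he : Real.exp (-3) = (Real.exp 1 ^ 3)⁻¹ := by
      rw [← Real.exp_nat_mul, ← Real.exp_neg]; norm_num
    have h6 : (2.7 : ℝ) ^ 3 ≤ Real.exp 1 ^ 3 :=
      pow_le_pow_left₀ (by norm_num) (by linarith [Real.exp_one_gt_d9]) 3
    rw [he, inv_le_comm₀ (by positivity) (by norm_num)]
    refine le_trans ?_ h6
    norm_num
  rw [le_div_iff₀ (by positivity)]
  have h7 : (2 / 3 * (p * s)) ^ 3 * (1 - s) ^ (2 * p)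
      = 8 / 27 * (s ^ 3 * (1 - s) ^ (2 * p) * (p : ℝ) ^ 3) := by ring
  rw [h7] at h4
  linarith

theorem one_sub_one_sub_pow_le {s : ℝ} (h1 : s ≤ 1) (m : ℕ) : 1 - (1 - s) ^ m ≤ m * s := by
  have := one_add_mul_le_pow (a := -s) (by linarith) m
  rw [← sub_eq_add_neg] at this
  linarith

/-- From x ≤ e^x at x = kc₀t/ν, raised to the power ν, against (1 - c₀t)^k ≤ e^(-kc₀t). -/
theorem rpow_mul_one_sub_pow_le {t c₀ ν : ℝ} (ht : 0 ≤ t) (hc : 0 < c₀) (hν : 0 < ν)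
    (h1 : c₀ * t ≤ 1) {k : ℕ} (hk : 1 ≤ k) :
    |(1 - c₀ * t) ^ k| * t ^ ν ≤ (ν / c₀) ^ ν * (k : ℝ) ^ (-ν) := by
  have hk0 : (0 : ℝ) < k := by exact_mod_cast hk
  rw [abs_of_nonneg (pow_nonneg (by linarith) k)]
  have h2 := one_sub_pow_le_exp h1 k
  have h3 : t ≤ ν / c₀ * (k : ℝ)⁻¹ * Real.exp (k * (c₀ * t) / ν) := by
    have : k * (c₀ * t) / ν ≤ Real.exp (k * (c₀ * t) / ν) := by
      linarith [Real.add_one_le_exp (k * (c₀ * t) / ν)]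
    calc t = ν / c₀ * (k : ℝ)⁻¹ * (k * (c₀ * t) / ν) := by field_simp
      _ ≤ _ := by gcongr
  have h4 : t ^ ν ≤ (ν / c₀) ^ ν * (k : ℝ) ^ (-ν) * Real.exp (k * (c₀ * t)) := by
    calc t ^ ν ≤ (ν / c₀ * (k : ℝ)⁻¹ * Real.exp (k * (c₀ * t) / ν)) ^ ν := by gcongr
      _ = _ := by
        rw [Real.mul_rpow (by positivity) (Real.exp_nonneg _), Real.mul_rpow (by positivity)
          (by positivity), Real.inv_rpow hk0.le, ← Real.rpow_neg hk0.le, ← Real.exp_mul]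
        congr 2
        field_simp
  calc (1 - c₀ * t) ^ k * t ^ ν
      ≤ Real.exp (-(k * (c₀ * t))) * ((ν / c₀) ^ ν * (k : ℝ) ^ (-ν) * Real.exp (k * (c₀ * t))) := by
        gcongr
    _ = (ν / c₀) ^ ν * (k : ℝ) ^ (-ν) * (Real.exp (-(k * (c₀ * t))) * Real.exp (k * (c₀ * t))) := by
        ring
    _ = _ := by rw [← Real.exp_add]; simp

end ScalarBounds

/-! ### Discrete convolutions and a Gronwall inequality -/

section Sums

open Finset

theorem sqrt_add_le_sqrt_add_sqrt {x y : ℝ} (hx : 0 ≤ x) (hy : 0 ≤ y) : √(x + y) ≤ √x + √y := by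
  rw [Real.sqrt_le_left (by positivity)]
  nlinarith [Real.sq_sqrt hx, Real.sq_sqrt hy, Real.sqrt_nonneg x, Real.sqrt_nonneg y,
    mul_nonneg (Real.sqrt_nonneg x) (Real.sqrt_nonneg y)]

theorem sum_inv_add_one_le (k : ℕ) : ∑ j ∈ range k, 1 / ((j : ℝ) + 1) ≤ 1 + Real.log k := by
  have h := harmonic_le_one_add_log k
  rw [harmonic] at h
  push_cast at h
  simpa using h

theorem sum_inv_one_add_four_mul_le {M : ℕ} (hM : 1 ≤ M) :
    ∑ r ∈ range M, 1 / (1 + 4 * (r : ℝ)) ≤ (10 + Real.log M) / 4 := by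
  obtain ⟨N, rfl⟩ : ∃ N, M = N + 1 := ⟨M - 1, by omega⟩
  rw [sum_range_succ']
  have h1 : ∑ r ∈ range N, 1 / (1 + 4 * ((r + 1 : ℕ) : ℝ)) ≤ 1 / 4 * (1 + Real.log N) := by
    refine le_trans ?_ (mul_le_mul_of_nonneg_left (sum_inv_add_one_le N) (by norm_num))
    rw [mul_sum]
    refine sum_le_sum fun r _ => ?_
    rw [← mul_div_assoc, div_le_div_iff₀ (by positivity) (by positivity)]
    push_cast
    linarith
  have h2 : Real.log N ≤ Real.log ((N + 1 : ℕ) : ℝ) := by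
    rcases Nat.eq_zero_or_pos N with rfl | hN
    · simp
    · exact Real.log_le_log (by exact_mod_cast hN) (by push_cast; linarith)
  norm_num at h1 h2 ⊢
  linarith

/-- Telescoping: 1/p³ ≤ 2/p² - 2/(p + 1)². -/
theorem sum_inv_pow_three_le {M : ℕ} (hM : 1 ≤ M) (N : ℕ) :
    ∑ p ∈ Ico M N, 1 / (p : ℝ) ^ 3 ≤ 2 / (M : ℝ) ^ 2 := by
  rcases le_or_gt N M with h | h
  · rw [Ico_eq_empty_of_le h]; simp; positivity
  have key : ∀ N, M ≤ N → ∑ p ∈ Ico M N, 1 / (p : ℝ) ^ 3 ≤ 2 / (M : ℝ) ^ 2 - 2 / (N : ℝ) ^ 2 := by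
    intro N hN
    induction N, hN using Nat.le_induction with
    | base => simp
    | succ N hN ih =>
      rw [sum_Ico_succ_top hN]
      have hN0 : (1 : ℝ) ≤ N := by exact_mod_cast hM.trans hN
      have : 1 / (N : ℝ) ^ 3 ≤ 2 / (N : ℝ) ^ 2 - 2 / ((N + 1 : ℕ) : ℝ) ^ 2 := by
        push_cast
        rw [div_sub_div _ _ (by positivity) (by positivity),
          div_le_div_iff₀ (by positivity) (by positivity)]
        have h1 : 0 ≤ (N : ℝ) ^ 2 * (3 * N ^ 2 - 1) := by
          refine mul_nonneg (by positivity) (by nlinarith)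
        nlinarith
      linarith
  have := key N h.le
  have h2 : 0 ≤ 2 / (N : ℝ) ^ 2 := by positivity
  linarith

variable {a : ℝ}

theorem sum_div_sqrt_le (h0 : 0 ≤ a) (h1 : a ≤ 1) (k : ℕ) :
    ∑ j ∈ range k, a / √(1 + j * a) ≤ 2 * √(1 + k * a) := by
  -- Right endpoint Riemann sums are dominated by the integral; the last term corrects for summing
  -- at left endpoints.
  suffices h : ∑ j ∈ range k, a / √(1 + j * a) ≤ 2 * √(1 + k * a) - 2 + a * (1 - 1 / √(1 + k * a)) by
    have : 0 ≤ a * (1 / √(1 + k * a)) := by positivity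
    linarith
  induction k with
  | zero => simp
  | succ k ih =>
    rw [sum_range_succ]
    set b := √(1 + k * a) with hb
    set d := √(1 + ((k + 1 : ℕ) : ℝ) * a) with hd
    have hb2 : b ^ 2 = 1 + k * a := Real.sq_sqrt (by positivity)
    have hd2 : d ^ 2 = 1 + k * a + a := by
      rw [hd, Real.sq_sqrt (by positivity)]; push_cast; ring
    have hb1 : 0 < b := Real.sqrt_pos.mpr (by positivity)
    have hd1 : 0 < d := Real.sqrt_pos.mpr (by positivity)
    have hbd : a / d ≤ 2 * (d - b) := by
      rw [div_le_iff₀ hd1]; nlinarith [sq_nonneg (d - b)]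
    have e1 : a * (1 - 1 / b) = a - a / b := by ring
    have e2 : a * (1 - 1 / d) = a - a / d := by ring
    rw [e1] at ih
    rw [e2]
    linarith

theorem sum_div_mul_sqrt_le (h0 : 0 ≤ a) (h1 : a ≤ 1) (k : ℕ) :
    ∑ j ∈ range k, a / ((1 + j * a) * √(1 + j * a)) ≤ 3 := by
  suffices h : ∑ j ∈ range k, a / ((1 + j * a) * √(1 + j * a))
      ≤ 2 + a - 2 / √(1 + k * a) - a / ((1 + k * a) * √(1 + k * a)) by
    have h2 : 0 ≤ 2 / √(1 + k * a) := by positivity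
    have h3 : 0 ≤ a / ((1 + k * a) * √(1 + k * a)) := by positivity
    linarith
  induction k with
  | zero => simp
  | succ k ih =>
    rw [sum_range_succ]
    set b := √(1 + k * a) with hb
    set d := √(1 + ((k + 1 : ℕ) : ℝ) * a) with hd
    have hb2 : b ^ 2 = 1 + k * a := Real.sq_sqrt (by positivity)
    have hd2 : d ^ 2 = 1 + ((k + 1 : ℕ) : ℝ) * a := Real.sq_sqrt (by positivity)
    have hda : d ^ 2 = b ^ 2 + a := by rw [hb2, hd2]; push_cast; ring
    have hb1 : 0 < b := Real.sqrt_pos.mpr (by positivity)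
    have hd1 : 0 < d := Real.sqrt_pos.mpr (by positivity)
    have hbd' : b ≤ d := Real.sqrt_le_sqrt (by push_cast; linarith)
    have hbd : a / (d ^ 2 * d) ≤ 2 / b - 2 / d := by
      rw [div_sub_div _ _ hb1.ne' hd1.ne', div_le_div_iff₀ (by positivity) (by positivity)]
      have ha : a = (d - b) * (d + b) := by linarith
      rw [ha]
      have : b * (d + b) ≤ 2 * d ^ 2 := by nlinarith
      have h4 : 0 ≤ (d - b) * d := mul_nonneg (by linarith) hd1.le
      nlinarith [mul_le_mul_of_nonneg_left this h4]
    rw [← hd2]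
    rw [← hb2] at ih ⊢
    linarith

/-- The discrete analogue of `∫₀ᶻ (1 + p)^(-1/2) (1 + z - p)^(-1/2) dp ≲ 1`. -/
theorem sum_div_sqrt_mul_sqrt_le (h0 : 0 ≤ a) (h1 : a ≤ 1) (k : ℕ) :
    ∑ j ∈ range k, a / (√(1 + (k - 1 - j : ℕ) * a) * √(1 + j * a)) ≤ 4 := by
  have hk : 0 < √(1 + k * a) := Real.sqrt_pos.mpr (by positivity)
  -- Since √(1 + ka) is at most the sum of the two roots in the denominator, multiplying by it
  -- cancels one root at a time and removes the convolution.
  have h2 : (∑ j ∈ range k, a / (√(1 + (k - 1 - j : ℕ) * a) * √(1 + j * a))) * √(1 + k * a)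
      ≤ ∑ j ∈ range k, (a / √(1 + j * a) + a / √(1 + (k - 1 - j : ℕ) * a)) := by
    rw [sum_mul]
    refine sum_le_sum fun j hj => ?_
    have hjk := mem_range.mp hj
    set p := k - 1 - j with hp
    have hkp : (k : ℝ) = p + j + 1 := by
      have : k = p + j + 1 := by omega
      exact_mod_cast this
    have hb : 0 < √(1 + p * a) := Real.sqrt_pos.mpr (by positivity)
    have hd : 0 < √(1 + j * a) := Real.sqrt_pos.mpr (by positivity)
    have hsub : √(1 + k * a) ≤ √(1 + p * a) + √(1 + j * a) := by
      refine (Real.sqrt_le_sqrt ?_).trans (sqrt_add_le_sqrt_add_sqrt (by positivity) (by positivity))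
      rw [hkp]; nlinarith
    calc a / (√(1 + p * a) * √(1 + j * a)) * √(1 + k * a)
        ≤ a / (√(1 + p * a) * √(1 + j * a)) * (√(1 + p * a) + √(1 + j * a)) := by gcongr
      _ = _ := by field_simp
  have h3 : ∑ j ∈ range k, a / √(1 + (k - 1 - j : ℕ) * a) = ∑ j ∈ range k, a / √(1 + j * a) :=
    sum_range_reflect (fun j : ℕ => a / √(1 + j * a)) k
  rw [sum_add_distrib, h3] at h2
  have h4 := sum_div_sqrt_le h0 h1 k
  refine le_of_mul_le_mul_right ?_ hk
  linarith

/-- The discrete analogue of `∫₀ᶻ (1 + p)^(-3/2) (1 + z - p)^(-1) dp ≲ (1 + z)^(-1)`. -/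
theorem sum_div_mul_sqrt_mul_le (h0 : 0 ≤ a) (h1 : a ≤ 1) (k : ℕ) :
    ∑ j ∈ range k, a / ((1 + (k - 1 - j : ℕ) * a) * √(1 + (k - 1 - j : ℕ) * a)) * (1 / (1 + j * a))
      ≤ 7 / (1 + k * a) := by
  rw [le_div_iff₀ (by positivity), sum_mul]
  have h2 : ∑ j ∈ range k, a / ((1 + (k - 1 - j : ℕ) * a) * √(1 + (k - 1 - j : ℕ) * a))
      * (1 / (1 + j * a)) * (1 + k * a)
      ≤ ∑ j ∈ range k, (a / ((1 + (k - 1 - j : ℕ) * a) * √(1 + (k - 1 - j : ℕ) * a))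
        + a / (√(1 + (k - 1 - j : ℕ) * a) * √(1 + j * a))) := by
    refine sum_le_sum fun j hj => ?_
    have hjk := mem_range.mp hj
    set p := k - 1 - j with hp
    have hkp : (k : ℝ) = p + j + 1 := by
      have : k = p + j + 1 := by omega
      exact_mod_cast this
    have hb : 0 < √(1 + p * a) := Real.sqrt_pos.mpr (by positivity)
    have hd : 1 ≤ √(1 + j * a) := Real.one_le_sqrt.mpr (by linarith [mul_nonneg j.cast_nonneg h0])
    have hd2 : √(1 + j * a) ^ 2 = 1 + j * a := Real.sq_sqrt (by positivity)
    have hsum : 1 + k * a ≤ (1 + j * a) + (1 + p * a) := by rw [hkp]; nlinarith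
    have hd3 : √(1 + j * a) ≤ 1 + j * a := by nlinarith
    calc a / ((1 + p * a) * √(1 + p * a)) * (1 / (1 + j * a)) * (1 + k * a)
        ≤ a / ((1 + p * a) * √(1 + p * a)) * (1 / (1 + j * a)) * ((1 + j * a) + (1 + p * a)) := by
          gcongr
      _ = a / ((1 + p * a) * √(1 + p * a)) + a / (√(1 + p * a) * (1 + j * a)) := by
          field_simp
      _ ≤ _ := by
          gcongr
  have h3 : ∑ j ∈ range k, a / ((1 + (k - 1 - j : ℕ) * a) * √(1 + (k - 1 - j : ℕ) * a))
      = ∑ j ∈ range k, a / ((1 + j * a) * √(1 + j * a)) :=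
    sum_range_reflect (fun j : ℕ => a / ((1 + j * a) * √(1 + j * a))) k
  rw [sum_add_distrib, h3] at h2
  linarith [sum_div_mul_sqrt_le h0 h1 k, sum_div_sqrt_mul_sqrt_le h0 h1 k]

theorem sum_inv_mul_inv_mul_sqrt_le (k : ℕ) :
    ∑ j ∈ range k, 1 / (1 + (k - 1 - j : ℕ) : ℝ) * (1 / ((1 + j) * √(1 + j))) ≤ 7 / (1 + k) := by
  have h := sum_div_mul_sqrt_mul_le zero_le_one le_rfl k
  rw [← sum_range_reflect] at h
  simp only [mul_one] at h
  refine le_trans (sum_le_sum fun j hj => ?_) h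
  have hjk := mem_range.mp hj
  have : k - 1 - (k - 1 - j) = j := by omega
  rw [this, mul_comm]

theorem sum_inv_sqrt_mul_inv_le (k : ℕ) :
    ∑ j ∈ range k, 1 / √(1 + (k - 1 - j : ℕ)) * (1 / (1 + j : ℝ)) ≤ (5 + Real.log k) / √(1 + k) := by
  have hk : 0 < √(1 + k : ℝ) := Real.sqrt_pos.mpr (by positivity)
  rw [le_div_iff₀ hk, sum_mul]
  have h2 : ∑ j ∈ range k, 1 / √(1 + (k - 1 - j : ℕ)) * (1 / (1 + j : ℝ)) * √(1 + k)
      ≤ ∑ j ∈ range k, (1 / ((j : ℝ) + 1)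
        + 1 / (√(1 + (k - 1 - j : ℕ) * 1) * √(1 + j * 1))) := by
    refine sum_le_sum fun j hj => ?_
    have hjk := mem_range.mp hj
    set p := k - 1 - j with hp
    have hkp : (k : ℝ) = p + j + 1 := by
      have : k = p + j + 1 := by omega
      exact_mod_cast this
    have hb : 0 < √(1 + p : ℝ) := Real.sqrt_pos.mpr (by positivity)
    have hd : 0 < √(1 + j : ℝ) := Real.sqrt_pos.mpr (by positivity)
    have hd2 : √(1 + j : ℝ) ^ 2 = 1 + j := Real.sq_sqrt (by positivity)
    have hsub : √(1 + k : ℝ) ≤ √(1 + p) + √(1 + j) := by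
      refine (Real.sqrt_le_sqrt ?_).trans (sqrt_add_le_sqrt_add_sqrt (by positivity) (by positivity))
      rw [hkp]; linarith
    calc 1 / √(1 + p : ℝ) * (1 / (1 + j : ℝ)) * √(1 + k)
        ≤ 1 / √(1 + p : ℝ) * (1 / (1 + j : ℝ)) * (√(1 + p) + √(1 + j)) := by gcongr
      _ = 1 / ((j : ℝ) + 1) + 1 / (√(1 + p * 1) * √(1 + j * 1)) := by
          rw [mul_one, mul_one, add_comm (j : ℝ) 1]
          field_simp
          linear_combination hd2
  rw [sum_add_distrib] at h2
  linarith [sum_inv_add_one_le k, sum_div_sqrt_mul_sqrt_le zero_le_one le_rfl k]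

theorem sum_inv_mul_sqrt_Ico_le {M : ℕ} (hM : 1 ≤ M) (N : ℕ) :
    ∑ p ∈ Ico M N, 1 / ((p : ℝ) * √p) ≤ 3 := by
  have h := sum_div_mul_sqrt_le zero_le_one le_rfl N
  simp only [mul_one] at h
  refine le_trans ?_ h
  rw [← Nat.Ico_zero_eq_range, sum_Ico_eq_sum_range]
  calc ∑ i ∈ range (N - M), 1 / (((M + i : ℕ) : ℝ) * √((M + i : ℕ) : ℝ))
      ≤ ∑ i ∈ range (N - M), 1 / ((1 + i : ℝ) * √(1 + i)) := by
        refine sum_le_sum fun i _ => ?_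
        have : (1 + i : ℝ) ≤ ((M + i : ℕ) : ℝ) := by
          push_cast
          have : (1 : ℝ) ≤ M := by exact_mod_cast hM
          linarith
        gcongr
    _ ≤ _ := by
        rw [Nat.Ico_zero_eq_range]
        exact sum_le_sum_of_subset_of_nonneg (range_mono (Nat.sub_le _ _))
          fun i _ _ => by positivity

/-- Gronwall's inequality for Volterra sums. -/
theorem le_mul_of_sum_le {D F W : ℕ → ℝ} {κ : ℕ → ℕ → ℝ} {θ Λ : ℝ} (hΛ : 0 ≤ Λ)
    (hκ : ∀ k j, 0 ≤ κ k j) (hD : ∀ k, D k ≤ F k + ∑ j ∈ range k, κ k j * D j)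
    (hF : ∀ k, F k ≤ (1 - θ) * (Λ * W k)) (hW : ∀ k, ∑ j ∈ range k, κ k j * W j ≤ θ * W k)
    (k : ℕ) : D k ≤ Λ * W k := by
  induction k using Nat.strong_induction_on with
  | _ k ih =>
    have h1 : ∑ j ∈ range k, κ k j * D j ≤ Λ * (θ * W k) := by
      calc ∑ j ∈ range k, κ k j * D j ≤ ∑ j ∈ range k, Λ * (κ k j * W j) := by
            refine sum_le_sum fun j hj => ?_
            have := mul_le_mul_of_nonneg_left (ih j (mem_range.mp hj)) (hκ k j)
            linarith
        _ = Λ * ∑ j ∈ range k, κ k j * W j := by rw [mul_sum]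
        _ ≤ _ := mul_le_mul_of_nonneg_left (hW k) hΛ
    linarith [hD k, hF k]

/-- Slow variation of the weights x^(-3/2): going q steps back costs a factor 1 + O(q^(3/2)/h),
close to 1 for large h. -/
theorem add_mul_sqrt_add_le {h x q : ℝ} (hh : 1 ≤ h) (hx : h ^ 2 ≤ x) (hq : 1 ≤ q) :
    (x + q) * √(x + q) ≤ x * √x * (1 + 3 * (q * √q) / h) := by
  have hx0 : 0 < x := by nlinarith
  have hq1 : 1 ≤ √q := Real.one_le_sqrt.mpr hq
  have hsx : h ≤ √x := Real.le_sqrt_of_sq_le hx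
  have hsx2 : √x ^ 2 = x := Real.sq_sqrt hx0.le
  have hsq2 : √q ^ 2 = q := Real.sq_sqrt (by linarith)
  have h1 : √(x + q) ≤ √x + √q := sqrt_add_le_sqrt_add_sqrt hx0.le (by linarith)
  have h0 : 0 < h := by linarith
  set u := √x
  set v := √q
  have hG : 0 ≤ q * v := by positivity
  have e1 : x * v ≤ x * u * (q * v) / h := by
    rw [le_div_iff₀ h0]
    have : v * h ≤ u * (q * v) := by nlinarith [mul_le_mul hsx hq (by norm_num) (by linarith)]
    nlinarith
  have e2 : q * u ≤ x * u * (q * v) / h := by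
    rw [le_div_iff₀ h0]
    have : h ≤ x * v := by nlinarith
    have h3 : 0 ≤ q * u := by positivity
    nlinarith
  have e3 : q * v ≤ x * u * (q * v) / h := by
    rw [le_div_iff₀ h0]
    have : h ≤ x * u := by nlinarith
    nlinarith
  calc (x + q) * √(x + q) ≤ (x + q) * (u + v) := by gcongr
    _ = x * u + (x * v + q * u + q * v) := by ring
    _ ≤ x * u + 3 * (x * u * (q * v) / h) := by linarith
    _ = _ := by ring

end Sums

/-! ### Bounds for A q(B) and its adjoint -/

section NormalOperator

variable {𝕜 : Type*} [RCLike 𝕜]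
variable {X : Type*} [NormedAddCommGroup X] [InnerProductSpace 𝕜 X]
variable {n : ℕ} {Y : Fin n → Type*} [∀ i, NormedAddCommGroup (Y i)]
  [∀ i, InnerProductSpace 𝕜 (Y i)]

theorem norm_sq_eq_sum_comp (A : X →L[𝕜] PiLp 2 Y) (x : X) :
    ‖A x‖ ^ 2 = ∑ i, ‖comp A i x‖ ^ 2 := PiLp.norm_sq_eq_of_L2 _ _

theorem norm_comp_apply_le (A : X →L[𝕜] PiLp 2 Y) (i : Fin n) (x : X) :
    ‖comp A i x‖ ≤ ‖A x‖ := PiLp.norm_apply_le _ _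

theorem norm_comp_sq_le_maxNormSq (A : X →L[𝕜] PiLp 2 Y) (i : Fin n) :
    ‖comp A i‖ ^ 2 ≤ maxNormSq A :=
  le_ciSup (f := fun i => ‖comp A i‖ ^ 2) (Set.finite_range _).bddAbove i

theorem maxNormSq_nonneg (A : X →L[𝕜] PiLp 2 Y) : 0 ≤ maxNormSq A :=
  Real.iSup_nonneg fun _ => sq_nonneg _

theorem norm_comp_le_sqrt (A : X →L[𝕜] PiLp 2 Y) (i : Fin n) : ‖comp A i‖ ≤ √(maxNormSq A) :=
  Real.le_sqrt_of_sq_le (norm_comp_sq_le_maxNormSq A i)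

theorem norm_comp_apply_le_sqrt (A : X →L[𝕜] PiLp 2 Y) (i : Fin n) (x : X) :
    ‖comp A i x‖ ≤ √(maxNormSq A) * ‖x‖ :=
  (comp A i).le_of_opNorm_le (norm_comp_le_sqrt A i) x

theorem norm_sq_le_mul_maxNormSq (A : X →L[𝕜] PiLp 2 Y) : ‖A‖ ^ 2 ≤ n * maxNormSq A := by
  have h0 := mul_nonneg n.cast_nonneg (maxNormSq_nonneg A)
  have : ‖A‖ ≤ √(n * maxNormSq A) := by
    refine A.opNorm_le_bound (Real.sqrt_nonneg _) fun x => ?_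
    refine le_of_sq_le_sq ?_ (by positivity)
    rw [norm_sq_eq_sum_comp, mul_pow, Real.sq_sqrt h0]
    calc ∑ i, ‖comp A i x‖ ^ 2 ≤ ∑ _i : Fin n, maxNormSq A * ‖x‖ ^ 2 := by
          refine Finset.sum_le_sum fun i _ => ?_
          have := pow_le_pow_left₀ (norm_nonneg _) (norm_comp_apply_le_sqrt A i x) 2
          rwa [mul_pow, Real.sq_sqrt (maxNormSq_nonneg A)] at this
      _ = _ := by simp [mul_assoc]
  calc ‖A‖ ^ 2 ≤ √(n * maxNormSq A) ^ 2 := by gcongr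
    _ = _ := Real.sq_sqrt h0

theorem step_mul_norm_sq_le {A : X →L[𝕜] PiLp 2 Y} {c : ℝ} (hn : 1 ≤ n) (hc : 0 ≤ c) :
    c * (‖A‖ ^ 2 / n) ≤ c * maxNormSq A := by
  have hn0 : (0 : ℝ) < n := by exact_mod_cast hn
  refine mul_le_mul_of_nonneg_left ?_ hc
  rw [div_le_iff₀' hn0]
  exact norm_sq_le_mul_maxNormSq A

variable [CompleteSpace X] [∀ i, CompleteSpace (Y i)]

theorem normalOp_apply (A : X →L[𝕜] PiLp 2 Y) (x : X) :
    normalOp A x = ((n : 𝕜)⁻¹) • A.adjoint (A x) := rfl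

open scoped ComplexOrder in
theorem isPositive_normalOp (A : X →L[𝕜] PiLp 2 Y) : (normalOp A).IsPositive := by
  have h : (A.adjoint.comp A).IsPositive := by
    simpa using ContinuousLinearMap.isPositive_self_comp_adjoint A.adjoint
  have hn : (0 : 𝕜) ≤ (n : 𝕜)⁻¹ := by
    have : ((n : 𝕜)⁻¹) = (((n : ℝ)⁻¹ : ℝ) : 𝕜) := by push_cast; rfl
    rw [this]
    exact RCLike.ofReal_nonneg.mpr (by positivity)
  exact h.smul_of_nonneg hn

theorem norm_normalOp (A : X →L[𝕜] PiLp 2 Y) : ‖normalOp A‖ = ‖A‖ ^ 2 / n := by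
  rw [normalOp, norm_smul, ContinuousLinearMap.norm_adjoint_comp_self, norm_inv, RCLike.norm_natCast]
  ring

theorem re_inner_normalOp (hn : 1 ≤ n) (A : X →L[𝕜] PiLp 2 Y) (x : X) :
    n * RCLike.re ⟪normalOp A x, x⟫_𝕜 = ‖A x‖ ^ 2 := by
  have hn' : (n : ℝ) ≠ 0 := by positivity
  have : ((n : 𝕜)⁻¹) = (((n : ℝ)⁻¹ : ℝ) : 𝕜) := by push_cast; rfl
  rw [normalOp_apply, inner_smul_left, this, RCLike.conj_ofReal, RCLike.re_ofReal_mul,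
    ContinuousLinearMap.adjoint_inner_left, inner_self_eq_norm_sq, ← mul_assoc,
    mul_inv_cancel₀ hn', one_mul]

theorem adjoint_apply_eq_sum (A : X →L[𝕜] PiLp 2 Y) (x : X) :
    A.adjoint (A x) = ∑ i, (comp A i).adjoint (comp A i x) := by
  refine ext_inner_right 𝕜 fun y => ?_
  simp_rw [sum_inner, ContinuousLinearMap.adjoint_inner_left]
  rw [PiLp.inner_apply]
  rfl

theorem norm_adjoint_comp_apply_le_sqrt (A : X →L[𝕜] PiLp 2 Y) (i : Fin n) (y : Y i) :
    ‖(comp A i).adjoint y‖ ≤ √(maxNormSq A) * ‖y‖ :=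
  (comp A i).adjoint.le_of_opNorm_le
    ((LinearIsometryEquiv.norm_map _ _).trans_le (norm_comp_le_sqrt A i)) y

variable {K : ℝ}

/-- ‖A q(B)x‖² = n⟨B q(B)x, q(B)x⟩ = n⟨(t q²)(B)x, x⟩. -/
theorem norm_apply_polyAt_le (hn : 1 ≤ n) (A : X →L[𝕜] PiLp 2 Y) (q : Polynomial ℝ)
    (hq : ∀ t ∈ Set.Icc 0 (‖A‖ ^ 2 / n), t * q.eval t ^ 2 ≤ K) (x : X) :
    ‖A (polyAt (normalOp A) q x)‖ ≤ √(n * K) * ‖x‖ := by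
  have hK : 0 ≤ K := by simpa using hq 0 ⟨le_rfl, by positivity⟩
  set B := normalOp A
  refine le_of_sq_le_sq ?_ (by positivity)
  rw [mul_pow, Real.sq_sqrt (by positivity), ← re_inner_normalOp hn, mul_assoc]
  refine mul_le_mul_of_nonneg_left ?_ n.cast_nonneg
  have h1 : ⟪B (polyAt B q x), polyAt B q x⟫_𝕜 = ⟪polyAt B (q * Polynomial.X * q) x, x⟫_𝕜 := by
    rw [polyAt_mul_apply, polyAt_mul_apply, polyAt_X, isSymmetric_polyAt (isPositive_normalOp A)]
  rw [h1]
  have h2 : ‖polyAt B (q * Polynomial.X * q) x‖ ≤ K * ‖x‖ := by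
    refine norm_polyAt_apply_le (isPositive_normalOp A) (norm_normalOp A).le _ (fun t ht => ?_) x
    have h3 : (q * Polynomial.X * q).eval t = t * q.eval t ^ 2 := by simp; ring
    rw [h3, abs_of_nonneg (mul_nonneg ht.1 (sq_nonneg _))]
    exact hq t ht
  calc _ ≤ ‖polyAt B (q * Polynomial.X * q) x‖ * ‖x‖ := re_inner_le_norm _ _
    _ ≤ (K * ‖x‖) * ‖x‖ := by gcongr
    _ = _ := by ring

theorem norm_polyAt_adjoint_le (hn : 1 ≤ n) (A : X →L[𝕜] PiLp 2 Y) (q : Polynomial ℝ)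
    (hq : ∀ t ∈ Set.Icc 0 (‖A‖ ^ 2 / n), t * q.eval t ^ 2 ≤ K) (y : PiLp 2 Y) :
    ‖polyAt (normalOp A) q (A.adjoint y)‖ ≤ √(n * K) * ‖y‖ := by
  have hF : ‖A.comp (polyAt (normalOp A) q)‖ ≤ √(n * K) :=
    ContinuousLinearMap.opNorm_le_bound _ (Real.sqrt_nonneg _) (norm_apply_polyAt_le hn A q hq)
  have : polyAt (normalOp A) q (A.adjoint y) = (A.comp (polyAt (normalOp A) q)).adjoint y := by
    refine ext_inner_right 𝕜 fun x => ?_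
    rw [isSymmetric_polyAt (isPositive_normalOp A), ContinuousLinearMap.adjoint_inner_left,
      ContinuousLinearMap.adjoint_inner_left]
    rfl
  rw [this]
  exact ContinuousLinearMap.le_of_opNorm_le _
    ((LinearIsometryEquiv.norm_map _ _).trans_le hF) y

theorem norm_polyAt_adjoint_comp_le (hn : 1 ≤ n) (A : X →L[𝕜] PiLp 2 Y) (q : Polynomial ℝ)
    (hq : ∀ t ∈ Set.Icc 0 (‖A‖ ^ 2 / n), t * q.eval t ^ 2 ≤ K) (i : Fin n) (y : Y i) :
    ‖polyAt (normalOp A) q ((comp A i).adjoint y)‖ ≤ √(n * K) * ‖y‖ := by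
  have hF : ‖(comp A i).comp (polyAt (normalOp A) q)‖ ≤ √(n * K) :=
    ContinuousLinearMap.opNorm_le_bound _ (Real.sqrt_nonneg _) fun x =>
      (norm_comp_apply_le A i _).trans (norm_apply_polyAt_le hn A q hq x)
  have : polyAt (normalOp A) q ((comp A i).adjoint y)
      = ((comp A i).comp (polyAt (normalOp A) q)).adjoint y := by
    refine ext_inner_right 𝕜 fun x => ?_
    rw [isSymmetric_polyAt (isPositive_normalOp A), ContinuousLinearMap.adjoint_inner_left,
      ContinuousLinearMap.adjoint_inner_left]
    rfl
  rw [this]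
  exact ContinuousLinearMap.le_of_opNorm_le _
    ((LinearIsometryEquiv.norm_map _ _).trans_le hF) y

/-- The companion `n⁻¹ A A*` of `normalOp A`. -/
def conormalOp (A : X →L[𝕜] PiLp 2 Y) : PiLp 2 Y →L[𝕜] PiLp 2 Y :=
  ((n : 𝕜)⁻¹) • (A.comp A.adjoint)

theorem conormalOp_apply (A : X →L[𝕜] PiLp 2 Y) (y : PiLp 2 Y) :
    conormalOp A y = ((n : 𝕜)⁻¹) • A (A.adjoint y) := rfl

open scoped ComplexOrder in
theorem isPositive_conormalOp (A : X →L[𝕜] PiLp 2 Y) : (conormalOp A).IsPositive := by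
  have hn : (0 : 𝕜) ≤ (n : 𝕜)⁻¹ := by
    have : ((n : 𝕜)⁻¹) = (((n : ℝ)⁻¹ : ℝ) : 𝕜) := by push_cast; rfl
    rw [this]
    exact RCLike.ofReal_nonneg.mpr (by positivity)
  exact (ContinuousLinearMap.isPositive_self_comp_adjoint A).smul_of_nonneg hn

theorem norm_conormalOp (A : X →L[𝕜] PiLp 2 Y) : ‖conormalOp A‖ = ‖A‖ ^ 2 / n := by
  have h := ContinuousLinearMap.norm_adjoint_comp_self A.adjoint
  rw [ContinuousLinearMap.adjoint_adjoint, LinearIsometryEquiv.norm_map] at h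
  rw [conormalOp, norm_smul, h, norm_inv, RCLike.norm_natCast]
  ring

theorem apply_polyAt_normalOp (A : X →L[𝕜] PiLp 2 Y) (q : Polynomial ℝ) (x : X) :
    A (polyAt (normalOp A) q x) = polyAt (conormalOp A) q (A x) := by
  refine polyAt_intertwine (fun x => ?_) q x
  simp [normalOp_apply, conormalOp_apply]

/-- A q(B) n⁻¹A* = q(C)C with C = n⁻¹AA*, so the polynomial calculus applies in the data space,
without a factor n. -/
theorem norm_apply_polyAt_adjoint_le (A : X →L[𝕜] PiLp 2 Y) (q : Polynomial ℝ)
    (hq : ∀ t ∈ Set.Icc 0 (‖A‖ ^ 2 / n), |t * q.eval t| ≤ K) (y : PiLp 2 Y) :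
    ‖A (polyAt (normalOp A) q (((n : 𝕜)⁻¹) • A.adjoint y))‖ ≤ K * ‖y‖ := by
  have : A (polyAt (normalOp A) q (((n : 𝕜)⁻¹) • A.adjoint y))
      = polyAt (conormalOp A) (q * Polynomial.X) y := by
    rw [apply_polyAt_normalOp, polyAt_mul_apply, polyAt_X, map_smul]
    rfl
  rw [this]
  refine norm_polyAt_apply_le (isPositive_conormalOp A) (norm_conormalOp A).le _ (fun t ht => ?_) y
  rw [Polynomial.eval_mul, Polynomial.eval_X, mul_comm]
  exact hq t ht

end NormalOperator

/-! ### Variation of constants for the error -/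

section ErrorRecursion

open Finset

variable {𝕜 : Type*} [RCLike 𝕜]
variable {X : Type*} [NormedAddCommGroup X] [InnerProductSpace 𝕜 X]

/-- The residual polynomial `1 - c t` of a gradient step of size `c`. -/
def resid (c : ℝ) : Polynomial ℝ := 1 - Polynomial.C c * Polynomial.X

@[simp]
theorem eval_resid (c t : ℝ) : (resid c).eval t = 1 - c * t := by simp [resid]

theorem polyAt_resid_apply (B : X →L[𝕜] X) (c : ℝ) (x : X) :
    polyAt B (resid c) x = x - (c : 𝕜) • B x := by
  simp [resid, map_sub, map_mul]

/-- The error of the Landweber iteration with initial error `e₀` and perturbation `b`. -/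
def landweberError (B : X →L[𝕜] X) (c : ℝ) (b e₀ : X) (k : ℕ) : X :=
  polyAt B (resid c ^ k) e₀ + ∑ j ∈ range k, polyAt B (Polynomial.C c * resid c ^ j) b

theorem error_eq_landweberError_add {B : X →L[𝕜] X} {c : ℝ} {b : X} {e N : ℕ → X}
    (he : ∀ k, e (k + 1) = e k - (c : 𝕜) • B (e k) + (c : 𝕜) • b + (c : 𝕜) • N k) (k : ℕ) :
    e k = landweberError B c b (e 0) k
      + ∑ j ∈ range k, polyAt B (Polynomial.C c * resid c ^ (k - 1 - j)) (N j) := by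
  have hC : ∀ x, polyAt B (Polynomial.C c) x = (c : 𝕜) • x := fun x => by simp
  induction k with
  | zero => simp [landweberError]
  | succ k ih =>
    have hsum : ∑ j ∈ range (k + 1), polyAt B (Polynomial.C c * resid c ^ (k + 1 - 1 - j)) (N j)
        = polyAt B (resid c) (∑ j ∈ range k,
          polyAt B (Polynomial.C c * resid c ^ (k - 1 - j)) (N j)) + (c : 𝕜) • N k := by
      rw [sum_range_succ, map_sum]
      congr 1
      · refine sum_congr rfl fun j hj => ?_
        have hjk := mem_range.mp hj
        rw [← polyAt_mul_apply]
        have : k + 1 - 1 - j = (k - 1 - j) + 1 := by omega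
        rw [this]
        congr 2
        ring
      · simp
    have hdet : landweberError B c b (e 0) (k + 1)
        = polyAt B (resid c) (landweberError B c b (e 0) k) + (c : 𝕜) • b := by
      rw [landweberError, landweberError, sum_range_succ', map_add, map_sum, pow_succ',
        polyAt_mul_apply, add_assoc]
      congr 2
      · refine sum_congr rfl fun j _ => ?_
        rw [← polyAt_mul_apply]
        congr 2
        ring
      · simp
    rw [he, hsum, hdet, ← polyAt_resid_apply]
    conv_lhs => rw [ih]
    rw [map_add]
    abel

/-- One Landweber step changes the error by -c(1 - cB)^j(Be₀ - b). The factor B on e₀ is what makes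
the increments decay. -/
theorem landweberError_sub {B : X →L[𝕜] X} (c : ℝ) (b e₀ : X) {z k : ℕ} (h : z ≤ k) :
    landweberError B c b e₀ k - landweberError B c b e₀ z
      = -∑ j ∈ Ico z k, polyAt B (Polynomial.C c * resid c ^ j) (B e₀ - b) := by
  induction k, h using Nat.le_induction with
  | base => simp
  | succ k hk ih =>
    rw [sum_Ico_succ_top hk, neg_add, ← ih, landweberError, landweberError, landweberError,
      sum_range_succ, map_sub]
    have : polyAt B (resid c ^ (k + 1)) e₀ = polyAt B (resid c ^ k) e₀
        - polyAt B (Polynomial.C c * resid c ^ k) (B e₀) := by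
      nth_rw 4 [← polyAt_X B]
      rw [← polyAt_mul_apply]
      rw [← sub_apply, ← map_sub]
      congr 2
      rw [resid]
      ring
    rw [this]
    abel

end ErrorRecursion

/-! ### The Volterra kernels of the drift and their contraction property -/

section DriftKernel

open Finset

/-- The polynomial that maps the `j`-th gradient noise to the drift `e_k - e_{[k/M]M}`. -/
def driftPoly (c : ℝ) (M k j : ℕ) : Polynomial ℝ :=
  Polynomial.C c * resid c ^ (k - 1 - j)
    - if j < k / M * M then Polynomial.C c * resid c ^ (k / M * M - 1 - j) else 0

theorem sub_div_mul_lt {M : ℕ} (hM : 1 ≤ M) (k : ℕ) : k - k / M * M < M := by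
  have h1 := Nat.mod_lt k hM
  have h2 := Nat.mod_add_div k M
  rw [mul_comm] at h2
  omega

theorem eval_driftPoly_of_le {c t : ℝ} {M k j : ℕ} (hj : k / M * M ≤ j) :
    t * (driftPoly c M k j).eval t ^ 2 = c * (c * t * (1 - c * t) ^ (2 * (k - 1 - j))) := by
  rw [driftPoly, if_neg (by omega)]
  simp only [sub_zero, Polynomial.eval_mul, Polynomial.eval_C, Polynomial.eval_pow, eval_resid]
  rw [pow_mul']
  ring

/-- Noise older than the anchor z acts on both x_k and x_z; the difference of the propagators leaves
the factor 1 - (1 - ct)^(k - z), with k - z < M. -/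
theorem eval_driftPoly_of_lt {c t : ℝ} {M k j : ℕ} (hj : j < k / M * M) :
    t * (driftPoly c M k j).eval t ^ 2
      = c * (c * t * (1 - c * t) ^ (2 * (k / M * M - 1 - j))
        * (1 - (1 - c * t) ^ (k - k / M * M)) ^ 2) := by
  have hz : k / M * M ≤ k := Nat.div_mul_le_self k M
  rw [driftPoly, if_pos hj]
  simp only [Polynomial.eval_sub, Polynomial.eval_mul, Polynomial.eval_C, Polynomial.eval_pow,
    eval_resid]
  have : k - 1 - j = (k / M * M - 1 - j) + (k - k / M * M) := by omega
  rw [this, pow_add, pow_mul']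
  ring

/-- The bound for the influence of the `j`-th gradient noise on the mean square of the drift. -/
def meanKernel (s₀ : ℝ) (M k j : ℕ) : ℝ :=
  if k / M * M ≤ j then min s₀ (1 / (1 + 4 * (k - 1 - j : ℕ)))
  else if k / M * M - 1 - j < M then min s₀ (1 / (1 + 4 * (k / M * M - 1 - j : ℕ)))
  else 0.172 * (M : ℝ) ^ 2 / ((k / M * M - 1 - j : ℕ) : ℝ) ^ 3

theorem meanKernel_nonneg {s₀ : ℝ} (h0 : 0 ≤ s₀) (M k j : ℕ) : 0 ≤ meanKernel s₀ M k j := by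
  rw [meanKernel]
  split_ifs
  · exact le_min h0 (by positivity)
  · exact le_min h0 (by positivity)
  · positivity

theorem mul_one_sub_pow_le_min {s s₀ : ℝ} (h0 : 0 ≤ s) (hs : s ≤ s₀) (h1 : s₀ ≤ 1) (r : ℕ) :
    s * (1 - s) ^ (2 * r) ≤ min s₀ (1 / (1 + 4 * r)) := by
  refine le_min ?_ (mul_one_sub_pow_two_mul_le (hs.trans h1) r)
  calc s * (1 - s) ^ (2 * r) ≤ s * 1 :=
        mul_le_mul_of_nonneg_left (pow_le_one₀ (by linarith) (by linarith)) h0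
    _ ≤ s₀ := by linarith

/-- Before the anchor, 1 - (1 - s)^m is bounded by 1 in the near past and by Ms in the far past,
where its square turns s(1 - s)^(2p) into M²s³(1 - s)^(2p). -/
theorem driftPoly_le_meanKernel {c t s₀ : ℝ} {M : ℕ} (hM : 1 ≤ M) (hc : 0 ≤ c) (h0 : 0 ≤ c * t)
    (hs : c * t ≤ s₀) (h1 : s₀ ≤ 1) (k j : ℕ) :
    t * (driftPoly c M k j).eval t ^ 2 ≤ c * meanKernel s₀ M k j := by
  set s := c * t with hsdef
  have hs1 : s ≤ 1 := hs.trans h1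
  rcases le_or_gt (k / M * M) j with hj | hj
  · rw [eval_driftPoly_of_le hj, meanKernel, if_pos hj]
    exact mul_le_mul_of_nonneg_left (mul_one_sub_pow_le_min h0 hs h1 _) hc
  · rw [eval_driftPoly_of_lt hj, meanKernel, if_neg hj.not_ge]
    refine mul_le_mul_of_nonneg_left ?_ hc
    rw [← hsdef]
    set p := k / M * M - 1 - j
    set m := k - k / M * M with hm
    have hmM : m ≤ M := (sub_div_mul_lt hM k).le
    have hq0 : 0 ≤ 1 - (1 - s) ^ m := by
      linarith [pow_le_one₀ (n := m) (by linarith : 0 ≤ 1 - s) (by linarith)]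
    have hq1 : 1 - (1 - s) ^ m ≤ 1 := by linarith [pow_nonneg (by linarith : 0 ≤ 1 - s) m]
    have hp0 : 0 ≤ (1 - s) ^ (2 * p) := pow_nonneg (by linarith) _
    split_ifs with hpM
    · refine le_trans ?_ (mul_one_sub_pow_le_min h0 hs h1 p)
      exact mul_le_of_le_one_right (by positivity) (pow_le_one₀ hq0 hq1)
    · have hq2 : 1 - (1 - s) ^ m ≤ M * s :=
        (one_sub_one_sub_pow_le hs1 m).trans (by gcongr)
      have hp : 0 < p := by omega
      calc s * (1 - s) ^ (2 * p) * (1 - (1 - s) ^ m) ^ 2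
          ≤ s * (1 - s) ^ (2 * p) * (M * s) ^ 2 := by gcongr
        _ = (M : ℝ) ^ 2 * (s ^ 3 * (1 - s) ^ (2 * p)) := by ring
        _ ≤ (M : ℝ) ^ 2 * (0.172 / (p : ℝ) ^ 3) := by
          gcongr
          exact pow_three_mul_one_sub_pow_le_inv h0 hs1 hp
        _ = _ := by ring

/-- The bound for the influence of the `j`-th gradient noise on the drift along a path. -/
def pathKernel (s₀ : ℝ) (M k j : ℕ) : ℝ :=
  if k / M * M ≤ j then s₀
  else 4 * (M : ℝ) ^ 2 * (s₀ / (1 + (k / M * M - 1 - j : ℕ) * s₀)) ^ 3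

theorem driftPoly_le_pathKernel {c t s₀ : ℝ} {M : ℕ} (hM : 1 ≤ M) (hc : 0 ≤ c) (h0 : 0 ≤ c * t)
    (hs : c * t ≤ s₀) (h1 : s₀ ≤ 1) (k j : ℕ) :
    t * (driftPoly c M k j).eval t ^ 2 ≤ c * pathKernel s₀ M k j := by
  set s := c * t with hsdef
  have hs1 : s ≤ 1 := hs.trans h1
  rcases le_or_gt (k / M * M) j with hj | hj
  · rw [eval_driftPoly_of_le hj, pathKernel, if_pos hj]
    exact mul_le_mul_of_nonneg_left
      ((mul_one_sub_pow_le_min h0 hs h1 _).trans (min_le_left _ _)) hc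
  · rw [eval_driftPoly_of_lt hj, pathKernel, if_neg hj.not_ge]
    refine mul_le_mul_of_nonneg_left ?_ hc
    rw [← hsdef]
    set p := k / M * M - 1 - j
    set m := k - k / M * M with hm
    have hmM : m ≤ M := (sub_div_mul_lt hM k).le
    have hq0 : 0 ≤ 1 - (1 - s) ^ m := by
      linarith [pow_le_one₀ (n := m) (by linarith : 0 ≤ 1 - s) (by linarith)]
    have hp0 : 0 ≤ (1 - s) ^ (2 * p) := pow_nonneg (by linarith) _
    have hq2 : 1 - (1 - s) ^ m ≤ M * s :=
      (one_sub_one_sub_pow_le hs1 m).trans (by gcongr)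
    calc s * (1 - s) ^ (2 * p) * (1 - (1 - s) ^ m) ^ 2
        ≤ s * (1 - s) ^ (2 * p) * (M * s) ^ 2 := by gcongr
      _ = (M : ℝ) ^ 2 * (s ^ 3 * (1 - s) ^ (2 * p)) := by ring
      _ ≤ (M : ℝ) ^ 2 * (4 * (s₀ / (1 + p * s₀)) ^ 3) :=
        mul_le_mul_of_nonneg_left (pow_three_mul_one_sub_pow_le h0 hs h1 p) (by positivity)
      _ = _ := by ring

theorem sum_range_eq_sum_reflect (f : ℕ → ℝ) {z k : ℕ} (h : z ≤ k) :
    ∑ j ∈ range k, f j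
      = ∑ p ∈ range z, f (z - 1 - p) + ∑ r ∈ range (k - z), f (k - 1 - r) := by
  have h1 : ∑ j ∈ range z, f j + ∑ j ∈ Ico z k, f j = ∑ j ∈ range k, f j := by
    simpa only [range_eq_Ico] using sum_Ico_consecutive f (Nat.zero_le z) h
  rw [← h1, sum_range_reflect f z, sum_Ico_eq_sum_range f z k,
    ← sum_range_reflect (fun i => f (z + i)) (k - z)]
  congr 1
  refine sum_congr rfl fun r hr => ?_
  have := mem_range.mp hr
  simp only [show z + (k - z - 1 - r) = k - 1 - r by omega]

/-- The width of the weights for which the mean square kernel is a contraction. -/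
def weightWidth (M : ℕ) : ℝ := 100 * (2 * M * √(2 * M) + (M : ℝ) ^ 2)

theorem one_le_weightWidth {M : ℕ} (hM : 1 ≤ M) : 1 ≤ weightWidth M := by
  have hM1 : (1 : ℝ) ≤ M := by exact_mod_cast hM
  have : 0 ≤ 2 * M * √(2 * M) := by positivity
  rw [weightWidth]
  nlinarith

/-- The kernel mass consists of 1/4 since the anchor, 1/4 for the M steps before it and 2 · 0.172
for the far past. The variation of the weights adds at most 0.05. -/
theorem sum_meanKernel_aux {ℓ s₀ h : ℝ} {M : ℕ} (hM : 1 ≤ M) (hℓ0 : 0 ≤ ℓ) (hℓ1 : ℓ ≤ 1)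
    (h0 : 0 ≤ s₀) (hh : h = weightWidth M)
    (hsum : ∑ r ∈ range M, ℓ * min s₀ (1 / (1 + 4 * (r : ℝ))) ≤ 1 / 4) (k : ℕ) :
    ∑ j ∈ range k, ℓ * meanKernel s₀ M k j * (1 + 3 * ((k - j : ℕ) * √(k - j : ℕ)) / h) ≤ 0.95 := by
  have hM1 : (1 : ℝ) ≤ M := by exact_mod_cast hM
  have hh1 : 1 ≤ h := hh ▸ one_le_weightWidth hM
  set z := k / M * M with hz
  have hzk : z ≤ k := Nat.div_mul_le_self k M
  have hmM : k - z < M := sub_div_mul_lt hM k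
  set g : ℝ := 1 + 3 * (2 * M * √(2 * M)) / h with hg
  have hK0 : ∀ r : ℕ, 0 ≤ ℓ * min s₀ (1 / (1 + 4 * (r : ℝ))) := fun r =>
    mul_nonneg hℓ0 (le_min h0 (by positivity))
  have hgq : ∀ q : ℕ, q ≤ 2 * M → 1 + 3 * ((q : ℝ) * √q) / h ≤ g := by
    intro q hq
    have : (q : ℝ) ≤ 2 * M := by exact_mod_cast hq
    rw [hg]
    gcongr
  have hg0 : 0 ≤ g := by rw [hg]; positivity
  have hhead : ∑ r ∈ range M, ℓ * min s₀ (1 / (1 + 4 * (r : ℝ))) * g ≤ 1 / 4 * g := by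
    rw [← sum_mul]
    exact mul_le_mul_of_nonneg_right hsum hg0
  rw [sum_range_eq_sum_reflect _ hzk]
  have hin : ∑ r ∈ range (k - z), ℓ * meanKernel s₀ M k (k - 1 - r)
      * (1 + 3 * ((k - (k - 1 - r) : ℕ) * √(k - (k - 1 - r) : ℕ)) / h) ≤ 1 / 4 * g := by
    refine le_trans ?_ hhead
    refine le_trans (sum_le_sum fun r hr => ?_)
      (sum_le_sum_of_subset_of_nonneg (range_mono hmM.le) fun r _ _ => mul_nonneg (hK0 r) hg0)
    have hr' := mem_range.mp hr
    rw [meanKernel, if_pos (by omega)]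
    have : k - 1 - (k - 1 - r) = r := by omega
    rw [this]
    exact mul_le_mul_of_nonneg_left (hgq _ (by omega)) (hK0 r)
  have hout : ∑ p ∈ range z, ℓ * meanKernel s₀ M k (z - 1 - p)
      * (1 + 3 * ((k - (z - 1 - p) : ℕ) * √(k - (z - 1 - p) : ℕ)) / h)
      ≤ 1 / 4 * g + (0.344 + 5 * (M : ℝ) ^ 2 / h) := by
    set F : ℕ → ℝ := fun p => if p < M then ℓ * min s₀ (1 / (1 + 4 * (p : ℝ))) * g
      else 0.172 * (M : ℝ) ^ 2 * (1 / (p : ℝ) ^ 3 + 9 / h * (1 / ((p : ℝ) * √p))) with hF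
    have hF0 : ∀ p, 0 ≤ F p := by
      intro p
      simp only [hF]
      split_ifs
      · exact mul_nonneg (hK0 p) hg0
      · positivity
    have hterm : ∀ p ∈ range z, ℓ * meanKernel s₀ M k (z - 1 - p)
        * (1 + 3 * ((k - (z - 1 - p) : ℕ) * √(k - (z - 1 - p) : ℕ)) / h) ≤ F p := by
      intro p hp
      have hp' := mem_range.mp hp
      have e1 : z - 1 - (z - 1 - p) = p := by omega
      rw [meanKernel, if_neg (by omega), e1]
      simp only [hF]
      split_ifs with hpM
      · exact mul_le_mul_of_nonneg_left (hgq _ (by omega)) (hK0 p)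
      · have hp0 : (0 : ℝ) < p := by
          have : 0 < p := by omega
          exact_mod_cast this
        set q := k - (z - 1 - p)
        -- Here q = (k - z) + 1 + p with k - z < M ≤ p.
        have hq : (q : ℝ) ≤ 2 * p := by
          have : q ≤ 2 * p := by omega
          exact_mod_cast this
        have hsq : √(q : ℝ) ≤ 3 / 2 * √p := by
          calc √(q : ℝ) ≤ √((3 / 2) ^ 2 * p) := Real.sqrt_le_sqrt (by linarith)
            _ = _ := by rw [Real.sqrt_mul (by positivity), Real.sqrt_sq (by positivity)]
        have hqq : (q : ℝ) * √q ≤ 3 * (p * √p) := by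
          calc (q : ℝ) * √q ≤ 2 * p * (3 / 2 * √p) := by gcongr
            _ = _ := by ring
        have hsp : √(p : ℝ) ^ 2 = p := Real.sq_sqrt hp0.le
        have hsp0 : 0 < √(p : ℝ) := Real.sqrt_pos.mpr hp0
        calc ℓ * (0.172 * (M : ℝ) ^ 2 / (p : ℝ) ^ 3) * (1 + 3 * (q * √q) / h)
            ≤ 1 * (0.172 * (M : ℝ) ^ 2 / (p : ℝ) ^ 3) * (1 + 3 * (3 * (p * √p)) / h) := by gcongr
          _ = 0.172 * (M : ℝ) ^ 2 * (1 / (p : ℝ) ^ 3 + 9 / h * (p * √p / (p : ℝ) ^ 3)) := by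
              ring
          _ = _ := by
              have : p * √p / (p : ℝ) ^ 3 = 1 / ((p : ℝ) * √p) := by
                rw [div_eq_div_iff (by positivity) (by positivity)]
                linear_combination (p : ℝ) ^ 2 * hsp
              rw [this]
    refine (sum_le_sum hterm).trans ?_
    refine (sum_le_sum_of_subset_of_nonneg (range_mono (Nat.le_add_right z M))
      fun p _ _ => hF0 p).trans ?_
    rw [range_eq_Ico, ← sum_Ico_consecutive F (Nat.zero_le M) (Nat.le_add_left M z),
      ← range_eq_Ico]
    refine add_le_add (le_trans (sum_le_sum fun p hp => ?_) hhead) ?_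
    · simp only [hF, if_pos (mem_range.mp hp)]; exact le_rfl
    · have : ∑ p ∈ Ico M (z + M), F p = 0.172 * (M : ℝ) ^ 2 * (∑ p ∈ Ico M (z + M), 1 / (p : ℝ) ^ 3
          + 9 / h * ∑ p ∈ Ico M (z + M), 1 / ((p : ℝ) * √p)) := by
        rw [mul_sum (a := 9 / h), ← sum_add_distrib, mul_sum]
        refine sum_congr rfl fun p hp => ?_
        simp only [hF, if_neg (mem_Ico.mp hp).1.not_gt]
      rw [this]
      have h3 := sum_inv_pow_three_le hM (z + M)
      have h4 := sum_inv_mul_sqrt_Ico_le hM (z + M)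
      calc 0.172 * (M : ℝ) ^ 2 * (∑ p ∈ Ico M (z + M), 1 / (p : ℝ) ^ 3
            + 9 / h * ∑ p ∈ Ico M (z + M), 1 / ((p : ℝ) * √p))
          ≤ 0.172 * (M : ℝ) ^ 2 * (2 / (M : ℝ) ^ 2 + 9 / h * 3) := by gcongr
        _ = 0.344 + 4.644 * ((M : ℝ) ^ 2 / h) := by field_simp; ring
        _ ≤ 0.344 + 5 * ((M : ℝ) ^ 2 / h) := by gcongr; norm_num
        _ = _ := by ring
  -- This is what the factor 100 in `weightWidth` is for.
  have hfin : 3 / 2 * (2 * M * √(2 * M)) / h + 5 * (M : ℝ) ^ 2 / h ≤ 0.05 := by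
    rw [← add_div, div_le_iff₀ (by linarith), hh, weightWidth]
    have : 0 ≤ 2 * M * √(2 * M) := by positivity
    nlinarith [sq_nonneg (M : ℝ)]
  have hgval : 1 / 4 * g + 1 / 4 * g = 1 / 2 + 3 / 2 * (2 * M * √(2 * M)) / h := by
    rw [hg]; ring
  linarith

theorem sum_meanKernel_mul_le {ℓ s₀ h : ℝ} {M : ℕ} (hM : 1 ≤ M) (hℓ0 : 0 ≤ ℓ) (hℓ1 : ℓ ≤ 1)
    (h0 : 0 ≤ s₀) (hh : h = weightWidth M)
    (hsum : ∑ r ∈ range M, ℓ * min s₀ (1 / (1 + 4 * (r : ℝ))) ≤ 1 / 4) (k : ℕ) :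
    ∑ j ∈ range k, ℓ * meanKernel s₀ M k j * (1 / ((j + h ^ 2) * √(j + h ^ 2)))
      ≤ 0.95 * (1 / ((k + h ^ 2) * √(k + h ^ 2))) := by
  have hh1 : 1 ≤ h := hh ▸ one_le_weightWidth hM
  have hpos : ∀ j : ℕ, 0 < (j + h ^ 2) * √(j + h ^ 2) := fun j => by positivity
  refine le_trans (sum_le_sum fun j hj => ?_) ((sum_mul (range k) (fun j : ℕ =>
    ℓ * meanKernel s₀ M k j * (1 + 3 * ((k - j : ℕ) * √(k - j : ℕ)) / h)) _).symm.trans_le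
    (mul_le_mul_of_nonneg_right (sum_meanKernel_aux hM hℓ0 hℓ1 h0 hh hsum k)
      (one_div_nonneg.mpr (hpos k).le)))
  have hjk := mem_range.mp hj
  rw [mul_assoc (ℓ * meanKernel s₀ M k j) (1 + _)]
  refine mul_le_mul_of_nonneg_left ?_ (mul_nonneg hℓ0 (meanKernel_nonneg h0 M k j))
  have hq : (1 : ℝ) ≤ ((k - j : ℕ) : ℝ) := by exact_mod_cast (by omega : 1 ≤ k - j)
  have hx : h ^ 2 ≤ (j : ℝ) + h ^ 2 := by linarith [(j.cast_nonneg : (0 : ℝ) ≤ j)]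
  have h1 := add_mul_sqrt_add_le hh1 hx hq
  have hk : (j : ℝ) + h ^ 2 + ((k - j : ℕ) : ℝ) = k + h ^ 2 := by
    rw [Nat.cast_sub hjk.le]; ring
  rw [hk] at h1
  rw [← div_eq_mul_one_div, div_le_div_iff₀ (hpos j) (hpos k), one_mul]
  linarith

/-- The root of the old part of the kernel decays like (1 + ps₀)^(-3/2), and its convolution with
1/(1 + js₀) reproduces that weight. With 200a√s₀M ≤ 1, the shares since and before the anchor are
1/100 and 28/200; comparing the weights at z and k at most doubles them. -/
theorem sum_pathKernel_mul_le {a s₀ : ℝ} {M : ℕ} (hM : 1 ≤ M) (ha : 0 ≤ a) (h0 : 0 ≤ s₀)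
    (h1 : s₀ ≤ 1) (ha1 : 200 * (a * √s₀ * M) ≤ 1) (hsM : s₀ * M ≤ 1) (k : ℕ) :
    ∑ j ∈ range k, 2 * a * √(pathKernel s₀ M k j) * (1 / (1 + j * s₀))
      ≤ 1 / 2 * (1 / (1 + k * s₀)) := by
  have hM1 : (1 : ℝ) ≤ M := by exact_mod_cast hM
  set z := k / M * M with hz
  have hzk : z ≤ k := Nat.div_mul_le_self k M
  have hmM : k - z < M := sub_div_mul_lt hM k
  have hzw : 1 / (1 + z * s₀) ≤ 2 * (1 / (1 + k * s₀)) := by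
    have hk : (k : ℝ) ≤ z + M := by
      have : k ≤ z + M := by omega
      exact_mod_cast this
    rw [← mul_div_assoc, mul_one, div_le_div_iff₀ (by positivity) (by positivity)]
    nlinarith [mul_le_mul_of_nonneg_right hk h0, mul_nonneg (z.cast_nonneg : (0 : ℝ) ≤ z) h0]
  have hy0 : 0 ≤ a * √s₀ := by positivity
  rw [range_eq_Ico, ← sum_Ico_consecutive _ (Nat.zero_le z) hzk, ← range_eq_Ico]
  have hin : ∑ j ∈ Ico z k, 2 * a * √(pathKernel s₀ M k j) * (1 / (1 + j * s₀))
      ≤ 1 / 100 * (1 / (1 + z * s₀)) := by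
    calc ∑ j ∈ Ico z k, 2 * a * √(pathKernel s₀ M k j) * (1 / (1 + j * s₀))
        ≤ ∑ _j ∈ Ico z k, 2 * (a * √s₀) * (1 / (1 + z * s₀)) := by
          refine sum_le_sum fun j hj => ?_
          have hzj := (mem_Ico.mp hj).1
          have hzj' : (z : ℝ) ≤ j := by exact_mod_cast hzj
          rw [pathKernel, if_pos hzj, mul_assoc 2 a]
          gcongr
      _ = ((k - z : ℕ) : ℝ) * (2 * (a * √s₀) * (1 / (1 + z * s₀))) := by simp
      _ ≤ M * (2 * (a * √s₀) * (1 / (1 + z * s₀))) := by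
          have : ((k - z : ℕ) : ℝ) ≤ M := by exact_mod_cast hmM.le
          gcongr
      _ = (2 * (a * √s₀ * M)) * (1 / (1 + z * s₀)) := by ring
      _ ≤ _ := by
          refine mul_le_mul_of_nonneg_right (by linarith) (by positivity)
  have hout : ∑ j ∈ range z, 2 * a * √(pathKernel s₀ M k j) * (1 / (1 + j * s₀))
      ≤ 7 / 50 * (1 / (1 + z * s₀)) := by
    have hterm : ∀ j ∈ range z, 2 * a * √(pathKernel s₀ M k j) * (1 / (1 + j * s₀))
        = 4 * (a * √s₀ * M) * (s₀ / ((1 + (z - 1 - j : ℕ) * s₀) * √(1 + (z - 1 - j : ℕ) * s₀))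
          * (1 / (1 + j * s₀))) := by
      intro j hj
      rw [pathKernel, if_neg (not_le.mpr (mem_range.mp hj))]
      set b := 1 + (z - 1 - j : ℕ) * s₀ with hb
      have hb0 : 0 < b := by positivity
      have : √(4 * (M : ℝ) ^ 2 * (s₀ / b) ^ 3) = 2 * M * (s₀ / b * (√s₀ / √b)) := by
        rw [show 4 * (M : ℝ) ^ 2 * (s₀ / b) ^ 3 = (2 * M * (s₀ / b)) ^ 2 * (s₀ / b) by ring,
          Real.sqrt_mul (by positivity), Real.sqrt_sq (by positivity), Real.sqrt_div h0]
        ring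
      rw [this]
      field_simp
      ring
    rw [sum_congr rfl hterm, ← mul_sum]
    calc _ ≤ 4 * (a * √s₀ * M) * (7 / (1 + z * s₀)) :=
          mul_le_mul_of_nonneg_left (sum_div_mul_sqrt_mul_le h0 h1 z) (by positivity)
      _ = (28 * (a * √s₀ * M)) * (1 / (1 + z * s₀)) := by ring
      _ ≤ _ := by
          refine mul_le_mul_of_nonneg_right (by linarith) (by positivity)
  have hk0 : 0 ≤ 1 / (1 + k * s₀) := by positivity
  linarith

end DriftKernel

/-! ### The gradient noise -/

section Innovation

open Finset

variable {𝕜 : Type*} [RCLike 𝕜]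
variable {X : Type*} [NormedAddCommGroup X] [InnerProductSpace 𝕜 X] [CompleteSpace X]
variable {n : ℕ} {Y : Fin n → Type*} [∀ i, NormedAddCommGroup (Y i)]
  [∀ i, InnerProductSpace 𝕜 (Y i)] [∀ i, CompleteSpace (Y i)]

/-- The gradient noise `(B - Aᵢ* Aᵢ) x` of the `i`-th component. -/
def innov (A : X →L[𝕜] PiLp 2 Y) (i : Fin n) (x : X) : X :=
  normalOp A x - (comp A i).adjoint (comp A i x)

theorem normalOp_apply_eq_sum (A : X →L[𝕜] PiLp 2 Y) (x : X) :
    normalOp A x = ((n : 𝕜)⁻¹) • ∑ i, (comp A i).adjoint (comp A i x) := by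
  rw [normalOp_apply, adjoint_apply_eq_sum]

theorem sum_innov (hn : 1 ≤ n) (A : X →L[𝕜] PiLp 2 Y) (x : X) : ∑ i, innov A i x = 0 := by
  have hn' : (n : 𝕜) ≠ 0 := by exact_mod_cast (by omega : n ≠ 0)
  simp only [innov, sum_sub_distrib, normalOp_apply_eq_sum, sum_const, card_univ, Fintype.card_fin]
  rw [← Nat.cast_smul_eq_nsmul 𝕜, smul_smul, mul_inv_cancel₀ hn', one_smul, sub_self]

/-- The variance is at most the second moment: F B x is the mean of the F A_i*A_i x. -/
theorem sum_norm_sq_innov_le (hn : 1 ≤ n) {E : Type*} [NormedAddCommGroup E]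
    [InnerProductSpace 𝕜 E] (A : X →L[𝕜] PiLp 2 Y) (F : X →L[𝕜] E) {κ : ℝ}
    (hF : ∀ i (y : Y i), ‖F ((comp A i).adjoint y)‖ ^ 2 ≤ κ * ‖y‖ ^ 2) (x : X) :
    ∑ i, ‖F (innov A i x)‖ ^ 2 ≤ κ * ‖A x‖ ^ 2 := by
  set v : Fin n → E := fun i => F ((comp A i).adjoint (comp A i x))
  set m : E := F (normalOp A x) with hm
  have hn' : (n : 𝕜) ≠ 0 := by exact_mod_cast (by omega : n ≠ 0)
  have hsum : ∑ i, v i = (n : 𝕜) • m := by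
    rw [hm, normalOp_apply_eq_sum, map_smul, smul_smul, mul_inv_cancel₀ hn', one_smul, map_sum]
  have h1 : ∑ i, ‖F (innov A i x)‖ ^ 2 = ∑ i, ‖v i‖ ^ 2 - n * ‖m‖ ^ 2 := by
    have h2 : ∀ i, ‖F (innov A i x)‖ ^ 2
        = ‖m‖ ^ 2 - 2 * RCLike.re ⟪m, v i⟫_𝕜 + ‖v i‖ ^ 2 := by
      intro i
      rw [innov, map_sub, @norm_sub_sq 𝕜]
    have h3 : ∑ i, RCLike.re ⟪m, v i⟫_𝕜 = n * ‖m‖ ^ 2 := by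
      rw [← map_sum, ← inner_sum, hsum, inner_smul_right, inner_self_eq_norm_sq_to_K]
      norm_cast
    simp only [h2, sum_add_distrib, sum_sub_distrib, ← mul_sum, h3, sum_const, card_univ,
      Fintype.card_fin, nsmul_eq_mul]
    ring
  rw [h1, norm_sq_eq_sum_comp, mul_sum]
  have h4 : ∑ i, ‖v i‖ ^ 2 ≤ ∑ i, κ * ‖comp A i x‖ ^ 2 := sum_le_sum fun i _ => hF i _
  have h5 : 0 ≤ n * ‖m‖ ^ 2 := by positivity
  linarith

/-- For a fixed index nothing averages out and √n remains. Working with the largest ‖A_i x‖ prevents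
a further loss, since B x is a mean of component terms. -/
theorem norm_polyAt_innov_le (hn : 1 ≤ n) (A : X →L[𝕜] PiLp 2 Y) {q : Polynomial ℝ} {K d : ℝ}
    (hq : ∀ t ∈ Set.Icc 0 (‖A‖ ^ 2 / n), t * q.eval t ^ 2 ≤ K) {x : X}
    (hd : ∀ i, ‖comp A i x‖ ≤ d) (i : Fin n) :
    ‖polyAt (normalOp A) q (innov A i x)‖ ≤ 2 * √(n * K) * d := by
  have hn0 : (0 : ℝ) < n := by exact_mod_cast hn
  have h1 : ∀ j, ‖polyAt (normalOp A) q ((comp A j).adjoint (comp A j x))‖ ≤ √(n * K) * d :=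
    fun j => (norm_polyAt_adjoint_comp_le hn A q hq j _).trans
      (mul_le_mul_of_nonneg_left (hd j) (Real.sqrt_nonneg _))
  have h2 : ‖polyAt (normalOp A) q (normalOp A x)‖ ≤ √(n * K) * d := by
    rw [normalOp_apply_eq_sum, map_smul, map_sum, norm_smul, norm_inv, RCLike.norm_natCast,
      inv_mul_le_iff₀ hn0]
    calc _ ≤ ∑ _j : Fin n, √(n * K) * d := norm_sum_le_of_le _ fun j _ => h1 j
      _ = _ := by simp
  rw [innov, map_sub]
  calc _ ≤ √(n * K) * d + √(n * K) * d := (norm_sub_le _ _).trans (add_le_add h2 (h1 i))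
    _ = _ := by ring

end Innovation

/-! ### Error and drift along a path -/

section Iteration

open Finset

variable {𝕜 : Type*} [RCLike 𝕜]
variable {X : Type*} [NormedAddCommGroup X] [InnerProductSpace 𝕜 X] [CompleteSpace X]
variable {n : ℕ} {Y : Fin n → Type*} [∀ i, NormedAddCommGroup (Y i)]
  [∀ i, InnerProductSpace 𝕜 (Y i)] [∀ i, CompleteSpace (Y i)]

/-- The drift `x_k - x_{[k/M]M}` from the anchor point. -/
def drift (A : X →L[𝕜] PiLp 2 Y) (y : PiLp 2 Y) (x₀ : X) (c : ℝ) (M : ℕ) (s : ℕ → Fin n) (k : ℕ) :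
    X :=
  iterate A y x₀ (fun _ => c) M s k - iterate A y x₀ (fun _ => c) M s (k / M * M)

theorem iterate_zero (A : X →L[𝕜] PiLp 2 Y) (y : PiLp 2 Y) (x₀ : X) (η : ℕ → ℝ) (M : ℕ)
    (s : ℕ → Fin n) : iterate A y x₀ η M s 0 = x₀ := by
  rw [iterate]

/-- Adaptedness: this is what makes the gradient noise a martingale difference. -/
theorem iterate_congr (A : X →L[𝕜] PiLp 2 Y) (y : PiLp 2 Y) (x₀ : X) (η : ℕ → ℝ) (M : ℕ)
    {s s' : ℕ → Fin n} {k : ℕ} (h : ∀ j < k, s j = s' j) :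
    iterate A y x₀ η M s k = iterate A y x₀ η M s' k := by
  induction k using Nat.strong_induction_on with
  | _ k ih =>
    cases k with
    | zero => rw [iterate_zero, iterate_zero]
    | succ k =>
      have hz : k / M * M ≤ k := Nat.div_mul_le_self k M
      rw [iterate, iterate, ih k k.lt_succ_self fun j hj => h j (by omega),
        ih (k / M * M) (by omega) fun j hj => h j (by omega)]
      have hcomp : ∀ i i' : Fin n, i = i' → ∀ x,
          (comp A i).adjoint (comp A i x) = (comp A i').adjoint (comp A i' x) := by
        rintro i _ rfl x
        rfl
      rw [hcomp _ _ (h k k.lt_succ_self)]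

theorem drift_congr (A : X →L[𝕜] PiLp 2 Y) (y : PiLp 2 Y) (x₀ : X) (c : ℝ) (M : ℕ)
    {s s' : ℕ → Fin n} {k : ℕ} (h : ∀ j < k, s j = s' j) :
    drift A y x₀ c M s k = drift A y x₀ c M s' k := by
  have hz : k / M * M ≤ k := Nat.div_mul_le_self k M
  rw [drift, drift, iterate_congr A y x₀ _ M h,
    iterate_congr A y x₀ _ M fun j hj => h j (hj.trans_le hz)]

/-- The anchor contributes B(z - x†) to the full gradient; writing it as B(x_k - x†) - BΔ_k leaves
(B - A_i*A_i)Δ_k as noise. Only the normal equation is needed, since for a truncated A in general A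
x† ≠ y†. -/
theorem error_succ {A : X →L[𝕜] PiLp 2 Y} {yd : PiLp 2 Y} {xd : X}
    (hxd : A.adjoint (A xd) = A.adjoint yd) (y : PiLp 2 Y) (x₀ : X) (c : ℝ) (M : ℕ)
    (s : ℕ → Fin n) (k : ℕ) :
    iterate A y x₀ (fun _ => c) M s (k + 1) - xd
      = (iterate A y x₀ (fun _ => c) M s k - xd)
        - (c : 𝕜) • normalOp A (iterate A y x₀ (fun _ => c) M s k - xd)
        + (c : 𝕜) • (((n : 𝕜)⁻¹) • A.adjoint (y - yd))
        + (c : 𝕜) • innov A (s k) (drift A y x₀ c M s k) := by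
  rw [iterate, innov, drift]
  set xk := iterate A y x₀ (fun _ => c) M s k
  set z := iterate A y x₀ (fun _ => c) M s (k / M * M)
  have h1 : normalOp A (xk - z) = normalOp A (xk - xd) - normalOp A (z - xd) := by
    rw [← map_sub]; congr 1; abel
  have h2 : ((n : 𝕜)⁻¹) • A.adjoint (A z - y)
      = normalOp A (z - xd) - ((n : 𝕜)⁻¹) • A.adjoint (y - yd) := by
    rw [normalOp_apply, ← smul_sub]
    congr 1
    simp only [map_sub, hxd]
    abel
  rw [h1, h2]
  module

theorem error_eq {A : X →L[𝕜] PiLp 2 Y} {yd : PiLp 2 Y} {xd : X}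
    (hxd : A.adjoint (A xd) = A.adjoint yd) (y : PiLp 2 Y) (x₀ : X) (c : ℝ) (M : ℕ)
    (s : ℕ → Fin n) (k : ℕ) :
    iterate A y x₀ (fun _ => c) M s k - xd
      = landweberError (normalOp A) c (((n : 𝕜)⁻¹) • A.adjoint (y - yd)) (x₀ - xd) k
        + ∑ j ∈ range k, polyAt (normalOp A) (Polynomial.C c * resid c ^ (k - 1 - j))
          (innov A (s j) (drift A y x₀ c M s j)) := by
  have h := error_eq_landweberError_add (e := fun k => iterate A y x₀ (fun _ => c) M s k - xd)
    (N := fun k => innov A (s k) (drift A y x₀ c M s k)) (error_succ hxd y x₀ c M s) k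
  simpa only [iterate_zero] using h

theorem drift_eq {A : X →L[𝕜] PiLp 2 Y} {yd : PiLp 2 Y} {xd : X}
    (hxd : A.adjoint (A xd) = A.adjoint yd) (y : PiLp 2 Y) (x₀ : X) (c : ℝ) (M : ℕ)
    (s : ℕ → Fin n) (k : ℕ) :
    drift A y x₀ c M s k
      = (landweberError (normalOp A) c (((n : 𝕜)⁻¹) • A.adjoint (y - yd)) (x₀ - xd) k
        - landweberError (normalOp A) c (((n : 𝕜)⁻¹) • A.adjoint (y - yd)) (x₀ - xd) (k / M * M))
        + ∑ j ∈ range k, polyAt (normalOp A) (driftPoly c M k j)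
          (innov A (s j) (drift A y x₀ c M s j)) := by
  have hz : k / M * M ≤ k := Nat.div_mul_le_self k M
  set N : ℕ → X := fun j => innov A (s j) (drift A y x₀ c M s j) with hN
  have h1 : ∑ j ∈ range k, polyAt (normalOp A) (driftPoly c M k j) (N j)
      = ∑ j ∈ range k, polyAt (normalOp A) (Polynomial.C c * resid c ^ (k - 1 - j)) (N j)
        - ∑ j ∈ range (k / M * M),
          polyAt (normalOp A) (Polynomial.C c * resid c ^ (k / M * M - 1 - j)) (N j) := by
    have h2 : ∑ j ∈ range (k / M * M),
        polyAt (normalOp A) (Polynomial.C c * resid c ^ (k / M * M - 1 - j)) (N j)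
        = ∑ j ∈ range k, if j < k / M * M then
          polyAt (normalOp A) (Polynomial.C c * resid c ^ (k / M * M - 1 - j)) (N j) else 0 := by
      rw [← sum_filter]
      refine sum_congr ?_ fun _ _ => rfl
      ext j
      simp only [mem_range, mem_filter]
      omega
    rw [h2, ← sum_sub_distrib]
    refine sum_congr rfl fun j _ => ?_
    rw [driftPoly]
    split_ifs <;> simp
  rw [h1, drift, ← sub_sub_sub_cancel_right _ _ xd, error_eq hxd, error_eq hxd y x₀ c M s (k / M * M)]
  abel

/-- Fewer than M Landweber increments have accumulated since the anchor z, each of size O(s₀/(1 +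
zs₀)) after applying A. -/
theorem norm_apply_landweberError_sub_le {A : X →L[𝕜] PiLp 2 Y} {c s₀ : ℝ} {M : ℕ} (hM : 1 ≤ M)
    (hc : 0 ≤ c) (hs₀ : s₀ = c * (‖A‖ ^ 2 / n)) (h1 : s₀ ≤ 1) (ξ : PiLp 2 Y) (e₀ : X) (k : ℕ) :
    ‖A (landweberError (normalOp A) c (((n : 𝕜)⁻¹) • A.adjoint ξ) e₀ k
      - landweberError (normalOp A) c (((n : 𝕜)⁻¹) • A.adjoint ξ) e₀ (k / M * M))‖
      ≤ M * (‖A‖ * ‖e₀‖ + ‖ξ‖) * (s₀ / (1 + (k / M * M : ℕ) * s₀)) := by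
  have hs00 : 0 ≤ s₀ := by rw [hs₀]; positivity
  have hz : k / M * M ≤ k := Nat.div_mul_le_self k M
  set z := k / M * M with hzdef
  have hR : 0 ≤ ‖A‖ * ‖e₀‖ + ‖ξ‖ := by positivity
  have hpoly : ∀ j, z ≤ j → ∀ t ∈ Set.Icc 0 (‖A‖ ^ 2 / n),
      |t * (Polynomial.C c * resid c ^ j).eval t| ≤ s₀ / (1 + z * s₀) := by
    intro j hj t ht
    have hct : c * t ≤ s₀ := hs₀ ▸ mul_le_mul_of_nonneg_left ht.2 hc
    have hct0 : 0 ≤ c * t := mul_nonneg hc ht.1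
    have e : t * (Polynomial.C c * resid c ^ j).eval t = c * t * (1 - c * t) ^ j := by
      simp; ring
    rw [e, abs_of_nonneg (mul_nonneg hct0 (pow_nonneg (by linarith) _))]
    calc c * t * (1 - c * t) ^ j ≤ c * t * (1 - c * t) ^ z := by
          refine mul_le_mul_of_nonneg_left ?_ hct0
          exact pow_le_pow_of_le_one (by linarith) (by linarith) hj
      _ ≤ _ := mul_one_sub_pow_le hct0 hct h1 z
  rw [landweberError_sub c _ e₀ hz, map_neg, norm_neg, map_sum]
  have hterm : ∀ j ∈ Ico z k, ‖A (polyAt (normalOp A) (Polynomial.C c * resid c ^ j)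
      (normalOp A e₀ - ((n : 𝕜)⁻¹) • A.adjoint ξ))‖
      ≤ (‖A‖ * ‖e₀‖ + ‖ξ‖) * (s₀ / (1 + z * s₀)) := by
    intro j hj
    have hj' := hpoly j (mem_Ico.mp hj).1
    rw [map_sub, map_sub]
    have e1 : polyAt (normalOp A) (Polynomial.C c * resid c ^ j) (normalOp A e₀)
        = polyAt (normalOp A) (Polynomial.C c * resid c ^ j * Polynomial.X) e₀ := by
      rw [polyAt_mul_apply _ (Polynomial.C c * resid c ^ j) Polynomial.X, polyAt_X]
    have e2 : ‖A (polyAt (normalOp A) (Polynomial.C c * resid c ^ j) (normalOp A e₀))‖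
        ≤ ‖A‖ * (s₀ / (1 + z * s₀) * ‖e₀‖) := by
      refine (A.le_opNorm _).trans (mul_le_mul_of_nonneg_left ?_ (norm_nonneg _))
      rw [e1]
      refine norm_polyAt_apply_le (isPositive_normalOp A) (norm_normalOp A).le _ (fun t ht => ?_) e₀
      rw [Polynomial.eval_mul, Polynomial.eval_X, mul_comm]
      exact hj' t ht
    have e3 := norm_apply_polyAt_adjoint_le A _ hj' ξ
    refine (norm_sub_le _ _).trans ((add_le_add e2 e3).trans_eq ?_)
    ring
  calc _ ≤ ∑ _j ∈ Ico z k, (‖A‖ * ‖e₀‖ + ‖ξ‖) * (s₀ / (1 + z * s₀)) := norm_sum_le_of_le _ hterm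
    _ = ((k - z : ℕ) : ℝ) * ((‖A‖ * ‖e₀‖ + ‖ξ‖) * (s₀ / (1 + z * s₀))) := by simp
    _ ≤ M * ((‖A‖ * ‖e₀‖ + ‖ξ‖) * (s₀ / (1 + z * s₀))) := by
        have : ((k - z : ℕ) : ℝ) ≤ M := by exact_mod_cast (sub_div_mul_lt hM k).le
        gcongr
    _ = _ := by ring

theorem eval_C_mul_resid_pow_le {c t : ℝ} (hc : 0 ≤ c) (h1 : c * t ≤ 1) (r : ℕ) :
    t * (Polynomial.C c * resid c ^ r).eval t ^ 2 ≤ c * (1 / (1 + r)) := by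
  have e : t * (Polynomial.C c * resid c ^ r).eval t ^ 2 = c * (c * t * (1 - c * t) ^ (2 * r)) := by
    simp only [Polynomial.eval_mul, Polynomial.eval_C, Polynomial.eval_pow, eval_resid]
    rw [pow_mul']
    ring
  rw [e]
  refine mul_le_mul_of_nonneg_left ((mul_one_sub_pow_two_mul_le h1 r).trans ?_) hc
  gcongr
  linarith [(r.cast_nonneg : (0 : ℝ) ≤ r)]

/-- Gronwall with contraction factor 1/2 for the largest component of AΔ_k. Since s₀ ≤ 1, the result
is O(1/(1 + k)) uniformly in n. -/
theorem norm_comp_drift_le {A : X →L[𝕜] PiLp 2 Y} {yd : PiLp 2 Y} {xd : X} {c s₀ : ℝ} {M : ℕ}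
    (hn : 1 ≤ n) (hxd : A.adjoint (A xd) = A.adjoint yd) (hM : 1 ≤ M) (hc : 0 ≤ c)
    (hL : c * maxNormSq A ≤ 1) (hstep : 200 * (c * √(maxNormSq A) * ‖A‖ * M) ≤ 1)
    (hs₀ : s₀ = c * (‖A‖ ^ 2 / n)) (y : PiLp 2 Y) (x₀ : X) (s : ℕ → Fin n) (i : Fin n) (k : ℕ) :
    ‖comp A i (drift A y x₀ c M s k)‖
      ≤ 4 * M * (‖A‖ * ‖x₀ - xd‖ + ‖y - yd‖) * s₀ * (1 / (1 + k * s₀)) := by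
  have hn0 : (0 : ℝ) < n := by exact_mod_cast hn
  have hn1 : (1 : ℝ) ≤ n := by exact_mod_cast hn
  have : NeZero n := ⟨by omega⟩
  have hM1 : (1 : ℝ) ≤ M := by exact_mod_cast hM
  set L := maxNormSq A with hLdef
  have hL0 : 0 ≤ L := maxNormSq_nonneg A
  have hs00 : 0 ≤ s₀ := by rw [hs₀]; positivity
  have h1 : s₀ ≤ 1 := hs₀ ▸ (step_mul_norm_sq_le hn hc).trans hL
  set R := ‖A‖ * ‖x₀ - xd‖ + ‖y - yd‖ with hR
  have hR0 : 0 ≤ R := by positivity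
  -- Chosen so that a√s₀ = c√L‖A‖: the n of the operator bound cancels against the n in s₀, leaving
  -- the quantity in the step size condition.
  set a := √(L * n * c) with ha
  have has : a * √s₀ = c * √L * ‖A‖ := by
    rw [ha, ← Real.sqrt_mul (by positivity), hs₀,
      show L * n * c * (c * (‖A‖ ^ 2 / n)) = L * (c * ‖A‖) ^ 2 by field_simp,
      Real.sqrt_mul hL0, Real.sqrt_sq (by positivity)]
    ring
  have ha1 : 200 * (a * √s₀ * M) ≤ 1 := by rwa [has]
  have hAL : ‖A‖ ≤ n * √L := by
    have h2 : ‖A‖ ^ 2 ≤ (n * √L) ^ 2 := by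
      rw [mul_pow, Real.sq_sqrt hL0]
      refine (norm_sq_le_mul_maxNormSq A).trans (mul_le_mul_of_nonneg_right ?_ hL0)
      nlinarith
    exact le_of_sq_le_sq h2 (by positivity)
  have hsM : s₀ * M ≤ 1 := by
    have h2 : s₀ ≤ c * √L * ‖A‖ := by
      rw [hs₀, mul_assoc]
      refine mul_le_mul_of_nonneg_left ?_ hc
      rw [div_le_iff₀ hn0]
      nlinarith [norm_nonneg A]
    have h3 : 0 ≤ c * √L * ‖A‖ * M := by positivity
    nlinarith
  set D : ℕ → ℝ := fun k => ⨆ i, ‖comp A i (drift A y x₀ c M s k)‖ with hD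
  have hDle : ∀ k i, ‖comp A i (drift A y x₀ c M s k)‖ ≤ D k := fun k i =>
    le_ciSup (f := fun i => ‖comp A i (drift A y x₀ c M s k)‖) (Set.finite_range _).bddAbove i
  refine (hDle k i).trans ?_
  refine le_mul_of_sum_le (D := D) (θ := 1 / 2)
    (F := fun k => M * R * (s₀ / (1 + (k / M * M : ℕ) * s₀)))
    (κ := fun k j => 2 * a * √(pathKernel s₀ M k j)) (W := fun k => 1 / (1 + k * s₀))
    (by positivity) (fun k j => by positivity) ?_ ?_ (sum_pathKernel_mul_le hM (Real.sqrt_nonneg _)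
      hs00 h1 ha1 hsM) k
  · intro k
    refine ciSup_le fun i => ?_
    rw [drift_eq hxd, map_add, map_sum]
    refine (norm_add_le _ _).trans (add_le_add ?_ (norm_sum_le_of_le _ fun j _ => ?_))
    · exact (norm_comp_apply_le A i _).trans
        (norm_apply_landweberError_sub_le hM hc hs₀ h1 (y - yd) (x₀ - xd) k)
    · have hq : ∀ t ∈ Set.Icc 0 (‖A‖ ^ 2 / n),
          t * (driftPoly c M k j).eval t ^ 2 ≤ c * pathKernel s₀ M k j := fun t ht =>
        driftPoly_le_pathKernel hM hc (mul_nonneg hc ht.1)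
          (hs₀ ▸ mul_le_mul_of_nonneg_left ht.2 hc) h1 k j
      calc _ ≤ √L * (2 * √(n * (c * pathKernel s₀ M k j)) * D j) :=
            (norm_comp_apply_le_sqrt A i _).trans (mul_le_mul_of_nonneg_left
              (norm_polyAt_innov_le hn A hq (hDle j) (s j)) (Real.sqrt_nonneg _))
        _ = 2 * (√L * √(n * (c * pathKernel s₀ M k j))) * D j := by ring
        _ = _ := by
            rw [ha, mul_assoc 2 (√(L * n * c)), ← Real.sqrt_mul hL0, ← Real.sqrt_mul (by positivity)]
            ring_nf
  · intro k
    set z := k / M * M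
    have hk : (k : ℝ) ≤ z + M := by
      have : k ≤ z + M := by have := sub_div_mul_lt hM k; omega
      exact_mod_cast this
    have hzw : 1 / (1 + z * s₀) ≤ 2 * (1 / (1 + k * s₀)) := by
      rw [← mul_div_assoc, mul_one, div_le_div_iff₀ (by positivity) (by positivity)]
      nlinarith [mul_le_mul_of_nonneg_right hk hs00, mul_nonneg (z.cast_nonneg : (0 : ℝ) ≤ z) hs00]
    calc M * R * (s₀ / (1 + z * s₀)) = M * R * s₀ * (1 / (1 + z * s₀)) := by ring
      _ ≤ M * R * s₀ * (2 * (1 / (1 + k * s₀))) := by gcongr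
      _ = _ := by ring

/-- Convolution of the propagator bound √(nc/(1 + r)) with the O(1/(1 + j)) drift; the logarithm
comes from the harmonic sum. -/
theorem norm_error_sub_landweberError_le {A : X →L[𝕜] PiLp 2 Y} {yd : PiLp 2 Y} {xd : X} {c : ℝ}
    {M : ℕ} (hn : 1 ≤ n) (hxd : A.adjoint (A xd) = A.adjoint yd) (hM : 1 ≤ M) (hc : 0 ≤ c)
    (hL : c * maxNormSq A ≤ 1) (hstep : 200 * (c * √(maxNormSq A) * ‖A‖ * M) ≤ 1)
    (y : PiLp 2 Y) (x₀ : X) (s : ℕ → Fin n) (k : ℕ) :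
    ‖iterate A y x₀ (fun _ => c) M s k - xd
      - landweberError (normalOp A) c (((n : 𝕜)⁻¹) • A.adjoint (y - yd)) (x₀ - xd) k‖
      ≤ √n * (8 * √c * M * (‖A‖ * ‖x₀ - xd‖ + ‖y - yd‖)) * ((5 + Real.log k) / √(1 + k)) := by
  set R := ‖A‖ * ‖x₀ - xd‖ + ‖y - yd‖ with hR
  have hR0 : 0 ≤ R := by positivity
  set s₀ := c * (‖A‖ ^ 2 / n) with hs₀
  have hs00 : 0 ≤ s₀ := by positivity
  have h1 : s₀ ≤ 1 := (step_mul_norm_sq_le hn hc).trans hL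
  rw [error_eq hxd, add_sub_cancel_left]
  calc _ ≤ ∑ j ∈ range k, √n * (8 * √c * M * R)
        * (1 / √(1 + (k - 1 - j : ℕ)) * (1 / (1 + j : ℝ))) := by
        refine norm_sum_le_of_le _ fun j _ => ?_
        set r := k - 1 - j
        have hd := fun i => norm_comp_drift_le hn hxd hM hc hL hstep hs₀ y x₀ s i j
        have hq : ∀ t ∈ Set.Icc 0 (‖A‖ ^ 2 / n),
            t * (Polynomial.C c * resid c ^ r).eval t ^ 2 ≤ c * (1 / (1 + r)) := fun t ht =>
          eval_C_mul_resid_pow_le hc ((mul_le_mul_of_nonneg_left ht.2 hc).trans h1) r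
        refine (norm_polyAt_innov_le hn A hq hd (s j)).trans ?_
        have e1 : √((n : ℝ) * (c * (1 / (1 + r)))) = √n * √c * (1 / √(1 + r)) := by
          rw [Real.sqrt_mul (by positivity), Real.sqrt_mul hc, Real.sqrt_div zero_le_one,
            Real.sqrt_one, mul_assoc]
        have e2 : s₀ * (1 / (1 + j * s₀)) ≤ 1 / (1 + j) := by
          rw [← mul_div_assoc, mul_one, div_le_div_iff₀ (by positivity) (by positivity)]
          nlinarith
        rw [e1]
        calc 2 * (√n * √c * (1 / √(1 + r))) * (4 * M * R * s₀ * (1 / (1 + j * s₀)))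
            = √n * (8 * √c * M * R) * (1 / √(1 + r) * (s₀ * (1 / (1 + j * s₀)))) := by ring
          _ ≤ _ := by gcongr
    _ ≤ _ := by
        rw [← mul_sum]
        exact mul_le_mul_of_nonneg_left (sum_inv_sqrt_mul_inv_le k) (by positivity)

end Iteration

/-! ### Independent uniform indices and martingale orthogonality -/

section Sampling

open Finset

variable {Ω : Type*} [MeasurableSpace Ω] {P : Measure Ω} {n : ℕ} {idx : ℕ → Ω → Fin n}

/-- A function of the first `k` indices factors through the restriction to `range k`. -/
theorem exists_eq_comp_restrict (hn : 1 ≤ n) {k : ℕ} {F : (ℕ → Fin n) → ℝ}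
    (hF : ∀ s s', (∀ j < k, s j = s' j) → F s = F s') :
    ∃ G : (range k → Fin n) → ℝ, ∀ s, F s = G fun j => s j := by
  refine ⟨fun p => F fun j => if h : j ∈ range k then p ⟨j, h⟩ else ⟨0, hn⟩, fun s => ?_⟩
  refine hF _ _ fun j hj => ?_
  rw [dif_pos (mem_range.mpr hj)]

/-- A function of finitely many indices takes finitely many values, so measurability and boundedness
are automatic. -/
theorem integrable_of_forall_lt_eq [IsProbabilityMeasure P] (hn : 1 ≤ n)
    (hidx : IsUniformSampling P idx) {k : ℕ} {F : (ℕ → Fin n) → ℝ}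
    (hF : ∀ s s', (∀ j < k, s j = s' j) → F s = F s') :
    Integrable (fun ω => F fun j => idx j ω) P := by
  obtain ⟨G, hG⟩ := exists_eq_comp_restrict hn hF
  simp only [hG]
  have hm : Measurable fun ω => (fun j : range k => idx j ω) :=
    measurable_pi_lambda _ fun j => hidx.1 j
  have hG' : Measurable G := measurable_of_finite G
  refine Integrable.of_bound (hG'.comp hm).aestronglyMeasurable (∑ p, ‖G p‖)
    (Eventually.of_forall fun ω => ?_)
  exact single_le_sum (f := fun p => ‖G p‖) (fun p _ => norm_nonneg _) (mem_univ _)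

/-- Averaging over the `k`-th index, which is independent of the previous ones. -/
theorem integral_sampling_eq [IsProbabilityMeasure P] (hn : 1 ≤ n)
    (hidx : IsUniformSampling P idx) {k : ℕ} {h : (ℕ → Fin n) → Fin n → ℝ}
    (hh : ∀ s s', (∀ j < k, s j = s' j) → h s = h s') :
    ∫ ω, h (fun j => idx j ω) (idx k ω) ∂P = ∫ ω, (n : ℝ)⁻¹ * ∑ i, h (fun j => idx j ω) i ∂P := by
  have hint : ∀ i, Integrable (fun ω => h (fun j => idx j ω) i) P := fun i =>
    integrable_of_forall_lt_eq hn hidx (F := fun s => h s i) fun s s' hs => by rw [hh s s' hs]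
  have hmeas : ∀ i, MeasurableSet (idx k ⁻¹' {i}) := fun i => hidx.1 k (measurableSet_singleton i)
  have hindic : ∀ (f : Ω → ℝ) i ω,
      (idx k ⁻¹' {i}).indicator f ω = if idx k ω = i then f ω else 0 := by
    intro f i ω
    split_ifs with hi
    · exact Set.indicator_of_mem (show ω ∈ idx k ⁻¹' {i} from hi) f
    · exact Set.indicator_of_notMem (show ω ∉ idx k ⁻¹' {i} from hi) f
  have hterm : ∀ i, ∫ ω, (idx k ⁻¹' {i}).indicator (fun ω => h (fun j => idx j ω) i) ω ∂P
      = (n : ℝ)⁻¹ * ∫ ω, h (fun j => idx j ω) i ∂P := by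
    intro i
    obtain ⟨G, hG⟩ := exists_eq_comp_restrict hn (F := fun s => h s i)
      fun s s' hs => by rw [hh s s' hs]
    have hG' : Measurable G := measurable_of_finite G
    have hm : Measurable fun ω => (fun j : range k => idx j ω) :=
      measurable_pi_lambda _ fun j => hidx.1 j
    have hind : IndepFun (fun ω => (fun j : range k => idx j ω)) (idx k) P := by
      have h1 := hidx.2.1.indepFun_finset (range k) {k} (by simp) hidx.1
      exact h1.comp (φ := id) (ψ := fun p : ({k} : Finset ℕ) → Fin n => p ⟨k, mem_singleton_self k⟩)
        measurable_id (measurable_pi_apply _)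
    have h2 : ∫ ω, G (fun j => idx j ω) * (if idx k ω = i then (1 : ℝ) else 0) ∂P
        = (∫ ω, G (fun j => idx j ω) ∂P) * ∫ ω, (if idx k ω = i then (1 : ℝ) else 0) ∂P :=
      hind.integral_fun_comp_mul_comp (f := G)
      (g := fun i' => if i' = i then (1 : ℝ) else 0) hm.aemeasurable (hidx.1 k).aemeasurable
      hG'.aestronglyMeasurable (measurable_of_finite _).aestronglyMeasurable
    have h3 : ∫ ω, (if idx k ω = i then (1 : ℝ) else 0) ∂P = (n : ℝ)⁻¹ := by
      have : (fun ω => if idx k ω = i then (1 : ℝ) else 0) = (idx k ⁻¹' {i}).indicator 1 := by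
        ext ω
        rw [hindic, Pi.one_apply]
      rw [this, integral_indicator_one (hmeas i), measureReal_def, hidx.2.2]
      simp
    rw [h3] at h2
    simp only [hG]
    rw [mul_comm, ← h2]
    refine integral_congr_ae (Eventually.of_forall fun ω => ?_)
    simp only [hindic, mul_ite, mul_one, mul_zero]
  -- Split over the events i_k = i, each of probability 1/n and independent of the indices before k.
  calc ∫ ω, h (fun j => idx j ω) (idx k ω) ∂P
      = ∫ ω, ∑ i, (idx k ⁻¹' {i}).indicator (fun ω => h (fun j => idx j ω) i) ω ∂P := by
        refine integral_congr_ae (Eventually.of_forall fun ω => ?_)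
        simp only [hindic]
        simp
    _ = ∑ i, (n : ℝ)⁻¹ * ∫ ω, h (fun j => idx j ω) i ∂P := by
        rw [integral_finsetSum _ fun i _ => (hint i).indicator (hmeas i)]
        exact sum_congr rfl fun i _ => hterm i
    _ = _ := by
        rw [integral_const_mul, integral_finsetSum _ fun i _ => hint i, mul_sum]

/-- Orthogonality of martingale differences. -/
theorem integral_norm_sq_add_sum [IsProbabilityMeasure P] (𝕜 : Type*) [RCLike 𝕜]
    {E : Type*} [NormedAddCommGroup E] [InnerProductSpace 𝕜 E] (hn : 1 ≤ n)
    (hidx : IsUniformSampling P idx) (a : E) {V : ℕ → (ℕ → Fin n) → Fin n → E}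
    (hV : ∀ j s s', (∀ i < j, s i = s' i) → V j s = V j s') (hsum : ∀ j s, ∑ i, V j s i = 0)
    (k : ℕ) :
    ∫ ω, ‖a + ∑ j ∈ range k, V j (fun l => idx l ω) (idx j ω)‖ ^ 2 ∂P
      = ‖a‖ ^ 2 + ∑ j ∈ range k, ∫ ω, (n : ℝ)⁻¹ * ∑ i, ‖V j (fun l => idx l ω) i‖ ^ 2 ∂P := by
  have hn0 : (n : ℝ) ≠ 0 := by exact_mod_cast (by omega : n ≠ 0)
  induction k with
  | zero => simp
  | succ k ih =>
    set S : (ℕ → Fin n) → E := fun s => a + ∑ j ∈ range k, V j s (s j) with hS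
    have hSdep : ∀ s s', (∀ j < k, s j = s' j) → S s = S s' := by
      intro s s' hs
      simp only [hS]
      congr 1
      refine sum_congr rfl fun j hj => ?_
      have hjk := mem_range.mp hj
      rw [hV j s s' fun i hi => hs i (hi.trans hjk), hs j hjk]
    have h1 := integral_sampling_eq hn hidx (k := k) (h := fun s i => ‖S s + V k s i‖ ^ 2)
      fun s s' hs => by rw [hSdep s s' hs, hV k s s' hs]
    have h2 : ∀ s, (n : ℝ)⁻¹ * ∑ i, ‖S s + V k s i‖ ^ 2
        = ‖S s‖ ^ 2 + (n : ℝ)⁻¹ * ∑ i, ‖V k s i‖ ^ 2 := by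
      intro s
      -- The cross term vanishes because the k-th increment averages to zero given the past.
      have h3 : ∑ i, RCLike.re ⟪S s, V k s i⟫_𝕜 = 0 := by
        rw [← map_sum, ← inner_sum, hsum]; simp
      simp only [@norm_add_sq 𝕜, sum_add_distrib, ← mul_sum, h3, sum_const, card_univ,
        Fintype.card_fin, nsmul_eq_mul]
      field_simp
      ring
    have h4 : ∀ ω, a + ∑ j ∈ range (k + 1), V j (fun l => idx l ω) (idx j ω)
        = S (fun l => idx l ω) + V k (fun l => idx l ω) (idx k ω) := by
      intro ω
      rw [sum_range_succ, ← add_assoc]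
    simp only [h4]
    rw [h1]
    simp only [h2]
    rw [integral_add, ih, sum_range_succ, add_assoc]
    · exact integrable_of_forall_lt_eq hn hidx (F := fun s => ‖S s‖ ^ 2)
        fun s s' hs => by rw [hSdep s s' hs]
    · exact integrable_of_forall_lt_eq hn hidx (F := fun s => (n : ℝ)⁻¹ * ∑ i, ‖V k s i‖ ^ 2)
        fun s s' hs => by rw [hV k s s' hs]

end Sampling

/-! ### Mean square bounds for drift and error -/

section MeanSquare

open Finset

variable {Ω : Type*} [MeasurableSpace Ω] {P : Measure Ω} [IsProbabilityMeasure P]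
variable {𝕜 : Type*} [RCLike 𝕜]
variable {X : Type*} [NormedAddCommGroup X] [InnerProductSpace 𝕜 X] [CompleteSpace X]
variable {n : ℕ} {Y : Fin n → Type*} [∀ i, NormedAddCommGroup (Y i)]
  [∀ i, InnerProductSpace 𝕜 (Y i)] [∀ i, CompleteSpace (Y i)] {idx : ℕ → Ω → Fin n}

/-- Orthogonality and the variance bound combined: the 1/n of the average absorbs the n allowed in
`hF`, so no n is left. Used with F_j = A q_j(B) for the drift and F_j = q_j(B) for the error. -/
theorem integral_norm_sq_add_sum_innov_le (hn : 1 ≤ n) (hidx : IsUniformSampling P idx)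
    {E : Type*} [NormedAddCommGroup E] [InnerProductSpace 𝕜 E] (A : X →L[𝕜] PiLp 2 Y) (a : E)
    (F : ℕ → X →L[𝕜] E) {κ : ℕ → ℝ} (y : PiLp 2 Y) (x₀ : X) (c : ℝ) (M k : ℕ)
    (hF : ∀ j i (y : Y i), ‖F j ((comp A i).adjoint y)‖ ^ 2 ≤ n * κ j * ‖y‖ ^ 2) :
    ∫ ω, ‖a + ∑ j ∈ range k, F j (innov A (idx j ω)
        (drift A y x₀ c M (fun l => idx l ω) j))‖ ^ 2 ∂P
      ≤ ‖a‖ ^ 2 + ∑ j ∈ range k, κ j *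
        ∫ ω, ‖A (drift A y x₀ c M (fun l => idx l ω) j)‖ ^ 2 ∂P := by
  have hn0 : (0 : ℝ) < n := by exact_mod_cast hn
  rw [integral_norm_sq_add_sum 𝕜 hn hidx a (V := fun j s i => F j (innov A i (drift A y x₀ c M s j)))
    (fun j s s' hs => by rw [drift_congr A y x₀ c M hs])
    (fun j s => by rw [← map_sum, sum_innov hn, map_zero]) k]
  refine add_le_add le_rfl (sum_le_sum fun j _ => ?_)
  rw [← integral_const_mul]
  refine integral_mono ?_ ?_ fun ω => ?_
  · exact integrable_of_forall_lt_eq hn hidx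
      (F := fun s => (n : ℝ)⁻¹ * ∑ i, ‖F j (innov A i (drift A y x₀ c M s j))‖ ^ 2)
      fun s s' hs => by rw [drift_congr A y x₀ c M hs]
  · exact integrable_of_forall_lt_eq hn hidx
      (F := fun s => κ j * ‖A (drift A y x₀ c M s j)‖ ^ 2)
      fun s s' hs => by rw [drift_congr A y x₀ c M hs]
  · have h := sum_norm_sq_innov_le hn A (F j) (hF j) (drift A y x₀ c M (fun l => idx l ω) j)
    rw [mul_assoc] at h
    exact (inv_mul_le_iff₀ hn0).mpr h

/-- The bound for the mean square drift, with explicit weights. -/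
theorem integral_norm_sq_apply_drift_le {A : X →L[𝕜] PiLp 2 Y} {yd : PiLp 2 Y} {xd : X}
    {c s₀ : ℝ} {M : ℕ} (hn : 1 ≤ n) (hidx : IsUniformSampling P idx)
    (hxd : A.adjoint (A xd) = A.adjoint yd) (hM : 1 ≤ M) (hc : 0 ≤ c)
    (hL : c * maxNormSq A ≤ 1) (hs₀ : s₀ = c * (‖A‖ ^ 2 / n))
    (hsum : ∑ r ∈ range M, c * maxNormSq A * min s₀ (1 / (1 + 4 * (r : ℝ))) ≤ 1 / 4)
    (y : PiLp 2 Y) (x₀ : X) (k : ℕ) :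
    ∫ ω, ‖A (drift A y x₀ c M (fun l => idx l ω) k)‖ ^ 2 ∂P
      ≤ 20 * ((M : ℝ) ^ 2 * (‖A‖ * ‖x₀ - xd‖ + ‖y - yd‖) * weightWidth M ^ 2) ^ 2
        * (1 / ((k + weightWidth M ^ 2) * √(k + weightWidth M ^ 2))) := by
  have hn0 : (0 : ℝ) < n := by exact_mod_cast hn
  have hM1 : (1 : ℝ) ≤ M := by exact_mod_cast hM
  set L := maxNormSq A with hLdef
  have hL0 : 0 ≤ L := maxNormSq_nonneg A
  have hs00 : 0 ≤ s₀ := by rw [hs₀]; positivity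
  have h1 : s₀ ≤ 1 := hs₀ ▸ (step_mul_norm_sq_le hn hc).trans hL
  set R := ‖A‖ * ‖x₀ - xd‖ + ‖y - yd‖ with hR
  have hR0 : 0 ≤ R := by positivity
  set h := weightWidth M with hh
  have hh1 : 1 ≤ h := one_le_weightWidth hM
  -- The factor 20 in the bound is 1/(1 - θ).
  refine le_mul_of_sum_le (θ := 0.95)
    (D := fun k => ∫ ω, ‖A (drift A y x₀ c M (fun l => idx l ω) k)‖ ^ 2 ∂P)
    (F := fun k => (M * R * (s₀ / (1 + (k / M * M : ℕ) * s₀))) ^ 2)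
    (κ := fun k j => c * L * meanKernel s₀ M k j)
    (W := fun k : ℕ => 1 / ((k + h ^ 2) * √(k + h ^ 2))) (by positivity)
    (fun k j => mul_nonneg (by positivity) (meanKernel_nonneg hs00 M k j)) ?_ ?_
    (sum_meanKernel_mul_le hM (by positivity) hL hs00 hh hsum) k
  · intro k
    simp only [drift_eq hxd y x₀ c M _ k, map_add, map_sum]
    refine (integral_norm_sq_add_sum_innov_le hn hidx A _
      (fun j => A.comp (polyAt (normalOp A) (driftPoly c M k j))) y x₀ c M k
      (κ := fun j => c * L * meanKernel s₀ M k j) fun j i v => ?_).trans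
      (add_le_add (pow_le_pow_left₀ (norm_nonneg _)
        (norm_apply_landweberError_sub_le hM hc hs₀ h1 (y - yd) (x₀ - xd) k) 2) le_rfl)
    have hq : ∀ t ∈ Set.Icc 0 (‖A‖ ^ 2 / n),
        t * (driftPoly c M k j).eval t ^ 2 ≤ c * meanKernel s₀ M k j := fun t ht =>
      driftPoly_le_meanKernel hM hc (mul_nonneg hc ht.1)
        (hs₀ ▸ mul_le_mul_of_nonneg_left ht.2 hc) h1 k j
    have h2 : ‖A (polyAt (normalOp A) (driftPoly c M k j) ((comp A i).adjoint v))‖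
        ≤ √(n * (c * meanKernel s₀ M k j)) * (√L * ‖v‖) :=
      (norm_apply_polyAt_le hn A _ hq _).trans
        (mul_le_mul_of_nonneg_left (norm_adjoint_comp_apply_le_sqrt A i v) (Real.sqrt_nonneg _))
    have hk0 := meanKernel_nonneg hs00 M k j
    calc _ ≤ (√(n * (c * meanKernel s₀ M k j)) * (√L * ‖v‖)) ^ 2 :=
          pow_le_pow_left₀ (norm_nonneg _) h2 2
      _ = _ := by
          rw [mul_pow, mul_pow, Real.sq_sqrt (by positivity), Real.sq_sqrt hL0]
          ring
  · intro k
    set z := k / M * M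
    have hk : (k : ℝ) + 1 ≤ M * (1 + z) := by
      have h2 : (k : ℝ) + 1 ≤ z + M := by
        have : k + 1 ≤ z + M := by have := sub_div_mul_lt hM k; omega
        exact_mod_cast this
      nlinarith [mul_nonneg (by linarith : (0 : ℝ) ≤ M - 1) (z.cast_nonneg : (0 : ℝ) ≤ z)]
    -- Uses s₀ ≤ 1 and k + 1 ≤ M(1 + z). The squared deterministic drift is thus O(k⁻²), which the
    -- weight k^(-3/2) dominates.
    have h3 : s₀ / (1 + z * s₀) ≤ M / (k + 1) := by
      rw [div_le_div_iff₀ (by positivity) (by positivity)]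
      have hz0 : (0 : ℝ) ≤ z := z.cast_nonneg
      have : s₀ * (1 + z) ≤ 1 + z * s₀ := by nlinarith
      nlinarith
    have hkh : (1 : ℝ) ≤ k + h ^ 2 := by nlinarith [(k.cast_nonneg : (0 : ℝ) ≤ k)]
    have h4 : ((k : ℝ) + h ^ 2) * √(k + h ^ 2) ≤ (h ^ 2 * (k + 1)) ^ 2 := by
      have h5 : √((k : ℝ) + h ^ 2) ≤ k + h ^ 2 := by
        rw [Real.sqrt_le_left (by linarith)]
        nlinarith
      have h6 : (k : ℝ) + h ^ 2 ≤ h ^ 2 * (k + 1) := by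
        nlinarith [mul_nonneg (by nlinarith : (0 : ℝ) ≤ h ^ 2 - 1) (k.cast_nonneg : (0 : ℝ) ≤ k)]
      calc ((k : ℝ) + h ^ 2) * √(k + h ^ 2) ≤ (k + h ^ 2) * (k + h ^ 2) := by gcongr
        _ ≤ (h ^ 2 * (k + 1)) * (h ^ 2 * (k + 1)) := by gcongr
        _ = _ := by ring
    calc (M * R * (s₀ / (1 + z * s₀))) ^ 2 ≤ (M * R * (M / (k + 1))) ^ 2 := by gcongr
      _ = (M ^ 2 * R * h ^ 2) ^ 2 * (1 / (h ^ 2 * (k + 1)) ^ 2) := by field_simp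
      _ ≤ (M ^ 2 * R * h ^ 2) ^ 2 * (1 / ((k + h ^ 2) * √(k + h ^ 2))) := by gcongr
      _ = _ := by ring

/-- The constant in the mean square bound for the stochastic part of the error. -/
def meanConst (c : ℝ) (M : ℕ) : ℝ := 140 * c * ((M : ℝ) ^ 2 * weightWidth M ^ 2) ^ 2

theorem integrable_norm_sq_error (hn : 1 ≤ n) (hidx : IsUniformSampling P idx)
    (A : X →L[𝕜] PiLp 2 Y) (y : PiLp 2 Y) (x₀ xd : X) (c : ℝ) (M k : ℕ) :
    Integrable (fun ω => ‖iterate A y x₀ (fun _ => c) M (fun j => idx j ω) k - xd‖ ^ 2) P :=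
  integrable_of_forall_lt_eq hn hidx
    (F := fun s => ‖iterate A y x₀ (fun _ => c) M s k - xd‖ ^ 2)
    fun s s' hs => by rw [iterate_congr A y x₀ _ M hs]

/-- Since (1 + j)^(-3/2) is summable, its convolution with 1/(k - j) is O(1/(1 + k)) without a
logarithm. -/
theorem integral_norm_sq_error_le {A : X →L[𝕜] PiLp 2 Y} {yd : PiLp 2 Y} {xd : X}
    {c : ℝ} {M : ℕ} (hn : 1 ≤ n) (hidx : IsUniformSampling P idx)
    (hxd : A.adjoint (A xd) = A.adjoint yd) (hM : 1 ≤ M) (hc : 0 ≤ c)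
    (hL : c * maxNormSq A ≤ 1)
    (hsum : ∑ r ∈ range M, c * maxNormSq A * min (c * (‖A‖ ^ 2 / n)) (1 / (1 + 4 * (r : ℝ)))
      ≤ 1 / 4)
    (y : PiLp 2 Y) (x₀ : X) (k : ℕ) :
    ∫ ω, ‖iterate A y x₀ (fun _ => c) M (fun j => idx j ω) k - xd‖ ^ 2 ∂P
      ≤ ‖landweberError (normalOp A) c (((n : 𝕜)⁻¹) • A.adjoint (y - yd)) (x₀ - xd) k‖ ^ 2
        + meanConst c M * (‖A‖ * ‖x₀ - xd‖ + ‖y - yd‖) ^ 2 / (1 + k) := by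
  set R := ‖A‖ * ‖x₀ - xd‖ + ‖y - yd‖ with hR
  have hR0 : 0 ≤ R := by positivity
  set h := weightWidth M with hh
  have hh1 : 1 ≤ h := one_le_weightWidth hM
  have h1 : c * (‖A‖ ^ 2 / n) ≤ 1 := (step_mul_norm_sq_le hn hc).trans hL
  set Λ := 20 * ((M : ℝ) ^ 2 * R * h ^ 2) ^ 2 with hΛ
  simp only [error_eq hxd y x₀ c M]
  refine (integral_norm_sq_add_sum_innov_le hn hidx A _
      (fun j => polyAt (normalOp A) (Polynomial.C c * resid c ^ (k - 1 - j))) y x₀ c M k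
      (κ := fun j => c * (1 / (1 + (k - 1 - j : ℕ)))) fun j i v => ?_).trans
      (add_le_add le_rfl ?_)
  · have hq : ∀ t ∈ Set.Icc 0 (‖A‖ ^ 2 / n),
        t * (Polynomial.C c * resid c ^ (k - 1 - j)).eval t ^ 2 ≤ c * (1 / (1 + (k - 1 - j : ℕ))) :=
      fun t ht => eval_C_mul_resid_pow_le hc ((mul_le_mul_of_nonneg_left ht.2 hc).trans h1) _
    calc _ ≤ (√(n * (c * (1 / (1 + (k - 1 - j : ℕ))))) * ‖v‖) ^ 2 :=
          pow_le_pow_left₀ (norm_nonneg _) (norm_polyAt_adjoint_comp_le hn A _ hq i v) 2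
      _ = _ := by
          rw [mul_pow, Real.sq_sqrt (by positivity)]
  · calc _ ≤ ∑ j ∈ range k, c * Λ * (1 / (1 + (k - 1 - j : ℕ) : ℝ) * (1 / ((1 + j) * √(1 + j)))) := by
          refine sum_le_sum fun j _ => ?_
          have h2 := integral_norm_sq_apply_drift_le hn hidx hxd hM hc hL rfl hsum y x₀ j
          have h3 : 1 / (((j : ℝ) + h ^ 2) * √(j + h ^ 2)) ≤ 1 / ((1 + j) * √(1 + j)) := by
            have : (1 : ℝ) + j ≤ j + h ^ 2 := by nlinarith
            gcongr
          calc _ ≤ c * (1 / (1 + (k - 1 - j : ℕ))) * (Λ * (1 / ((1 + j) * √(1 + j)))) := by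
                refine mul_le_mul_of_nonneg_left (h2.trans ?_) (by positivity)
                exact mul_le_mul_of_nonneg_left h3 (by positivity)
            _ = _ := by ring
      _ ≤ c * Λ * (7 / (1 + k)) := by
          rw [← mul_sum]
          exact mul_le_mul_of_nonneg_left (sum_inv_mul_inv_mul_sqrt_le k) (by positivity)
      _ = _ := by rw [hΛ, meanConst]; ring

end MeanSquare

/-- A geometric sum: the Landweber filter approximates 1/t with relative residual (1 - ct)^k. -/
theorem eval_sum_resid (c t : ℝ) (k : ℕ) :
    t * (∑ j ∈ Finset.range k, Polynomial.C c * resid c ^ j).eval t = 1 - (1 - c * t) ^ k := by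
  induction k with
  | zero => simp
  | succ k ih =>
    rw [Finset.sum_range_succ, Polynomial.eval_add, mul_add, ih]
    simp only [Polynomial.eval_mul, Polynomial.eval_C, Polynomial.eval_pow, eval_resid]
    ring

/-! ### Truncated SVD, source condition and propagated data error -/

section SpectralCutoff

variable {𝕜 : Type*} [RCLike 𝕜]
variable {X : Type*} [NormedAddCommGroup X] [InnerProductSpace 𝕜 X]
variable {n : ℕ} {Y : Fin n → Type*} [∀ i, NormedAddCommGroup (Y i)]
  [∀ i, InnerProductSpace 𝕜 (Y i)]

theorem norm_sq_sum_smul_eq {ι E : Type*} [NormedAddCommGroup E] [InnerProductSpace 𝕜 E]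
    {v : ι → E} (hv : Orthonormal 𝕜 v) (s : Finset ι) (a : ι → 𝕜) :
    ‖∑ i ∈ s, a i • v i‖ ^ 2 = ∑ i ∈ s, ‖a i‖ ^ 2 := by
  have h : ((‖∑ i ∈ s, a i • v i‖ ^ 2 : ℝ) : 𝕜) = ((∑ i ∈ s, ‖a i‖ ^ 2 : ℝ) : 𝕜) := by
    push_cast
    rw [← inner_self_eq_norm_sq_to_K, hv.inner_sum]
    exact Finset.sum_congr rfl fun i _ => RCLike.conj_mul _
  exact_mod_cast h

variable [CompleteSpace X] [∀ i, CompleteSpace (Y i)]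

/-- `A = T P` for an orthogonal projection `P` that commutes with `T* T`, with `T` small on the
kernel of `P` and bounded below on its range. -/
structure IsSpectralCutoff (T A : X →L[𝕜] PiLp 2 Y) (P : X →L[𝕜] X) (τ : ℝ) : Prop where
  apply_eq : ∀ x, A x = T (P x)
  comm : ∀ x, P (normalOp T x) = normalOp T (P x)
  symm : ∀ x y, ⟪P x, y⟫_𝕜 = ⟪x, P y⟫_𝕜
  idem : ∀ x, P (P x) = P x
  norm_sub_le : ∀ x, ‖T x - A x‖ ≤ τ * ‖x‖
  le_norm : ∀ x, τ * ‖P x‖ ≤ ‖A x‖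

theorem isSpectralCutoff_one (T : X →L[𝕜] PiLp 2 Y) : IsSpectralCutoff T T 1 0 where
  apply_eq _ := rfl
  comm _ := rfl
  symm _ _ := rfl
  idem _ := rfl
  norm_sub_le x := by simp
  le_norm x := by simp

/-- P projects onto the span of the kept φ_j. Bessel bounds the discarded tail, and orthonormality
bounds A from below on the range of P. -/
theorem IsTruncatedSVD.exists_isSpectralCutoff {T A : X →L[𝕜] PiLp 2 Y} {τ : ℝ}
    (h : IsTruncatedSVD T A τ) : ∃ P, IsSpectralCutoff T A P τ := by
  obtain ⟨hτ, -, σ, φ, ψ, J, hs, hJ, hJ', hA⟩ := h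
  -- Orthonormality is available only where σ_j ≠ 0, so sums are moved to this subtype before it is
  -- used.
  set p : ℕ → Prop := fun j => σ j ≠ 0 with hp
  classical
  have hne : ∀ j ∈ Finset.range J, σ j ≠ 0 := fun j hj =>
    (hτ.trans_le (hJ j (Finset.mem_range.mp hj))).ne'
  have hφ : ∀ i j, σ i ≠ 0 → σ j ≠ 0 → ⟪φ i, φ j⟫_𝕜 = if i = j then 1 else 0 := by
    intro i j hi hj
    have := orthonormal_iff_ite.mp hs.orthonormal_left ⟨i, hi⟩ ⟨j, hj⟩
    simpa using this
  have hψ : ∀ i j, σ i ≠ 0 → σ j ≠ 0 → ⟪ψ i, ψ j⟫_𝕜 = if i = j then 1 else 0 := by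
    intro i j hi hj
    have := orthonormal_iff_ite.mp hs.orthonormal_right ⟨i, hi⟩ ⟨j, hj⟩
    simpa using this
  have hTφ : ∀ j, σ j ≠ 0 → T (φ j) = (σ j : 𝕜) • ψ j := by
    intro j hj
    have hfun : (fun i => ((σ i : 𝕜) * ⟪φ i, φ j⟫_𝕜) • ψ i)
        = fun i => if i = j then (σ j : 𝕜) • ψ j else 0 := by
      funext i
      rcases eq_or_ne (σ i) 0 with hi | hi
      · have : i ≠ j := by rintro rfl; exact hj hi
        simp [hi, this]
      · rw [hφ i j hi hj]
        split_ifs with hij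
        · subst hij; simp
        · simp
    have h := hs.hasSum (φ j)
    rw [hfun] at h
    exact h.unique (hasSum_ite_eq j ((σ j : 𝕜) • ψ j))
  have hψT : ∀ j, σ j ≠ 0 → ∀ x, ⟪ψ j, T x⟫_𝕜 = (σ j : 𝕜) * ⟪φ j, x⟫_𝕜 := by
    intro j hj x
    refine ((hs.hasSum x).mapL (innerSL 𝕜 (ψ j))).unique ?_
    convert hasSum_ite_eq j ((σ j : 𝕜) * ⟪φ j, x⟫_𝕜) using 1
    ext i
    rw [innerSL_apply_apply, inner_smul_right]
    rcases eq_or_ne (σ i) 0 with hi | hi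
    · have : i ≠ j := by rintro rfl; exact hj hi
      simp [hi, this]
    · rw [hψ j i hj hi]
      by_cases hij : i = j
      · subst hij; simp
      · simp [hij, Ne.symm hij]
  have hTT : ∀ j, σ j ≠ 0 → T.adjoint (T (φ j)) = ((σ j : 𝕜) * (σ j : 𝕜)) • φ j := by
    intro j hj
    refine ext_inner_right 𝕜 fun x => ?_
    rw [ContinuousLinearMap.adjoint_inner_left, hTφ j hj, inner_smul_left, hψT j hj,
      inner_smul_left]
    simp only [map_mul, RCLike.conj_ofReal]
    ring
  set P : X →L[𝕜] X := ∑ j ∈ Finset.range J, (innerSL 𝕜 (φ j)).smulRight (φ j) with hP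
  have hPx : ∀ x, P x = ∑ j ∈ Finset.range J, ⟪φ j, x⟫_𝕜 • φ j := by
    intro x
    simp [hP]
  have hPφ : ∀ i ∈ Finset.range J, P (φ i) = φ i := by
    intro i hi
    rw [hPx, Finset.sum_eq_single_of_mem i hi]
    · rw [hφ i i (hne i hi) (hne i hi)]; simp
    · intro j hj hji
      rw [hφ j i (hne j hj) (hne i hi), if_neg hji, zero_smul]
  have hsub : ∀ (s : Finset ℕ) (x : X), ∑ j ∈ s, ((σ j : 𝕜) * ⟪φ j, x⟫_𝕜) • ψ j
      = ∑ j ∈ s.subtype p, ((σ j : 𝕜) * ⟪φ j, x⟫_𝕜) • ψ j := by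
    intro s x
    rw [Finset.sum_subtype_eq_sum_filter (f := fun j => ((σ j : 𝕜) * ⟪φ j, x⟫_𝕜) • ψ j),
      Finset.sum_filter_of_ne]
    intro j _ hj hσ
    exact hj (by simp [hσ])
  refine ⟨P, ?_, ?_, ?_, ?_, ?_, ?_⟩
  · intro x
    rw [hA, hPx, map_sum]
    refine Finset.sum_congr rfl fun j hj => ?_
    rw [map_smul, hTφ j (hne j hj), smul_smul, mul_comm]
  · intro x
    rw [hPx, hPx, map_sum]
    refine Finset.sum_congr rfl fun j hj => ?_
    rw [map_smul, normalOp_apply, normalOp_apply, inner_smul_right, hTT j (hne j hj),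
      ContinuousLinearMap.adjoint_inner_right, hTφ j (hne j hj), inner_smul_left, hψT j (hne j hj),
      RCLike.conj_ofReal, smul_smul, smul_smul]
    congr 1
    ring
  · intro x y
    rw [hPx, hPx, sum_inner, inner_sum]
    refine Finset.sum_congr rfl fun j _ => ?_
    rw [inner_smul_left, inner_smul_right, inner_conj_symm, mul_comm]
  · intro x
    rw [hPx x, map_sum]
    refine Finset.sum_congr rfl fun j hj => ?_
    rw [map_smul, hPφ j hj]
  · intro x
    have hlim := ((hs.hasSum x).tendsto_sum_nat.sub_const (A x)).norm
    refine le_of_tendsto hlim ?_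
    filter_upwards [eventually_ge_atTop J] with N hN
    have hN' : ∑ j ∈ Finset.range N, ((σ j : 𝕜) * ⟪φ j, x⟫_𝕜) • ψ j - A x
        = ∑ j ∈ Finset.Ico J N, ((σ j : 𝕜) * ⟪φ j, x⟫_𝕜) • ψ j := by
      rw [hA, Finset.sum_Ico_eq_sub _ hN]
    rw [hN', hsub]
    refine le_of_sq_le_sq ?_ (by positivity)
    rw [norm_sq_sum_smul_eq hs.orthonormal_right _ fun j => (σ j : 𝕜) * ⟪φ j, x⟫_𝕜, mul_pow]
    calc ∑ j ∈ (Finset.Ico J N).subtype p, ‖(σ j : 𝕜) * ⟪φ j, x⟫_𝕜‖ ^ 2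
        ≤ ∑ j ∈ (Finset.Ico J N).subtype p, τ ^ 2 * ‖⟪φ j, x⟫_𝕜‖ ^ 2 := by
          refine Finset.sum_le_sum fun j hj => ?_
          have hj' := (Finset.mem_Ico.mp (Finset.mem_subtype.mp hj)).1
          rw [norm_mul, mul_pow, RCLike.norm_ofReal, abs_of_nonneg (hs.nonneg j)]
          have h1 := (hJ' j hj').le
          have h2 := hs.nonneg j
          gcongr
      _ ≤ τ ^ 2 * ‖x‖ ^ 2 := by
          rw [← Finset.mul_sum]
          exact mul_le_mul_of_nonneg_left (hs.orthonormal_left.sum_inner_products_le x)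
            (sq_nonneg τ)
  · intro x
    refine le_of_sq_le_sq ?_ (norm_nonneg _)
    have hmem : ∀ j ∈ (Finset.range J), p j := hne
    have h1 : P x = ∑ j ∈ (Finset.range J).subtype p, ⟪φ j, x⟫_𝕜 • φ j := by
      rw [hPx]
      exact (Finset.sum_subtype_of_mem (fun j => ⟪φ j, x⟫_𝕜 • φ j) hmem).symm
    rw [hA, hsub, norm_sq_sum_smul_eq hs.orthonormal_right _ fun j => (σ j : 𝕜) * ⟪φ j, x⟫_𝕜,
      mul_pow, h1, norm_sq_sum_smul_eq hs.orthonormal_left _ fun j => ⟪φ j, x⟫_𝕜, Finset.mul_sum]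
    refine Finset.sum_le_sum fun j hj => ?_
    have hj' := Finset.mem_range.mp (Finset.mem_subtype.mp hj)
    rw [norm_mul, mul_pow, RCLike.norm_ofReal, abs_of_nonneg (hs.nonneg j)]
    have h1 := hJ j hj'
    gcongr

namespace IsSpectralCutoff

variable {T A : X →L[𝕜] PiLp 2 Y} {P : X →L[𝕜] X} {τ : ℝ}

theorem norm_apply_le (h : IsSpectralCutoff T A P τ) (x : X) : ‖P x‖ ≤ ‖x‖ := by
  have h1 : ‖P x‖ ^ 2 = RCLike.re ⟪x, P x⟫_𝕜 := by
    rw [← h.idem x, ← h.symm, h.idem, inner_self_eq_norm_sq]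
  have h2 := re_inner_le_norm (𝕜 := 𝕜) x (P x)
  nlinarith [norm_nonneg (P x), norm_nonneg x]

theorem norm_le_one (h : IsSpectralCutoff T A P τ) : ‖P‖ ≤ 1 :=
  P.opNorm_le_bound zero_le_one fun x => by rw [one_mul]; exact h.norm_apply_le x

theorem norm_one_sub_le (h : IsSpectralCutoff T A P τ) : ‖1 - P‖ ≤ 1 := by
  refine (1 - P).opNorm_le_bound zero_le_one fun x => ?_
  rw [one_mul]
  have e : (1 - P) x = x - P x := rfl
  have h1 : RCLike.re ⟪x, P x⟫_𝕜 = ‖P x‖ ^ 2 := by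
    rw [← h.idem x, ← h.symm, h.idem, inner_self_eq_norm_sq]
  have h2 : ‖x - P x‖ ^ 2 = ‖x‖ ^ 2 - ‖P x‖ ^ 2 := by
    rw [@norm_sub_sq 𝕜, h1]; ring
  rw [e]
  refine le_of_sq_le_sq ?_ (norm_nonneg x)
  nlinarith [sq_nonneg ‖P x‖]

theorem adjoint_apply (h : IsSpectralCutoff T A P τ) (y : PiLp 2 Y) :
    A.adjoint y = P (T.adjoint y) := by
  refine ext_inner_right 𝕜 fun x => ?_
  rw [ContinuousLinearMap.adjoint_inner_left, h.apply_eq, h.symm,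
    ContinuousLinearMap.adjoint_inner_left]

theorem normalOp_apply_eq (h : IsSpectralCutoff T A P τ) (x : X) :
    normalOp A x = normalOp T (P x) := by
  rw [normalOp_apply, h.adjoint_apply, h.apply_eq, ← map_smul, ← normalOp_apply, h.comm, h.idem]

/-- As P commutes with T*T, both sides equal P T*T x: the exact solution still solves the truncated
normal equation. -/
theorem adjoint_apply_solution (h : IsSpectralCutoff T A P τ) (hn : 1 ≤ n) (x : X) :
    A.adjoint (A x) = A.adjoint (T x) := by
  have hn' : ((n : 𝕜)⁻¹) ≠ 0 := inv_ne_zero (by exact_mod_cast (by omega : n ≠ 0))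
  have h1 : normalOp A x = ((n : 𝕜)⁻¹) • A.adjoint (T x) := by
    rw [h.normalOp_apply_eq, h.adjoint_apply, ← map_smul, ← normalOp_apply, h.comm]
  rw [normalOp_apply] at h1
  exact smul_right_injective X hn' h1

theorem norm_le (h : IsSpectralCutoff T A P τ) : ‖A‖ ≤ ‖T‖ := by
  refine A.opNorm_le_bound (norm_nonneg _) fun x => ?_
  rw [h.apply_eq]
  exact (T.le_opNorm _).trans (mul_le_mul_of_nonneg_left (h.norm_apply_le x) (norm_nonneg _))

/-- The complementary part of a spectral cutoff. -/
theorem compl_normalOp (h : IsSpectralCutoff T A P τ) (x : X) :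
    (1 - P) (normalOp T x) = normalOp (T - A) ((1 - P) x) := by
  have h1 : ∀ x, (T - A) x = T ((1 - P) x) := by
    intro x
    have : (T - A) x = T x - A x := rfl
    have e : (1 - P) x = x - P x := rfl
    rw [this, e, map_sub, h.apply_eq]
  have h2 : ∀ y, (T - A).adjoint y = (1 - P) (T.adjoint y) := by
    intro y
    have e : (1 - P) (T.adjoint y) = T.adjoint y - P (T.adjoint y) := rfl
    rw [e, ← h.adjoint_apply, map_sub]
    rfl
  have e : ∀ x, (1 - P) x = x - P x := fun _ => rfl
  rw [normalOp_apply (T - A), h1, h2, ← map_smul, ← normalOp_apply]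
  simp only [e, map_sub, h.comm, h.idem, sub_self, sub_zero]

theorem norm_sub_le_norm (h : IsSpectralCutoff T A P τ) : ‖T - A‖ ≤ ‖T‖ := by
  refine (T - A).opNorm_le_bound (norm_nonneg _) fun x => ?_
  have h1 : (T - A) x = T ((1 - P) x) := by
    have : (T - A) x = T x - A x := rfl
    have e : (1 - P) x = x - P x := rfl
    rw [this, e, map_sub, h.apply_eq]
  rw [h1]
  refine (T.le_opNorm _).trans (mul_le_mul_of_nonneg_left ?_ (norm_nonneg _))
  simpa using (1 - P).le_of_opNorm_le h.norm_one_sub_le x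

theorem polyAt_resid_compl (h : IsSpectralCutoff T A P τ) (c : ℝ) (k : ℕ) (x : X) :
    polyAt (normalOp A) (resid c ^ k) (x - P x) = x - P x := by
  induction k with
  | zero => simp
  | succ k ih =>
    rw [pow_succ, polyAt_mul_apply, polyAt_resid_apply, h.normalOp_apply_eq, map_sub P, h.idem,
      sub_self, map_zero, smul_zero, sub_zero, ih]

variable {ν c : ℝ}

/-- The iteration filters the P-part of the source and leaves the rest untouched. That rest lives on
the normal operator of T - A, whose norm is at most τ²/n. -/
theorem norm_polyAt_resid_le (h : IsSpectralCutoff T A P τ) (hτ : 0 ≤ τ) (hν : 0 < ν) (hc : 0 < c)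
    (h1 : c * (‖A‖ ^ 2 / n) ≤ 1) (w : X) {k : ℕ} (hk : 1 ≤ k) :
    ‖polyAt (normalOp A) (resid c ^ k) (opPow (normalOp T) ν w)‖
      ≤ (ν / c) ^ ν * (k : ℝ) ^ (-ν) * ‖w‖ + (τ ^ 2 / n) ^ ν * ‖w‖ := by
  set u := opPow (normalOp T) ν w with hu
  have hu' : u = P u + (u - P u) := by abel
  rw [hu', map_add, h.polyAt_resid_compl]
  refine (norm_add_le _ _).trans (add_le_add ?_ ?_)
  · refine norm_polyAt_opPow_le (isPositive_normalOp T) (isPositive_normalOp A) ?_ (fun x => ?_)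
      h.norm_le_one hν _ (fun t ht => ?_) w
    · rw [norm_normalOp, norm_normalOp]
      have := h.norm_le
      gcongr
    · rw [h.comm, h.normalOp_apply_eq, h.idem]
    · rw [norm_normalOp] at ht
      rw [Polynomial.eval_pow, eval_resid]
      exact rpow_mul_one_sub_pow_le ht.1 hc hν ((mul_le_mul_of_nonneg_left ht.2 hc.le).trans h1) hk
  · have h2 := norm_polyAt_opPow_le (B := normalOp T) (C := normalOp (T - A)) (P := 1 - P)
      (K := (τ ^ 2 / n) ^ ν) (isPositive_normalOp T) (isPositive_normalOp (T - A)) ?_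
      h.compl_normalOp h.norm_one_sub_le hν 1 (fun t ht => ?_) w
    · simpa using h2
    · rw [norm_normalOp, norm_normalOp]
      have := h.norm_sub_le_norm
      gcongr
    · rw [norm_normalOp] at ht
      have h3 : ‖T - A‖ ≤ τ := (T - A).opNorm_le_bound hτ h.norm_sub_le
      have h4 : t ≤ τ ^ 2 / n := ht.2.trans (by gcongr)
      simp only [Polynomial.eval_one, abs_one, one_mul]
      exact Real.rpow_le_rpow ht.1 h4 hν.le

/-- The noise stays in the range of P, where ‖v‖ ≤ ‖Av‖/τ, and after applying A the filter is 1 - (1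
- ct)^k ≤ 1. -/
theorem norm_noise_le_div (h : IsSpectralCutoff T A P τ) (hτ : 0 < τ) (hc : 0 < c)
    (h1 : c * (‖A‖ ^ 2 / n) ≤ 1) (ξ : PiLp 2 Y) (k : ℕ) :
    ‖∑ j ∈ Finset.range k, polyAt (normalOp A) (Polynomial.C c * resid c ^ j)
      (((n : 𝕜)⁻¹) • A.adjoint ξ)‖ ≤ ‖ξ‖ / τ := by
  set q : Polynomial ℝ := ∑ j ∈ Finset.range k, Polynomial.C c * resid c ^ j with hq
  set b := ((n : 𝕜)⁻¹) • A.adjoint ξ with hb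
  have hsum : ∑ j ∈ Finset.range k, polyAt (normalOp A) (Polynomial.C c * resid c ^ j) b
      = polyAt (normalOp A) q b := by
    rw [hq, map_sum, sum_apply]
  have hPb : P b = b := by
    rw [hb, h.adjoint_apply, map_smul, h.idem]
  have hPv : P (polyAt (normalOp A) q b) = polyAt (normalOp A) q b := by
    rw [polyAt_intertwine (S := normalOp A) (fun x => ?_) q b, hPb]
    rw [h.normalOp_apply_eq, h.comm, h.normalOp_apply_eq]
  rw [hsum, le_div_iff₀' hτ]
  calc τ * ‖polyAt (normalOp A) q b‖ = τ * ‖P (polyAt (normalOp A) q b)‖ := by rw [hPv]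
    _ ≤ ‖A (polyAt (normalOp A) q b)‖ := h.le_norm _
    _ ≤ 1 * ‖ξ‖ := by
        refine norm_apply_polyAt_adjoint_le A q (fun t ht => ?_) ξ
        have hct : c * t ≤ 1 := (mul_le_mul_of_nonneg_left ht.2 hc.le).trans h1
        have hct0 : 0 ≤ c * t := mul_nonneg hc.le ht.1
        rw [eval_sum_resid]
        have h2 : 0 ≤ (1 - c * t) ^ k := pow_nonneg (by linarith) k
        have h3 : (1 - c * t) ^ k ≤ 1 := pow_le_one₀ (by linarith) (by linarith)
        rw [abs_le]
        constructor <;> linarith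
    _ = ‖ξ‖ := one_mul _

end IsSpectralCutoff

/-- Interpolates t q ≤ 1 and q ≤ ck to t q² ≤ ck; no lower bound on the spectrum is needed. -/
theorem norm_noise_le_sqrt (hn : 1 ≤ n) (A : X →L[𝕜] PiLp 2 Y) {c : ℝ} (hc : 0 < c)
    (h1 : c * (‖A‖ ^ 2 / n) ≤ 1) (ξ : PiLp 2 Y) (k : ℕ) :
    ‖∑ j ∈ Finset.range k, polyAt (normalOp A) (Polynomial.C c * resid c ^ j)
      (((n : 𝕜)⁻¹) • A.adjoint ξ)‖ ≤ √c * ((n : ℝ) ^ (-(1 / 2) : ℝ) * √k * ‖ξ‖) := by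
  have hn0 : (0 : ℝ) < n := by exact_mod_cast hn
  set q : Polynomial ℝ := ∑ j ∈ Finset.range k, Polynomial.C c * resid c ^ j with hq
  have hsum : ∑ j ∈ Finset.range k, polyAt (normalOp A) (Polynomial.C c * resid c ^ j)
      (((n : 𝕜)⁻¹) • A.adjoint ξ) = ((n : 𝕜)⁻¹) • polyAt (normalOp A) q (A.adjoint ξ) := by
    rw [hq, map_sum, sum_apply, Finset.smul_sum]
    exact Finset.sum_congr rfl fun j _ => map_smul _ _ _
  have hbound : ∀ t ∈ Set.Icc 0 (‖A‖ ^ 2 / n), t * q.eval t ^ 2 ≤ c * k := by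
    intro t ht
    have hct : c * t ≤ 1 := (mul_le_mul_of_nonneg_left ht.2 hc.le).trans h1
    have hct0 : 0 ≤ c * t := mul_nonneg hc.le ht.1
    have h2 : t * q.eval t ≤ 1 := by
      rw [eval_sum_resid]
      linarith [pow_nonneg (by linarith : 0 ≤ 1 - c * t) k]
    have h3 : q.eval t = ∑ j ∈ Finset.range k, c * (1 - c * t) ^ j := by
      simp [hq, Polynomial.eval_finsetSum]
    have h4 : 0 ≤ q.eval t := by
      rw [h3]
      exact Finset.sum_nonneg fun j _ => mul_nonneg hc.le (pow_nonneg (by linarith) j)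
    have h5 : q.eval t ≤ c * k := by
      rw [h3]
      calc ∑ j ∈ Finset.range k, c * (1 - c * t) ^ j ≤ ∑ _j ∈ Finset.range k, c := by
            refine Finset.sum_le_sum fun j _ => ?_
            exact mul_le_of_le_one_right hc.le (pow_le_one₀ (by linarith) (by linarith))
        _ = c * k := by simp [mul_comm]
    nlinarith
  rw [hsum, norm_smul, norm_inv, RCLike.norm_natCast]
  calc (n : ℝ)⁻¹ * ‖polyAt (normalOp A) q (A.adjoint ξ)‖
      ≤ (n : ℝ)⁻¹ * (√(n * (c * k)) * ‖ξ‖) := by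
        gcongr
        exact norm_polyAt_adjoint_le hn A q hbound ξ
    _ = _ := by
        rw [Real.sqrt_mul hn0.le, Real.sqrt_mul hc.le, Real.rpow_neg hn0.le, ← Real.sqrt_eq_rpow]
        have : √(n : ℝ) * √n = n := Real.mul_self_sqrt hn0.le
        have hs : 0 < √(n : ℝ) := Real.sqrt_pos.mpr hn0
        nth_rw 1 [← this]
        field_simp

theorem norm_opPow_apply_le (hn : 1 ≤ n) (T : X →L[𝕜] PiLp 2 Y) {ν R : ℝ} (hν : 0 < ν)
    (hT : ‖T‖ ≤ R) (w : X) : ‖opPow (normalOp T) ν w‖ ≤ (R ^ 2) ^ ν * ‖w‖ := by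
  have hn1 : (1 : ℝ) ≤ n := by exact_mod_cast hn
  have h := norm_polyAt_opPow_le (B := normalOp T) (C := normalOp T) (P := 1) (K := (R ^ 2) ^ ν)
    (isPositive_normalOp T) (isPositive_normalOp T) le_rfl (fun _ => rfl)
    (ContinuousLinearMap.norm_id_le) hν 1 (fun t ht => ?_) w
  · simpa using h
  · rw [norm_normalOp] at ht
    have h4 : t ≤ R ^ 2 := by
      refine ht.2.trans ((div_le_self (by positivity) hn1).trans ?_)
      gcongr
    simp only [Polynomial.eval_one, abs_one, one_mul]
    exact Real.rpow_le_rpow ht.1 h4 hν.le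

end SpectralCutoff

/-! ### What the step size thresholds provide -/

section StepSizes

variable {𝕜 : Type*} [RCLike 𝕜]
variable {X : Type*} [NormedAddCommGroup X] [InnerProductSpace 𝕜 X]
variable {n : ℕ} {Y : Fin n → Type*} [∀ i, NormedAddCommGroup (Y i)]
  [∀ i, InnerProductSpace 𝕜 (Y i)]

theorem mul_lt_one_of_ofReal_lt_inv {c x : ℝ} (hc : 0 < c)
    (h : ENNReal.ofReal c < (ENNReal.ofReal x)⁻¹) : c * x < 1 := by
  rcases le_or_gt x 0 with hx | hx
  · nlinarith
  · rw [← ENNReal.ofReal_inv_of_pos hx, ENNReal.ofReal_lt_ofReal_iff (inv_pos.mpr hx)] at h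
    rwa [lt_inv_comm₀ hc hx, ← one_div, lt_div_iff₀ hc, mul_comm] at h

/-- The two alternatives in the threshold correspond to the two entries of the minimum: M copies of
s₀, or a harmonic sum. -/
theorem sum_min_le_of_lt_stepBoundMean (A : X →L[𝕜] PiLp 2 Y) {c : ℝ} {M : ℕ}
    (hM : 1 ≤ M) (hc : 0 < c) (h : ENNReal.ofReal c < stepBoundMean A M) :
    ∑ r ∈ Finset.range M, c * maxNormSq A * min (c * (‖A‖ ^ 2 / n)) (1 / (1 + 4 * (r : ℝ)))
      ≤ 1 / 4 := by
  have hL0 := maxNormSq_nonneg A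
  set L := maxNormSq A
  rw [stepBoundMean, lt_max_iff] at h
  rcases h with h | h
  · have h1 := mul_lt_one_of_ofReal_lt_inv hc h
    have h2 : (c * (‖A‖ * √(5 * L * (n : ℝ)⁻¹ * M))) ^ 2 ≤ 1 := pow_le_one₀ (by positivity) h1.le
    rw [mul_pow, mul_pow, Real.sq_sqrt (by positivity)] at h2
    calc _ ≤ ∑ _r ∈ Finset.range M, c * L * (c * (‖A‖ ^ 2 / n)) := by
          refine Finset.sum_le_sum fun r _ => ?_
          exact mul_le_mul_of_nonneg_left (min_le_left _ _) (by positivity)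
      _ = c ^ 2 * (‖A‖ ^ 2 * (5 * L * (n : ℝ)⁻¹ * M)) / 5 := by
          simp only [Finset.sum_const, Finset.card_range, nsmul_eq_mul]
          ring
      _ ≤ 1 / 4 := by linarith
  · have h1 := mul_lt_one_of_ofReal_lt_inv hc h
    calc _ ≤ ∑ r ∈ Finset.range M, c * L * (1 / (1 + 4 * (r : ℝ))) := by
          refine Finset.sum_le_sum fun r _ => ?_
          exact mul_le_mul_of_nonneg_left (min_le_right _ _) (by positivity)
      _ ≤ c * L * ((10 + Real.log M) / 4) := by
          rw [← Finset.mul_sum]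
          exact mul_le_mul_of_nonneg_left (sum_inv_one_add_four_mul_le hM) (by positivity)
      _ ≤ 1 / 4 := by linarith

/-- ‖A‖ ≤ n√L makes the logarithm at least 2, which turns 100 into 200. -/
theorem mul_le_one_of_lt_stepBoundPath (A : X →L[𝕜] PiLp 2 Y) {c : ℝ} {M : ℕ} (hn : 1 ≤ n)
    (hc : 0 < c) (h : ENNReal.ofReal c < stepBoundPath A M) :
    200 * (c * √(maxNormSq A) * ‖A‖ * M) ≤ 1 := by
  have hL0 := maxNormSq_nonneg A
  have hAL := norm_sq_le_mul_maxNormSq A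
  set L := maxNormSq A
  have hn1 : (1 : ℝ) ≤ n := by exact_mod_cast hn
  rcases eq_or_lt_of_le (norm_nonneg A) with h0 | h0
  · rw [← h0]; simp
  have h1 := mul_lt_one_of_ofReal_lt_inv hc h
  have hA : ‖A‖ ≤ n * √L := by
    refine le_of_sq_le_sq ?_ (by positivity)
    rw [mul_pow, Real.sq_sqrt hL0]
    refine hAL.trans (mul_le_mul_of_nonneg_right ?_ hL0)
    nlinarith
  have hlog : 2 ≤ Real.log (2 * Real.exp 2 * n * √L * ‖A‖⁻¹) := by
    have h2 : 1 ≤ n * √L * ‖A‖⁻¹ := by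
      rw [← div_eq_mul_inv, one_le_div h0]
      exact hA
    rw [Real.le_log_iff_exp_le (by
      have : 0 < 2 * Real.exp 2 * (n * √L * ‖A‖⁻¹) := by positivity
      calc (0 : ℝ) < 2 * Real.exp 2 * (n * √L * ‖A‖⁻¹) := this
        _ = _ := by ring)]
    calc Real.exp 2 ≤ 2 * Real.exp 2 * (n * √L * ‖A‖⁻¹) := by
          nlinarith [Real.exp_pos 2]
      _ = _ := by ring
  have h3 : 0 ≤ c * √L * ‖A‖ * M := by positivity
  nlinarith

end StepSizes

/-! ### The deterministic error of both methods -/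

section MethodOperator

variable {𝕜 : Type*} [RCLike 𝕜]
variable {X : Type*} [NormedAddCommGroup X] [InnerProductSpace 𝕜 X] [CompleteSpace X]
variable {n : ℕ} {Y : Fin n → Type*} [∀ i, NormedAddCommGroup (Y i)]
  [∀ i, InnerProductSpace 𝕜 (Y i)] [∀ i, CompleteSpace (Y i)]

theorem IsMethodOperator.exists_isSpectralCutoff {T A : X →L[𝕜] PiLp 2 Y} {a b δ : ℝ} (ha : 0 ≤ a)
    (h : IsMethodOperator T A a b δ) : ∃ P, IsSpectralCutoff T A P (a * δ ^ b) := by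
  rcases ha.eq_or_lt with rfl | ha'
  · rw [h.1 rfl, zero_mul]
    exact ⟨1, isSpectralCutoff_one T⟩
  · exact (h.2 ha').exists_isSpectralCutoff

theorem noiseTerm_nonneg {a ν δ : ℝ} (hδ : 0 ≤ δ) (n k : ℕ) : 0 ≤ noiseTerm a ν δ n k := by
  rw [noiseTerm]
  split_ifs <;> positivity

/-- The error of the Landweber iteration with a spectral cutoff under a source condition. -/
theorem norm_landweberError_le {T A : X →L[𝕜] PiLp 2 Y} {w x₀ xd : X} {ξ : PiLp 2 Y}
    {a ν δ c : ℝ} (hn : 1 ≤ n) (ha : 0 ≤ a) (hν : 0 < ν) (hc : 0 < c)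
    (h1 : c * (‖A‖ ^ 2 / n) ≤ 1) (hξ : ‖ξ‖ = δ) (hA : IsMethodOperator T A a (1 + 2 * ν)⁻¹ δ)
    (hxd : xd - x₀ = opPow (normalOp T) ν w) {k : ℕ} (hk : 1 ≤ k) :
    ‖landweberError (normalOp A) c (((n : 𝕜)⁻¹) • A.adjoint ξ) (x₀ - xd) k‖
      ≤ (ν / c) ^ ν * ‖w‖ * (k : ℝ) ^ (-ν)
        + ((a ^ 2) ^ ν * ‖w‖ + √c + a⁻¹) * noiseTerm a ν δ n k := by
  have hn1 : (1 : ℝ) ≤ n := by exact_mod_cast hn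
  have hδ : 0 ≤ δ := hξ ▸ norm_nonneg ξ
  obtain ⟨P, hP⟩ := hA.exists_isSpectralCutoff ha
  set b := (1 + 2 * ν)⁻¹ with hb
  have hN := noiseTerm_nonneg (a := a) (ν := ν) hδ n k
  have he : x₀ - xd = -opPow (normalOp T) ν w := by rw [← hxd]; abel
  have hsource := hP.norm_polyAt_resid_le (by positivity) hν hc h1 w hk
  have hnoise : ‖∑ j ∈ Finset.range k, polyAt (normalOp A) (Polynomial.C c * resid c ^ j)
      (((n : 𝕜)⁻¹) • A.adjoint ξ)‖ ≤ (√c + a⁻¹) * noiseTerm a ν δ n k := by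
    rcases ha.eq_or_lt with rfl | ha'
    · refine (norm_noise_le_sqrt hn A hc h1 ξ k).trans_eq ?_
      rw [noiseTerm, if_neg (lt_irrefl _), hξ]
      simp
    · have hτ : 0 < a * δ ^ b := (hA.2 ha').1
      -- The truncation level is positive and 0^b = 0.
      have hδ0 : 0 < δ := by
        refine hδ.lt_of_ne fun h0 => ?_
        rw [← h0, Real.zero_rpow (by positivity), mul_zero] at hτ
        exact lt_irrefl _ hτ
      refine (hP.norm_noise_le_div hτ hc h1 ξ k).trans ?_
      -- The choice b = 1/(1 + 2ν) balances the exponents: 1 - b = 2νb.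
      have e : δ / (a * δ ^ b) = a⁻¹ * δ ^ (2 * ν / (1 + 2 * ν)) := by
        have hexp : 2 * ν / (1 + 2 * ν) = 1 - b := by rw [hb]; field_simp; ring
        rw [hexp, Real.rpow_sub hδ0, Real.rpow_one]
        field_simp
      rw [hξ, e, noiseTerm, if_pos ha']
      have : 0 ≤ δ ^ (2 * ν / (1 + 2 * ν)) := by positivity
      nlinarith [mul_nonneg (Real.sqrt_nonneg c) this]
  have hcut : ((a * δ ^ b) ^ 2 / n) ^ ν ≤ (a ^ 2) ^ ν * noiseTerm a ν δ n k := by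
    rcases ha.eq_or_lt with rfl | ha'
    · simp [Real.zero_rpow hν.ne']
    · rw [noiseTerm, if_pos ha']
      calc ((a * δ ^ b) ^ 2 / n) ^ ν ≤ ((a * δ ^ b) ^ 2) ^ ν :=
            Real.rpow_le_rpow (by positivity) (div_le_self (by positivity) hn1) hν.le
        _ = (a ^ 2) ^ ν * ((δ ^ b) ^ 2) ^ ν := by
            rw [mul_pow, Real.mul_rpow (by positivity) (by positivity)]
        _ = _ := by
            rw [← Real.rpow_natCast (δ ^ b) 2, ← Real.rpow_mul hδ, ← Real.rpow_mul hδ]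
            congr 2
            rw [hb]
            push_cast
            field_simp
  rw [landweberError, he, map_neg]
  refine (norm_add_le _ _).trans ?_
  rw [norm_neg]
  have hcut' := mul_le_mul_of_nonneg_right hcut (norm_nonneg w)
  linarith

end MethodOperator

/-! ### Comparison with the stated rates -/

section Rates

/-- For ν < 1/2 the logarithm is absorbed by k^η/η with η = 1/2 - ν. Otherwise 5 ≤ 8 ln 2 absorbs
the constant, and the inverse (0 at ν = 1/2) only enlarges the bound. -/
theorem log_div_sqrt_le {ν : ℝ} {k : ℕ} (hk : 1 ≤ k) (h : ν < 1 / 2 ∨ 2 ≤ k) :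
    (5 + Real.log k) / √(1 + k)
      ≤ (9 + |(1 / 2 - ν)⁻¹|) * ((k : ℝ) ^ (-(1 / 2) : ℝ) * powLog k (max (1 / 2 - ν) 0)) := by
  have hk1 : (1 : ℝ) ≤ k := by exact_mod_cast hk
  have hk0 : (0 : ℝ) < k := by linarith
  have hlog0 : 0 ≤ Real.log k := Real.log_nonneg hk1
  have hsq : (k : ℝ) ^ (-(1 / 2) : ℝ) = 1 / √k := by
    rw [Real.rpow_neg hk0.le, ← Real.sqrt_eq_rpow, one_div]
  have hab := abs_nonneg ((1 / 2 - ν)⁻¹)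
  have hmain : 5 + Real.log k ≤ (9 + |(1 / 2 - ν)⁻¹|) * powLog k (max (1 / 2 - ν) 0) := by
    rcases lt_or_ge ν (1 / 2) with hν | hν
    · have hη : 0 < 1 / 2 - ν := by linarith
      rw [powLog, max_eq_left hη.le, if_neg hη.ne', abs_of_pos (inv_pos.mpr hη)]
      have h1 := Real.log_le_rpow_div hk0.le hη
      have h2 : 1 ≤ (k : ℝ) ^ (1 / 2 - ν) := Real.one_le_rpow hk1 hη.le
      rw [div_eq_mul_inv] at h1
      linarith
    · rw [powLog, max_eq_right (by linarith), if_pos rfl]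
      have hk2 : (2 : ℝ) ≤ k := by
        rcases h with h | h
        · linarith
        · exact_mod_cast h
      have h1 : Real.log 2 ≤ Real.log k := Real.log_le_log (by norm_num) hk2
      have h2 := Real.log_two_gt_d9
      nlinarith [mul_nonneg hab hlog0]
  have hp : 0 ≤ (9 + |(1 / 2 - ν)⁻¹|) * powLog k (max (1 / 2 - ν) 0) := by linarith
  calc (5 + Real.log k) / √(1 + k) ≤ (5 + Real.log k) / √k := by
        gcongr
        linarith
    _ ≤ ((9 + |(1 / 2 - ν)⁻¹|) * powLog k (max (1 / 2 - ν) 0)) / √k := by gcongr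
    _ = _ := by rw [hsq]; ring

theorem rpow_neg_le_mul_powLog {ν : ℝ} {k : ℕ} (hk : 1 ≤ k) (h : ν < 1 / 2 ∨ 2 ≤ k) :
    (k : ℝ) ^ (-ν) ≤ 2 * ((k : ℝ) ^ (-(1 / 2) : ℝ) * powLog k (max (1 / 2 - ν) 0)) := by
  have hk1 : (1 : ℝ) ≤ k := by exact_mod_cast hk
  have hk0 : (0 : ℝ) < k := by linarith
  rcases lt_or_ge ν (1 / 2) with hν | hν
  · have hη : 0 < 1 / 2 - ν := by linarith
    rw [powLog, max_eq_left hη.le, if_neg hη.ne', ← Real.rpow_add hk0,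
      show -(1 / 2) + (1 / 2 - ν) = -ν by ring]
    linarith [Real.rpow_nonneg hk0.le (-ν)]
  · rw [powLog, max_eq_right (by linarith), if_pos rfl]
    have hk2 : (2 : ℝ) ≤ k := by
      rcases h with h | h
      · linarith
      · exact_mod_cast h
    have h1 : Real.log 2 ≤ Real.log k := Real.log_le_log (by norm_num) hk2
    have h2 := Real.log_two_gt_d9
    have h3 : (k : ℝ) ^ (-ν) ≤ (k : ℝ) ^ (-(1 / 2) : ℝ) :=
      Real.rpow_le_rpow_of_exponent_le hk1 (by linarith)
    nlinarith [Real.rpow_nonneg hk0.le (-(1 / 2) : ℝ)]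

theorem sqrt_div_le_mul_rpow {C ν : ℝ} {k : ℕ} (hk : 1 ≤ k) :
    √(C / (1 + k)) ≤ √C * (k : ℝ) ^ (-min ν (1 / 2)) := by
  have hk1 : (1 : ℝ) ≤ k := by exact_mod_cast hk
  have hk0 : (0 : ℝ) < k := by linarith
  rw [Real.sqrt_div' _ (by positivity), div_eq_mul_inv]
  refine mul_le_mul_of_nonneg_left ?_ (Real.sqrt_nonneg _)
  calc (√(1 + k : ℝ))⁻¹ ≤ (√k)⁻¹ := by
        gcongr
        linarith
    _ = (k : ℝ) ^ (-(1 / 2) : ℝ) := by rw [Real.rpow_neg hk0.le, ← Real.sqrt_eq_rpow]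
    _ ≤ _ := Real.rpow_le_rpow_of_exponent_le hk1 (neg_le_neg (min_le_right _ _))

end Rates

end SVRG

end

/-! ### The convergence rates -/

theorem theorem2p1 {𝕜 : Type*} [RCLike 𝕜]
    (ν a c₀ R ρ : ℝ) (M : ℕ) (hν : 0 < ν) (ha : 0 ≤ a) (hc₀ : 0 < c₀) (hM : 1 ≤ M) :
    ∃ c : ℝ, ∀ (n : ℕ) (_ : 1 ≤ n)
      (X : Type u) [NormedAddCommGroup X] [InnerProductSpace 𝕜 X] [CompleteSpace X]
      (Y : Fin n → Type v) [∀ i, NormedAddCommGroup (Y i)] [∀ i, InnerProductSpace 𝕜 (Y i)]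
      [∀ i, CompleteSpace (Y i)]
      (Ω : Type w) [MeasurableSpace Ω] (P : Measure Ω) [IsProbabilityMeasure P]
      (idx : ℕ → Ω → Fin n) (T A : X →L[𝕜] PiLp 2 Y) (yd yδ : PiLp 2 Y) (x₀ xd w : X) (δ : ℝ),
      SVRG.IsUniformSampling P idx →
      ‖T‖ ≤ R → ‖w‖ ≤ ρ →
      SVRG.IsMinNormSolution T yd x₀ xd →
      ‖yδ - yd‖ = δ → δ < 1 →
      c₀ * SVRG.maxNormSq A ≤ 1 →
      SVRG.SourceCondition T x₀ xd w ν →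
      SVRG.IsMethodOperator T A a (1 + 2 * ν)⁻¹ δ →
      (ENNReal.ofReal c₀ < SVRG.stepBoundMean A M → ∀ k : ℕ, 1 ≤ k →
        Integrable (fun ω =>
          ‖SVRG.iterate A yδ x₀ (fun _ => c₀) M (fun j => idx j ω) k - xd‖ ^ 2) P ∧
        √(∫ ω, ‖SVRG.iterate A yδ x₀ (fun _ => c₀) M (fun j => idx j ω) k - xd‖ ^ 2 ∂P) ≤
          c * (k : ℝ) ^ (-min ν (1 / 2)) + c * SVRG.noiseTerm a ν δ n k) ∧
      (ENNReal.ofReal c₀ < SVRG.stepBoundPath A M → ∀ k : ℕ, 1 ≤ k → (ν < 1 / 2 ∨ 2 ≤ k) →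
        ∀ ω, ‖SVRG.iterate A yδ x₀ (fun _ => c₀) M (fun j => idx j ω) k - xd‖ ≤
          √n * c * ((k : ℝ) ^ (-(1 / 2) : ℝ) * SVRG.powLog k (max (1 / 2 - ν) 0)) +
            c * SVRG.noiseTerm a ν δ n k) := by
  -- D₀ bounds ‖A‖‖x₀ - x†‖ + δ by the source condition and δ < 1. C₁ and C₂ serve the Landweber
  -- error, C₃ and C₄ the stochastic part in mean square and on a path. In C₂ the convention 0⁻¹ = 0
  -- covers a = 0.
  set D₀ : ℝ := R * ((R ^ 2) ^ ν * ρ) + 1 with hD₀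
  set C₁ : ℝ := (ν / c₀) ^ ν * ρ with hC₁
  set C₂ : ℝ := (a ^ 2) ^ ν * ρ + √c₀ + a⁻¹ with hC₂
  set C₃ : ℝ := √(SVRG.meanConst c₀ M * D₀ ^ 2) with hC₃
  set C₄ : ℝ := 8 * √c₀ * M * D₀ * (9 + |(1 / 2 - ν)⁻¹|) with hC₄
  refine ⟨2 * C₁ + C₂ + C₃ + C₄, ?_⟩
  intro n hn X _ _ _ Y _ _ _ Ω _ P _ idx T A yd yδ x₀ xd w δ hidx hT hw hmin hδ _ hL hsrc hmeth
  have hn1 : (1 : ℝ) ≤ n := by exact_mod_cast hn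
  have hδ0 : 0 ≤ δ := hδ ▸ norm_nonneg _
  have hR : 0 ≤ R := (norm_nonneg T).trans hT
  have hρ : 0 ≤ ρ := (norm_nonneg w).trans hw
  have hC₁0 : 0 ≤ C₁ := by positivity
  have hC₂0 : 0 ≤ C₂ := by positivity
  have hC₃0 : 0 ≤ C₃ := Real.sqrt_nonneg _
  have hD₀0 : 0 ≤ D₀ := by positivity
  have hC₄0 : 0 ≤ C₄ := by positivity
  obtain ⟨Q, hQ⟩ := hmeth.exists_isSpectralCutoff ha
  have hxd : A.adjoint (A xd) = A.adjoint yd := by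
    rw [hQ.adjoint_apply_solution hn, hmin.1]
  have hstep : c₀ * (‖A‖ ^ 2 / n) ≤ 1 := (SVRG.step_mul_norm_sq_le hn hc₀.le).trans hL
  have hdata : ‖A‖ * ‖x₀ - xd‖ + ‖yδ - yd‖ ≤ D₀ := by
    have h1 : ‖x₀ - xd‖ ≤ (R ^ 2) ^ ν * ρ := by
      rw [norm_sub_rev, hsrc.2]
      exact (SVRG.norm_opPow_apply_le hn T hν hT w).trans (by gcongr)
    have h2 : ‖A‖ ≤ R := hQ.norm_le.trans hT
    have h3 : ‖yδ - yd‖ ≤ 1 := by linarith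
    exact add_le_add (mul_le_mul h2 h1 (norm_nonneg _) hR) h3
  have hdata0 : 0 ≤ ‖A‖ * ‖x₀ - xd‖ + ‖yδ - yd‖ := by positivity
  have hdet : ∀ k : ℕ, 1 ≤ k → ‖SVRG.landweberError (SVRG.normalOp A) c₀
      (((n : 𝕜)⁻¹) • A.adjoint (yδ - yd)) (x₀ - xd) k‖
      ≤ C₁ * (k : ℝ) ^ (-ν) + C₂ * SVRG.noiseTerm a ν δ n k := by
    intro k hk
    have hN := SVRG.noiseTerm_nonneg (a := a) (ν := ν) hδ0 n k
    refine (SVRG.norm_landweberError_le hn ha hν hc₀ hstep hδ hmeth hsrc.2 hk).trans ?_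
    rw [hC₁, hC₂]
    gcongr
  refine ⟨fun hc k hk => ⟨SVRG.integrable_norm_sq_error hn hidx A yδ x₀ xd c₀ M k, ?_⟩,
    fun hc k hk hk' ω => ?_⟩
  · have hk1 : (1 : ℝ) ≤ k := by exact_mod_cast hk
    have hN := SVRG.noiseTerm_nonneg (a := a) (ν := ν) hδ0 n k
    have hmean := SVRG.integral_norm_sq_error_le hn hidx hxd hM hc₀.le hL
      (SVRG.sum_min_le_of_lt_stepBoundMean A hM hc₀ hc) yδ x₀ k
    set d := ‖SVRG.landweberError (SVRG.normalOp A) c₀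
      (((n : 𝕜)⁻¹) • A.adjoint (yδ - yd)) (x₀ - xd) k‖ with hd
    have hd0 : 0 ≤ d := norm_nonneg _
    have hK0 : 0 ≤ SVRG.meanConst c₀ M := by rw [SVRG.meanConst]; positivity
    have h1 : √(∫ ω, ‖SVRG.iterate A yδ x₀ (fun _ => c₀) M (fun j => idx j ω) k - xd‖ ^ 2 ∂P)
        ≤ d + C₃ * (k : ℝ) ^ (-min ν (1 / 2)) := by
      calc _ ≤ √(d ^ 2 + SVRG.meanConst c₀ M * D₀ ^ 2 / (1 + k)) := by
            refine Real.sqrt_le_sqrt (hmean.trans ?_)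
            gcongr
        _ ≤ √(d ^ 2) + √(SVRG.meanConst c₀ M * D₀ ^ 2 / (1 + k)) :=
            SVRG.sqrt_add_le_sqrt_add_sqrt (by positivity) (by positivity)
        _ ≤ _ := by
            rw [Real.sqrt_sq hd0]
            exact add_le_add le_rfl (SVRG.sqrt_div_le_mul_rpow hk)
    have h2 : (k : ℝ) ^ (-ν) ≤ (k : ℝ) ^ (-min ν (1 / 2)) :=
      Real.rpow_le_rpow_of_exponent_le hk1 (neg_le_neg (min_le_left _ _))
    have h3 : 0 ≤ (k : ℝ) ^ (-min ν (1 / 2)) := by positivity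
    calc _ ≤ d + C₃ * (k : ℝ) ^ (-min ν (1 / 2)) := h1
      _ ≤ C₁ * (k : ℝ) ^ (-min ν (1 / 2)) + C₂ * SVRG.noiseTerm a ν δ n k
          + C₃ * (k : ℝ) ^ (-min ν (1 / 2)) := by
          have := mul_le_mul_of_nonneg_left h2 hC₁0
          linarith [hdet k hk]
      _ = (C₁ + C₃) * (k : ℝ) ^ (-min ν (1 / 2)) + C₂ * SVRG.noiseTerm a ν δ n k := by ring
      _ ≤ _ := add_le_add (mul_le_mul_of_nonneg_right (by linarith) h3)
          (mul_le_mul_of_nonneg_right (by linarith) hN)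
  · have hN := SVRG.noiseTerm_nonneg (a := a) (ν := ν) hδ0 n k
    have hpath := SVRG.norm_error_sub_landweberError_le hn hxd hM hc₀.le hL
      (SVRG.mul_le_one_of_lt_stepBoundPath A hn hc₀ hc) yδ x₀ (fun j => idx j ω) k
    set e := SVRG.iterate A yδ x₀ (fun _ => c₀) M (fun j => idx j ω) k - xd
    set l := SVRG.landweberError (SVRG.normalOp A) c₀
      (((n : 𝕜)⁻¹) • A.adjoint (yδ - yd)) (x₀ - xd) k
    set r := (k : ℝ) ^ (-(1 / 2) : ℝ) * SVRG.powLog k (max (1 / 2 - ν) 0)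
    have hlog : (5 + Real.log k) / √(1 + k) ≤ (9 + |(1 / 2 - ν)⁻¹|) * r :=
      SVRG.log_div_sqrt_le hk hk'
    have hrate : (k : ℝ) ^ (-ν) ≤ 2 * r := SVRG.rpow_neg_le_mul_powLog hk hk'
    have hr0 : 0 ≤ r := by linarith [Real.rpow_nonneg (k.cast_nonneg : (0 : ℝ) ≤ k) (-ν)]
    -- The Landweber rate carries no √n; it is enlarged to share the √n of the path bound.
    have hsn : 1 ≤ √(n : ℝ) := Real.one_le_sqrt.mpr hn1
    have h1 : ‖e - l‖ ≤ √n * (C₄ * r) := by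
      refine hpath.trans ?_
      calc √n * (8 * √c₀ * M * (‖A‖ * ‖x₀ - xd‖ + ‖yδ - yd‖)) * ((5 + Real.log k) / √(1 + k))
          ≤ √n * (8 * √c₀ * M * D₀) * ((9 + |(1 / 2 - ν)⁻¹|) * r) := by
            have : 0 ≤ (5 + Real.log k) / √(1 + k) :=
              div_nonneg (by linarith [Real.log_natCast_nonneg k]) (Real.sqrt_nonneg _)
            gcongr
        _ = _ := by ring
    have h2 : ‖l‖ ≤ √n * (2 * C₁ * r) + C₂ * SVRG.noiseTerm a ν δ n k := by
      refine (hdet k hk).trans (add_le_add ?_ le_rfl)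
      have h3 : C₁ * (k : ℝ) ^ (-ν) ≤ C₁ * (2 * r) := by gcongr
      have h4 : 0 ≤ 2 * C₁ * r := by positivity
      nlinarith
    calc ‖e‖ ≤ ‖e - l‖ + ‖l‖ := by
          have := norm_add_le (e - l) l
          rwa [sub_add_cancel] at this
      _ ≤ √n * (2 * C₁ + C₄) * r + C₂ * SVRG.noiseTerm a ν δ n k := by linarith
      _ ≤ _ := add_le_add (mul_le_mul_of_nonneg_right
            (mul_le_mul_of_nonneg_left (by linarith) (Real.sqrt_nonneg _)) hr0)
          (mul_le_mul_of_nonneg_right (by linarith) hN)
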